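/- Let $p,r>1$, let $q=0$ or $q>1$, and let $A_0,B_0>0$. Let $f\in C^2(\mathbb R)$ and $g\in C^1(\mathbb R)$ be compactly supported and not both identically zero. For $\varepsilon>0$ consider $$u_{tt}-u_{xx}=A_0|u_t|^p|u|^q+B_0|u|^r\ \text{ in }\mathbb R\times(0,T),\qquad u(x,0)=\varepsilon f(x),\quad u_t(x,0)=\varepsilon g(x)\ \ (x\in\mathbb R),$$ (with $|u|^0=1$ if $q=0$), and let the lifespan $T(\varepsilon)\in[0,\infty]$ be the supremum of all $T>0$ for which a classical solution $u\in C^2(\mathbb R\times[0,T))$ exists. Write $T(\varepsilon)\gtrsim\varepsilon^{-\theta}$ if there are $\varepsilon_0,C_1>0$, independent of $\varepsilon$, with $C_1\varepsilon^{-\theta}\le T(\varepsilon)$ for all $0<\varepsilon\le\varepsilon_0$, and $T(\varepsilon)\sim\varepsilon^{-\theta}$ if there are $\varepsilon_0,C_1,C_2>0$, independent of $\varepsilon$, with $C_1\varepsilon^{-\theta}\le T(\varepsilon)\le C_2\varepsilon^{-\theta}$ for all $0<\varepsilon\le\varepsilon_0$. (1) Suppose $\int_{\mathbb R}g\,dx\ne0$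 and let $\theta=\min\{p+q-1,(r-1)/2\}$. Then $T(\varepsilon)\gtrsim\varepsilon^{-\theta}$. Moreover $T(\varepsilon)\sim\varepsilon^{-\theta}$, where in the case that both $\int_{\mathbb R}g\,dx<0$ and $p+q<\frac{r+1}2$ it is assumed in addition that, for some $x\in\mathbb R$, $f(x)+\int_x^\infty g\,dy>0$ or $f(x)+\int_{-\infty}^x g\,dy>0$. (2) If $\int_{\mathbb R}g\,dx=0$ and it is not the case that $\frac{r+1}2<p+q<r$, then $T(\varepsilon)\sim\varepsilon^{-\min\{p+q-1,\;r(r-1)/(r+1)\}}$. (3) If $\int_{\mathbb R}g\,dx=0$ and $\frac{r+1}2<p+q<r$, then $T(\varepsilon)\sim\varepsilon^{-(p+q)(r-1)/(r+1)}$ (the "generalized combined effect"). This is strictly shorter than in (2): $\frac{(p+q)(r-1)}{r+1}<\min\{p+q-1,\frac{r(r-1)}{r+1}\}$, and for every $c>0$ one has $T(\varepsilon)<c\,\varepsilon^{-\min\{p+q-1,\,r(r-1)/(r+1)\}}$ for all sufficiently small $\varepsilon>0$. -/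

import Mathlib

open MeasureTheory Set Filter Topology
open scoped ENNReal

noncomputable section

/-- `u` is a classical solution, of class `C²` on `ℝ × [0, T)` (up to the initial line), of
`u_tt - u_xx = A |u_t|^p |u|^q + B |u|^r` in `ℝ × (0, T)` with `u(x,0) = φ x`, `u_t(x,0) = ψ x`.
The first argument of `u` is the position `x`, the second one is the time `t`. -/
structure IsClassicalSolution (p q r A B : ℝ) (φ ψ : ℝ → ℝ) (T : ℝ) (u : ℝ → ℝ → ℝ) : Prop where
  contDiffOn : ContDiffOn ℝ 2 (fun z : ℝ × ℝ => u z.1 z.2) (univ ×ˢ Ico 0 T)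
  equation : ∀ x t : ℝ, 0 < t → t < T →
    iteratedDeriv 2 (fun s => u x s) t - iteratedDeriv 2 (fun y => u y t) x
      = A * |deriv (fun s => u x s) t| ^ p * |u x t| ^ q + B * |u x t| ^ r
  initial_value : ∀ x : ℝ, u x 0 = φ x
  initial_speed : ∀ x : ℝ, HasDerivWithinAt (fun s => u x s) (ψ x) (Ici 0) 0

/-- The lifespan `T(ε)`: the supremum (possibly `∞`) of all times `T > 0` such that a classical
solution with initial data `(ε f, ε g)` exists on `ℝ × [0, T)`. -/
def lifespan (p q r A B : ℝ) (f g : ℝ → ℝ) (ε : ℝ) : ℝ≥0∞ :=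
  sSup {τ : ℝ≥0∞ | ∃ T : ℝ, 0 < T ∧ τ = ENNReal.ofReal T ∧
    ∃ u : ℝ → ℝ → ℝ, IsClassicalSolution p q r A B (fun x => ε * f x) (fun x => ε * g x) T u}

/-- `L(ε) ≥ C₁ ε^{-θ}` for all small `ε > 0`, with a constant `C₁ > 0` independent of `ε`. -/
def LowerPowerBound (L : ℝ → ℝ≥0∞) (θ : ℝ) : Prop :=
  ∃ ε₀ > 0, ∃ C₁ > 0, ∀ ε : ℝ, 0 < ε → ε ≤ ε₀ → ENNReal.ofReal (C₁ * ε ^ (-θ)) ≤ L ε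

/-- `L(ε) ∼ C ε^{-θ}`: `C₁ ε^{-θ} ≤ L(ε) ≤ C₂ ε^{-θ}` for all small `ε > 0`, with constants
`C₁, C₂ > 0` independent of `ε`. -/
def SimPower (L : ℝ → ℝ≥0∞) (θ : ℝ) : Prop :=
  ∃ ε₀ > 0, ∃ C₁ > 0, ∃ C₂ > 0, ∀ ε : ℝ, 0 < ε → ε ≤ ε₀ →
    ENNReal.ofReal (C₁ * ε ^ (-θ)) ≤ L ε ∧ L ε ≤ ENNReal.ofReal (C₂ * ε ^ (-θ))

end

/-! A solution is d'Alembert's free wave `ε (P(x + t) + Q(x - t))` plus the Duhamel term of a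
non-negative source. Since `P` and `Q` are constant outside `[-R, R]`, the free wave is the constant
`ε ∫ g / 2`, with zero velocity, inside the light cone; it varies only in a strip of fixed width
around the cone. Up to time `T`, a source of size `k` in the strip and `l` inside the cone adds at
most `T (3 R k + T l)` to `u`.

Lower bounds. The source solves a Volterra equation, solvable on all of `[0, T]` once the
nonlinearity is cut off (`exists_volterra_solution`). If the Duhamel term is at most `δ`, then
`|u_t| ≤ δ / T` inside the cone, and the bootstrap closes when `T (3 R k + T l) ≤ δ`
(`exists_controlled_solution`). For `∫ g ≠ 0` take `δ ~ ε`: this asks that `T ε^(p+q-1)` and `T²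
ε^(r-1)` be small. For `∫ g = 0` the interior sees only `δ ~ T ε^m` with `m = min (p+q) r`: this
asks that `T ε^(p+q-1)` and `T^(r+1) ε^(m(r-1))` be small.

Upper bounds. Positivity of the source makes `u_t ± u_x` monotone along characteristics and `u`
superadditive on characteristic rectangles. A positive value `N` is doubled by `|u|^r` inside the
cone within a time of order `N^(-(r-1)/2)` (`lifespan_le_of_pos_inside`), and by `|u_t|^p |u|^q` in
the strip within a time of order `N^(-(p+q-1))` (`lifespan_le_of_pos_level`), because `u` has to
rise from `0` to `N` across a strip of bounded width. The doubling times form a geometric series, so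
each mechanism bounds the lifespan.

If `∫ g < 0` and `(r-1)/2 ≤ p+q-1`, the source first drives `u` to a positive value inside the cone
(`pos_of_neg_corner`). If `∫ g = 0`, the strip feeds the edge of the cone, where `u` either reaches
order `ε` or grows like `ε^m t`, with `m = p+q` or `m = r` (`exists_growth`). Waiting a time
`ε^(-θ)` and then doubling `ε^(m-θ)` by `|u|^r` balance at `θ = m(r-1)/(r+1)`; the choice `m = p+q`
is the generalized combined effect: the mixed term feeds and the pure power blows up. -/

/-! ### Duhamel's formula: continuity and linearity -/

/-- Integral of a source along the characteristic `y + s = x + t`. -/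
noncomputable def charA (F : ℝ → ℝ → ℝ) (x t : ℝ) : ℝ := ∫ s in (0 : ℝ)..t, F (x + t - s) s

/-- Integral of a source along the characteristic `y - s = x - t`. -/
noncomputable def charB (F : ℝ → ℝ → ℝ) (x t : ℝ) : ℝ := ∫ s in (0 : ℝ)..t, F (x - t + s) s

/-- Time derivative of the Duhamel term of the one-dimensional wave equation. -/
noncomputable def duhamelVel (F : ℝ → ℝ → ℝ) (x t : ℝ) : ℝ := (charA F x t + charB F x t) / 2

/-- Duhamel term of the one-dimensional wave equation. -/
noncomputable def duhamel (F : ℝ → ℝ → ℝ) (x t : ℝ) : ℝ := ∫ s in (0 : ℝ)..t, duhamelVel F x s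

theorem continuous_charA {F : ℝ → ℝ → ℝ} (hF : Continuous (Function.uncurry F)) :
    Continuous (Function.uncurry (charA F)) := by
  refine intervalIntegral.continuous_parametric_intervalIntegral_of_continuous
    (f := fun (z : ℝ × ℝ) s => F (z.1 + z.2 - s) s) (s := fun z => z.2) ?_ continuous_snd
  exact hF.comp (f := fun w : (ℝ × ℝ) × ℝ => (w.1.1 + w.1.2 - w.2, w.2)) (by fun_prop)

theorem continuous_charB {F : ℝ → ℝ → ℝ} (hF : Continuous (Function.uncurry F)) :
    Continuous (Function.uncurry (charB F)) := by
  refine intervalIntegral.continuous_parametric_intervalIntegral_of_continuous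
    (f := fun (z : ℝ × ℝ) s => F (z.1 - z.2 + s) s) (s := fun z => z.2) ?_ continuous_snd
  exact hF.comp (f := fun w : (ℝ × ℝ) × ℝ => (w.1.1 - w.1.2 + w.2, w.2)) (by fun_prop)

theorem continuous_duhamelVel {F : ℝ → ℝ → ℝ} (hF : Continuous (Function.uncurry F)) :
    Continuous (Function.uncurry (duhamelVel F)) :=
  ((continuous_charA hF).add (continuous_charB hF)).div_const 2

theorem continuous_duhamel {F : ℝ → ℝ → ℝ} (hF : Continuous (Function.uncurry F)) :
    Continuous (Function.uncurry (duhamel F)) := by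
  refine intervalIntegral.continuous_parametric_intervalIntegral_of_continuous
    (f := fun (z : ℝ × ℝ) s => duhamelVel F z.1 s) (s := fun z => z.2) ?_ continuous_snd
  exact (continuous_duhamelVel hF).comp (f := fun w : (ℝ × ℝ) × ℝ => (w.1.1, w.2)) (by fun_prop)

theorem continuous_along {F : ℝ → ℝ → ℝ} (hF : Continuous (Function.uncurry F)) {k l : ℝ → ℝ}
    (hk : Continuous k) (hl : Continuous l) : Continuous fun s => F (k s) (l s) :=
  hF.comp (hk.prodMk hl)

section Linear

variable {F Z : ℝ → ℝ → ℝ} (hF : Continuous (Function.uncurry F))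
  (hZ : Continuous (Function.uncurry Z)) (h k x t : ℝ)

-- Translation invariance and linearity: the increment and the Taylor remainder in space of a
-- Duhamel term are Duhamel terms of the increment (`k = 0`) and of the Taylor remainder (`k = h`)
-- of the source, so weighted bounds apply to them.
include hF hZ in
theorem charA_shift_sub :
    charA (fun y s => F (y + h) s - F y s - k * Z y s) x t
      = charA F (x + h) t - charA F x t - k * charA Z x t := by
  unfold charA
  rw [← intervalIntegral.integral_const_mul, ← intervalIntegral.integral_sub,
    ← intervalIntegral.integral_sub]
  · refine intervalIntegral.integral_congr fun s _ => ?_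
    simp only [show x + h + t - s = x + t - s + h by ring]
  all_goals
    refine Continuous.intervalIntegrable ?_ _ _
    have h1 := continuous_along hF (k := fun s => x + h + t - s) (l := fun s => s) (by fun_prop)
      (by fun_prop)
    have h2 := continuous_along hF (k := fun s => x + t - s) (l := fun s => s) (by fun_prop)
      (by fun_prop)
    have h3 := continuous_along hZ (k := fun s => x + t - s) (l := fun s => s) (by fun_prop)
      (by fun_prop)
    fun_prop

include hF hZ in
theorem charB_shift_sub :
    charB (fun y s => F (y + h) s - F y s - k * Z y s) x t
      = charB F (x + h) t - charB F x t - k * charB Z x t := by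
  unfold charB
  rw [← intervalIntegral.integral_const_mul, ← intervalIntegral.integral_sub,
    ← intervalIntegral.integral_sub]
  · refine intervalIntegral.integral_congr fun s _ => ?_
    simp only [show x + h - t + s = x - t + s + h by ring]
  all_goals
    refine Continuous.intervalIntegrable ?_ _ _
    have h1 := continuous_along hF (k := fun s => x + h - t + s) (l := fun s => s) (by fun_prop)
      (by fun_prop)
    have h2 := continuous_along hF (k := fun s => x - t + s) (l := fun s => s) (by fun_prop)
      (by fun_prop)
    have h3 := continuous_along hZ (k := fun s => x - t + s) (l := fun s => s) (by fun_prop)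
      (by fun_prop)
    fun_prop

include hF hZ in
theorem duhamelVel_shift_sub :
    duhamelVel (fun y s => F (y + h) s - F y s - k * Z y s) x t
      = duhamelVel F (x + h) t - duhamelVel F x t - k * duhamelVel Z x t := by
  unfold duhamelVel
  rw [charA_shift_sub hF hZ, charB_shift_sub hF hZ]
  ring

include hF hZ in
theorem duhamel_shift_sub :
    duhamel (fun y s => F (y + h) s - F y s - k * Z y s) x t
      = duhamel F (x + h) t - duhamel F x t - k * duhamel Z x t := by
  unfold duhamel
  simp_rw [duhamelVel_shift_sub hF hZ]
  have h1 := continuous_along (continuous_duhamelVel hF) (k := fun _ => x + h) (l := fun s => s)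
    (by fun_prop) (by fun_prop)
  have h2 := continuous_along (continuous_duhamelVel hF) (k := fun _ => x) (l := fun s => s)
    (by fun_prop) (by fun_prop)
  have h3 := continuous_along (continuous_duhamelVel hZ) (k := fun _ => x) (l := fun s => s)
    (by fun_prop) (by fun_prop)
  rw [intervalIntegral.integral_sub, intervalIntegral.integral_sub,
    intervalIntegral.integral_const_mul]
  all_goals exact Continuous.intervalIntegrable (by fun_prop) _ _

end Linear

theorem duhamelVel_sub {F F' : ℝ → ℝ → ℝ} (hF : Continuous (Function.uncurry F))
    (hF' : Continuous (Function.uncurry F')) (x t : ℝ) :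
    duhamelVel (fun y s => F y s - F' y s) x t = duhamelVel F x t - duhamelVel F' x t := by
  unfold duhamelVel charA charB
  rw [intervalIntegral.integral_sub, intervalIntegral.integral_sub]
  · ring
  all_goals
    exact (continuous_along (by assumption) (by fun_prop) (by fun_prop)).intervalIntegrable _ _

theorem duhamel_sub {F F' : ℝ → ℝ → ℝ} (hF : Continuous (Function.uncurry F))
    (hF' : Continuous (Function.uncurry F')) (x t : ℝ) :
    duhamel (fun y s => F y s - F' y s) x t = duhamel F x t - duhamel F' x t := by
  unfold duhamel
  simp_rw [duhamelVel_sub hF hF']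
  rw [intervalIntegral.integral_sub]
  all_goals
    exact (continuous_along (continuous_duhamelVel (by assumption)) (by fun_prop)
      (by fun_prop)).intervalIntegrable _ _

/-! ### Exponentially weighted estimates and reflection -/

/-- Integration of an exponentially weighted bound. -/
theorem abs_integral_le_exp {k : ℝ → ℝ} {N l t : ℝ} (hN : 0 ≤ N) (hl : 0 < l) (ht : 0 ≤ t)
    (hk : ∀ s ∈ Icc 0 t, |k s| ≤ N * Real.exp (l * s)) :
    |∫ s in (0 : ℝ)..t, k s| ≤ N / l * Real.exp (l * t) := by
  have hd : ∀ s ∈ uIcc 0 t, HasDerivAt (fun s => N / l * Real.exp (l * s)) (N * Real.exp (l * s)) s := by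
    intro s _
    have := ((Real.hasDerivAt_exp (l * s)).comp s ((hasDerivAt_id s).const_mul l)).const_mul (N / l)
    convert! this using 1
    field_simp
  have hi : IntervalIntegrable (fun s => N * Real.exp (l * s)) volume 0 t :=
    Continuous.intervalIntegrable (by fun_prop) _ _
  have h1 : |∫ s in (0 : ℝ)..t, k s| ≤ ∫ s in (0 : ℝ)..t, N * Real.exp (l * s) := by
    rw [← Real.norm_eq_abs]
    refine intervalIntegral.norm_integral_le_of_norm_le ht (Eventually.of_forall fun s hs => ?_) hi
    exact hk s ⟨hs.1.le, hs.2⟩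
  rw [intervalIntegral.integral_eq_sub_of_hasDerivAt hd hi] at h1
  have : 0 ≤ N / l := by positivity
  simp only [mul_zero, Real.exp_zero, mul_one] at h1
  linarith

section ExpBound

variable {F : ℝ → ℝ → ℝ} {N l T : ℝ} (hN : 0 ≤ N) (hl : 0 < l)
  (hF : ∀ x, ∀ s ∈ Icc 0 T, |F x s| ≤ N * Real.exp (l * s))

include hN hl hF

theorem abs_charA_le_exp (x : ℝ) {t : ℝ} (ht : t ∈ Icc 0 T) :
    |charA F x t| ≤ N / l * Real.exp (l * t) :=
  abs_integral_le_exp hN hl ht.1 fun s hs => hF _ s ⟨hs.1, hs.2.trans ht.2⟩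

theorem abs_charB_le_exp (x : ℝ) {t : ℝ} (ht : t ∈ Icc 0 T) :
    |charB F x t| ≤ N / l * Real.exp (l * t) :=
  abs_integral_le_exp hN hl ht.1 fun s hs => hF _ s ⟨hs.1, hs.2.trans ht.2⟩

theorem abs_duhamelVel_le_exp (x : ℝ) {t : ℝ} (ht : t ∈ Icc 0 T) :
    |duhamelVel F x t| ≤ N / l * Real.exp (l * t) := by
  have h1 := abs_charA_le_exp hN hl hF x ht
  have h2 := abs_charB_le_exp hN hl hF x ht
  unfold duhamelVel
  rw [abs_le] at *
  constructor <;> linarith [h1.1, h1.2, h2.1, h2.2]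

theorem abs_duhamel_le_exp (x : ℝ) {t : ℝ} (ht : t ∈ Icc 0 T) :
    |duhamel F x t| ≤ N / l / l * Real.exp (l * t) :=
  abs_integral_le_exp (by positivity) hl ht.1 fun s hs =>
    abs_duhamelVel_le_exp hN hl hF x ⟨hs.1, hs.2.trans ht.2⟩

end ExpBound

/-- A bounded family which improves each of its weighted bounds `N` to `A + N / 2` is bounded by
`2 A`. -/
theorem le_of_forall_improve {X : Type*} {D : Set X} {e w : X → ℝ} {A N₀ : ℝ} (hA : 0 ≤ A)
    (hN₀ : 0 ≤ N₀) (h0 : ∀ z ∈ D, |e z| ≤ N₀ * w z)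
    (himp : ∀ N, 0 ≤ N → (∀ z ∈ D, |e z| ≤ N * w z) → ∀ z ∈ D, |e z| ≤ (A + N / 2) * w z) :
    ∀ z ∈ D, |e z| ≤ 2 * A * w z := by
  have key : ∀ n : ℕ, ∀ z ∈ D, |e z| ≤ (2 * A + N₀ / 2 ^ n) * w z := by
    intro n
    induction n with
    | zero =>
      intro z hz
      have h1 := h0 z hz
      have h2 := himp N₀ hN₀ h0 z hz
      simp only [pow_zero, div_one]
      rcases le_or_gt 0 (w z) with hw | hw
      · nlinarith [mul_nonneg hA hw]
      -- The weight has no prescribed sign. Where it is negative the bounds force `N₀ = 0` and then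
      -- `A = 0`.
      · have := abs_nonneg (e z)
        have h3 : N₀ = 0 := by nlinarith
        subst h3
        have h4 : A = 0 := by nlinarith
        subst h4
        simpa using h1
    | succ n ih =>
      intro z hz
      refine (himp _ (by positivity) ih z hz).trans (le_of_eq ?_)
      rw [pow_succ]; field_simp; ring
  intro z hz
  have hlim : Tendsto (fun n : ℕ => (2 * A + N₀ / 2 ^ n) * w z) atTop (𝓝 ((2 * A + 0) * w z)) := by
    refine (tendsto_const_nhds.add ?_).mul_const _
    have := (tendsto_pow_atTop_nhds_zero_of_lt_one (r := (1 / 2 : ℝ)) (by norm_num)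
      (by norm_num)).const_mul N₀
    simpa [div_eq_mul_inv] using this
  rw [add_zero] at hlim
  exact ge_of_tendsto' hlim fun n => key n z hz

/-- Reflection `x ↦ -x` of a function on space-time. -/
def reflect (F : ℝ → ℝ → ℝ) (x t : ℝ) : ℝ := F (-x) t

theorem continuous_reflect {F : ℝ → ℝ → ℝ} (hF : Continuous (Function.uncurry F)) :
    Continuous (Function.uncurry (reflect F)) :=
  hF.comp (f := fun z : ℝ × ℝ => (-z.1, z.2)) (by fun_prop)

theorem charB_eq_charA_reflect (F : ℝ → ℝ → ℝ) (x t : ℝ) :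
    charB F x t = charA (reflect F) (-x) t := by
  unfold charA charB reflect
  congr 1; ext s; congr 1; ring

/-- Each integration gains a factor `1 / l` against the weight `exp (l t)`. With `l ≥ 4 L` an
`L`-Lipschitz nonlinearity therefore contracts by `1 / 2`, however large `T` is. -/
theorem mul_abs_duhamel_add_le_exp {F : ℝ → ℝ → ℝ} {L N l T : ℝ} (hL : 0 ≤ L) (hN : 0 ≤ N)
    (hl : 1 ≤ l) (hlL : 4 * L ≤ l)
    (hF : ∀ x, ∀ s ∈ Icc 0 T, |F x s| ≤ N * Real.exp (l * s)) (x : ℝ) {t : ℝ}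
    (ht : t ∈ Icc 0 T) :
    L * (|duhamel F x t| + |duhamelVel F x t|) ≤ N / 2 * Real.exp (l * t) := by
  have hl0 : 0 < l := by linarith
  have h1 := abs_duhamel_le_exp hN hl0 hF x ht
  have h2 := abs_duhamelVel_le_exp hN hl0 hF x ht
  set X := N * Real.exp (l * t) with hX
  have hX0 : 0 ≤ X := by positivity
  have e1 : N / l * Real.exp (l * t) = X / l := by rw [hX]; ring
  have e2 : N / l / l * Real.exp (l * t) = X / l / l := by rw [hX]; ring
  rw [e1] at h2
  rw [e2] at h1
  have h3 : X / l / l ≤ X / l := div_le_self (by positivity) hl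
  have h4 : L * (X / l) ≤ X / 4 := by
    rw [← mul_div_assoc, div_le_div_iff₀ hl0 (by norm_num)]
    nlinarith
  calc _ ≤ L * (X / l / l + X / l) := by gcongr
    _ ≤ L * (X / l + X / l) := by gcongr
    _ ≤ N / 2 * Real.exp (l * t) := by rw [hX] at h4 ⊢; linarith

/-! ### Global solution of the Volterra equation -/

open scoped BoundedContinuousFunction in
/-- Global solvability on `[0, T]` of the Volterra equation `F = 𝒩(·, duhamel F, duhamelVel F)` with
a globally Lipschitz nonlinearity, inside a closed invariant set of sources. -/
theorem exists_volterra_solution {T L M : ℝ} (hT : 0 ≤ T) (hL : 0 ≤ L) (𝒩 : ℝ × ℝ → ℝ × ℝ → ℝ)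
    (hcont : Continuous (Function.uncurry 𝒩))
    (hlip : ∀ z w w', |𝒩 z w - 𝒩 z w'| ≤ L * (|w.1 - w'.1| + |w.2 - w'.2|))
    (hbd : ∀ z, |𝒩 z 0| ≤ M) (K : Set (ℝ → ℝ → ℝ)) (hKc : IsClosed K)
    (h0 : (fun _ _ => 0) ∈ K)
    (hinv : ∀ F, Continuous (Function.uncurry F) → F ∈ K → ∀ F' : ℝ → ℝ → ℝ,
      (∀ x, ∀ t ∈ Icc 0 T, F' x t = 𝒩 (x, t) (duhamel F x t, duhamelVel F x t)) → F' ∈ K) :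
    ∃ F : ℝ → ℝ → ℝ, Continuous (Function.uncurry F) ∧ F ∈ K ∧ (∃ C, 0 ≤ C ∧ ∀ x t, |F x t| ≤ C) ∧
      ∀ x, ∀ t ∈ Icc 0 T, F x t = 𝒩 (x, t) (duhamel F x t, duhamelVel F x t) := by
  -- Clamping the time to `[0, T]` lets the fixed point be sought among bounded continuous functions
  -- on the whole plane.
  set τ : ℝ → ℝ := fun t => max 0 (min t T) with hτ
  have hτc : Continuous τ := by fun_prop
  have hτm : ∀ t, τ t ∈ Icc 0 T := fun t => ⟨le_max_left _ _, max_le hT (min_le_right _ _)⟩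
  have hτe : ∀ t ∈ Icc 0 T, τ t = t := fun t ht => by
    simp only [hτ, min_eq_left ht.2, max_eq_right ht.1]
  obtain ⟨l, hl1, hl4⟩ : ∃ l : ℝ, 1 ≤ l ∧ 4 * L ≤ l := ⟨max 1 (4 * L), le_max_left _ _, le_max_right _ _⟩
  have hl : 0 < l := by linarith
  -- The unknown `E` is the source divided by the exponential weight, so the ordinary sup distance
  -- of `E` is the weighted distance of sources.
  let src : (ℝ × ℝ →ᵇ ℝ) → ℝ → ℝ → ℝ := fun E x t => Real.exp (l * τ t) * E (x, t)
  have hsrc : ∀ E, Continuous (Function.uncurry (src E)) := by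
    intro E
    have : Continuous fun z : ℝ × ℝ => Real.exp (l * τ z.2) * E z := by
      have := E.continuous
      fun_prop
    exact this
  have hsrcb : ∀ E E' : ℝ × ℝ →ᵇ ℝ, ∀ x, ∀ s ∈ Icc 0 T,
      |src E x s - src E' x s| ≤ dist E E' * Real.exp (l * s) := by
    intro E E' x s hs
    have : src E x s - src E' x s = Real.exp (l * s) * (E (x, s) - E' (x, s)) := by
      simp only [src, hτe s hs]; ring
    rw [this, abs_mul, abs_of_pos (Real.exp_pos _), mul_comm]
    gcongr
    exact BoundedContinuousFunction.dist_coe_le_dist (f := E) (g := E') (x, s)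
  let rhs : (ℝ × ℝ →ᵇ ℝ) → ℝ × ℝ → ℝ := fun E z =>
    𝒩 (z.1, τ z.2) (duhamel (src E) z.1 (τ z.2), duhamelVel (src E) z.1 (τ z.2))
  have hdiff : ∀ E E' z, |rhs E z - rhs E' z| ≤ dist E E' / 2 * Real.exp (l * τ z.2) := by
    intro E E' z
    refine (hlip _ _ _).trans ?_
    simp only
    rw [← duhamel_sub (hsrc E) (hsrc E'), ← duhamelVel_sub (hsrc E) (hsrc E')]
    exact mul_abs_duhamel_add_le_exp hL dist_nonneg hl1 hl4 (hsrcb E E') z.1 (hτm z.2)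
  have hrhsc : ∀ E, Continuous (rhs E) := by
    intro E
    refine hcont.comp (f := fun z : ℝ × ℝ => (((z.1, τ z.2) : ℝ × ℝ),
      ((duhamel (src E) z.1 (τ z.2), duhamelVel (src E) z.1 (τ z.2)) : ℝ × ℝ))) ?_
    have h1 := (continuous_duhamel (hsrc E)).comp (f := fun z : ℝ × ℝ => (z.1, τ z.2)) (by fun_prop)
    have h2 := (continuous_duhamelVel (hsrc E)).comp (f := fun z : ℝ × ℝ => (z.1, τ z.2))
      (by fun_prop)
    exact Continuous.prodMk (by fun_prop) (h1.prodMk h2)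
  have hexp : ∀ z : ℝ × ℝ, 1 ≤ Real.exp (l * τ z.2) := fun z =>
    Real.one_le_exp (mul_nonneg hl.le (hτm z.2).1)
  have hrhs0 : ∀ z, |rhs 0 z| ≤ M := by
    intro z
    have e : src 0 = fun _ _ => 0 := by ext x t; simp [src]
    have h1 : duhamelVel (fun _ _ => 0) = fun _ _ => 0 := by
      ext x t; simp [duhamelVel, charA, charB]
    have h2 : duhamel (fun _ _ => 0) = fun _ _ => 0 := by
      ext x t; simp [duhamel, h1]
    simp only [rhs, e, h1, h2]
    exact hbd _
  have hM : 0 ≤ M := (abs_nonneg _).trans (hbd (0, 0))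
  have hbound : ∀ E z, ‖Real.exp (-(l * τ z.2)) * rhs E z‖ ≤ M + dist E 0 / 2 := by
    intro E z
    rw [norm_mul, Real.norm_eq_abs, Real.norm_eq_abs, abs_of_pos (Real.exp_pos _), Real.exp_neg,
      inv_mul_le_iff₀ (Real.exp_pos _)]
    have h1 := hdiff E 0 z
    have h2 := hrhs0 z
    have h3 := hexp z
    have h4 : |rhs E z| ≤ |rhs E z - rhs 0 z| + |rhs 0 z| := by
      simpa using abs_add_le (rhs E z - rhs 0 z) (rhs 0 z)
    nlinarith
  let Φ : (ℝ × ℝ →ᵇ ℝ) → (ℝ × ℝ →ᵇ ℝ) := fun E =>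
    BoundedContinuousFunction.ofNormedAddCommGroup (fun z => Real.exp (-(l * τ z.2)) * rhs E z)
      (by have := hrhsc E; fun_prop) _ (hbound E)
  have hΦ : ∀ E z, Φ E z = Real.exp (-(l * τ z.2)) * rhs E z := fun E z => rfl
  have hΦsrc : ∀ E x, ∀ t ∈ Icc 0 T, src (Φ E) x t
      = 𝒩 (x, t) (duhamel (src E) x t, duhamelVel (src E) x t) := by
    intro E x t ht
    simp only [src, hΦ, rhs, hτe t ht]
    rw [← mul_assoc, ← Real.exp_add]; simp
  have hcon : ContractingWith (1 / 2) Φ := by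
    refine ⟨by rw [← NNReal.coe_lt_coe]; norm_num, LipschitzWith.of_dist_le_mul fun E E' => ?_⟩
    refine (BoundedContinuousFunction.dist_le (by positivity)).2 fun z => ?_
    rw [Real.dist_eq, hΦ, hΦ, ← mul_sub, abs_mul, abs_of_pos (Real.exp_pos _), Real.exp_neg,
      inv_mul_le_iff₀ (Real.exp_pos _)]
    refine (hdiff E E' z).trans (le_of_eq ?_)
    push_cast; ring
  set E := hcon.fixedPoint Φ with hE
  have hfix : Φ E = E := hcon.fixedPoint_isFixedPt
  refine ⟨src E, hsrc E, ?_, ⟨Real.exp (l * T) * ‖E‖, by positivity, fun x t => ?_⟩, fun x t ht => ?_⟩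
  -- The fixed point is the limit of the Picard iterates of `0`, all of which lie in `K`; closedness
  -- of `K` is needed only for pointwise convergence.
  · have hmem : ∀ n, src (Φ^[n] 0) ∈ K := by
      intro n
      induction n with
      | zero =>
        have e : src 0 = fun _ _ => 0 := by ext x t; simp [src]
        simpa [e] using h0
      | succ n ih =>
        rw [Function.iterate_succ_apply']
        exact hinv _ (hsrc _) ih _ (hΦsrc _)
    refine hKc.mem_of_tendsto (b := atTop) (f := fun n => src (Φ^[n] 0)) ?_
      (Eventually.of_forall hmem)
    refine tendsto_pi_nhds.2 fun x => tendsto_pi_nhds.2 fun t => ?_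
    have h1 := hcon.tendsto_iterate_fixedPoint 0
    have h2 := ((BoundedContinuousFunction.lipschitz_eval_const (β := ℝ) (x, t)).continuous.tendsto E).comp h1
    exact h2.const_mul _
  · have : |src E x t| = Real.exp (l * τ t) * |E (x, t)| := by
      simp only [src, abs_mul, abs_of_pos (Real.exp_pos _)]
    rw [this]
    gcongr
    · exact (hτm t).2
    · exact E.norm_coe_le_norm (x, t)
  · conv_lhs => rw [← hfix]
    exact hΦsrc E x t ht

/-! ### Differentiability of the source in space -/

theorem exists_forall_taylor_le {E : Type*} [NormedAddCommGroup E] [NormedSpace ℝ E] {φ : E → ℝ}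
    (hφ : Differentiable ℝ φ) (hu : UniformContinuous (fderiv ℝ φ)) {η : ℝ} (hη : 0 < η) :
    ∃ d > 0, ∀ x k, ‖k‖ < d → |φ (x + k) - φ x - fderiv ℝ φ x k| ≤ η * ‖k‖ := by
  obtain ⟨d, hd, h⟩ := Metric.uniformContinuous_iff.1 hu η hη
  refine ⟨d, hd, fun x k hk => ?_⟩
  have := Convex.norm_image_sub_le_of_norm_fderiv_le' (𝕜 := ℝ) (f := φ) (s := Metric.ball x d)
    (C := η) (φ := fderiv ℝ φ x) (x := x) (y := x + k) (fun y _ => hφ y)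
    (fun y hy => by
      rw [← dist_eq_norm]
      exact (h hy).le) (convex_ball x d) (Metric.mem_ball_self hd) (by simpa using hk)
  simpa using this

theorem hasDerivAt_of_forall_taylor_le {φ : ℝ → ℝ} {φ' x : ℝ}
    (h : ∀ η > 0, ∃ d > 0, ∀ k, |k| < d → |φ (x + k) - φ x - k * φ'| ≤ η * |k|) :
    HasDerivAt φ φ' x := by
  rw [hasDerivAt_iff_isLittleO_nhds_zero, Asymptotics.isLittleO_iff]
  intro η hη
  obtain ⟨d, hd, hk⟩ := h η hη
  filter_upwards [Metric.ball_mem_nhds (0 : ℝ) hd] with k hkd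
  have := hk k (by simpa using hkd)
  simpa [Real.norm_eq_abs] using this

section SpaceDerivative

variable {H : ℝ × ℝ → ℝ} {U₀ V₀ U₁ V₁ F : ℝ → ℝ → ℝ} {T C : ℝ}

/-- The solution of a semilinear wave equation with smooth, compactly supported nonlinearity has a
source which is continuously differentiable in space. -/
theorem exists_hasDerivAt_source (hT : 0 ≤ T) (hC : 0 ≤ C) (hH : ContDiff ℝ 1 H)
    (hHc : HasCompactSupport H)
    (hU₀ : Continuous (Function.uncurry U₀)) (hV₀ : Continuous (Function.uncurry V₀))
    (hU₁ : Continuous (Function.uncurry U₁)) (hV₁ : Continuous (Function.uncurry V₁))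
    (hU₁b : ∀ x t, |U₁ x t| ≤ C) (hV₁b : ∀ x t, |V₁ x t| ≤ C)
    (hU₀l : ∀ x t k, |U₀ (x + k) t - U₀ x t| ≤ C * |k|)
    (hV₀l : ∀ x t k, |V₀ (x + k) t - V₀ x t| ≤ C * |k|)
    (hU₀d : ∀ η > 0, ∃ d > 0, ∀ x t k, |k| < d → |U₀ (x + k) t - U₀ x t - k * U₁ x t| ≤ η * |k|)
    (hV₀d : ∀ η > 0, ∃ d > 0, ∀ x t k, |k| < d → |V₀ (x + k) t - V₀ x t - k * V₁ x t| ≤ η * |k|)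
    (hF : Continuous (Function.uncurry F)) (hFb : ∃ M, 0 ≤ M ∧ ∀ x t, |F x t| ≤ M)
    (hFe : ∀ x, ∀ t ∈ Icc 0 T, F x t = H (U₀ x t + duhamel F x t, V₀ x t + duhamelVel F x t)) :
    ∃ Z : ℝ → ℝ → ℝ, Continuous (Function.uncurry Z) ∧
      ∀ x, ∀ t ∈ Icc 0 T, HasDerivAt (fun y => F y t) (Z x t) x := by
  have hDc : Continuous (fderiv ℝ H) := hH.continuous_fderiv (by norm_num)
  have hHd : Differentiable ℝ H := hH.differentiable (by norm_num)
  have hDs : HasCompactSupport (fderiv ℝ H) := hHc.fderiv (𝕜 := ℝ)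
  have hDu : UniformContinuous (fderiv ℝ H) :=
    hDs.uniformContinuous_of_continuous hDc
  obtain ⟨L, hL⟩ := hDs.exists_bound_of_continuous hDc
  have hL0 : 0 ≤ L := (norm_nonneg _).trans (hL 0)
  have hpair : ∀ w : ℝ × ℝ, ‖w‖ ≤ |w.1| + |w.2| := fun w =>
    max_le_add_of_nonneg (abs_nonneg _) (abs_nonneg _)
  have hDa : ∀ z w, |fderiv ℝ H z w| ≤ L * (|w.1| + |w.2|) := fun z w =>
    ((fderiv ℝ H z).le_of_opNorm_le (hL z) w).trans (by gcongr; exact hpair w)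
  have hHl : ∀ w w', |H w - H w'| ≤ L * (|w.1 - w'.1| + |w.2 - w'.2|) := fun w w' =>
    (Convex.norm_image_sub_le_of_norm_fderiv_le (𝕜 := ℝ) (f := H) (C := L) (fun x _ => hHd x)
      (fun x _ => hL x) convex_univ (mem_univ w') (mem_univ w)).trans (by gcongr; exact hpair _)
  set W : ℝ → ℝ → ℝ × ℝ := fun x t => (U₀ x t + duhamel F x t, V₀ x t + duhamelVel F x t) with hW
  have hWc : Continuous (Function.uncurry W) :=
    (hU₀.add (continuous_duhamel hF)).prodMk (hV₀.add (continuous_duhamelVel hF))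
  -- The candidate for the space derivative solves the equation obtained by formally differentiating
  -- the equation of `F` in `x`. It is again a Volterra equation, now affine in the unknown.
  obtain ⟨Z, hZc, -, ⟨MZ, hMZ0, hMZ⟩, hZe⟩ := exists_volterra_solution (T := T) (L := L) (M := L * (C + C)) hT hL0
    (fun z w => fderiv ℝ H (W z.1 z.2) (U₁ z.1 z.2 + w.1, V₁ z.1 z.2 + w.2))
    (by
      refine Continuous.clm_apply (hDc.comp (hWc.comp continuous_fst)) ?_
      have h1 := hU₁.comp (continuous_fst (X := ℝ × ℝ) (Y := ℝ × ℝ))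
      have h2 := hV₁.comp (continuous_fst (X := ℝ × ℝ) (Y := ℝ × ℝ))
      exact (h1.add (continuous_fst.comp continuous_snd)).prodMk
        (h2.add (continuous_snd.comp continuous_snd)))
    (fun z w w' => by
      rw [← map_sub]
      refine (hDa _ _).trans (le_of_eq ?_)
      simp)
    (fun z => by
      refine (hDa _ _).trans ?_
      simp only [Prod.fst_zero, Prod.snd_zero, add_zero]
      gcongr
      exacts [hU₁b _ _, hV₁b _ _])
    univ isClosed_univ (mem_univ _) (fun _ _ _ _ _ => mem_univ _)
  refine ⟨Z, hZc, ?_⟩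
  obtain ⟨M, hM0, hM⟩ := hFb
  obtain ⟨l, hl1, hl4⟩ : ∃ l : ℝ, 1 ≤ l ∧ 4 * L ≤ l := ⟨max 1 (4 * L), le_max_left _ _, le_max_right _ _⟩
  have hl : 0 < l := by linarith
  have hexp1 : ∀ t ∈ Icc 0 T, 1 ≤ Real.exp (l * t) := fun t ht =>
    Real.one_le_exp (mul_nonneg hl.le ht.1)
  have hexpT : ∀ t ∈ Icc 0 T, Real.exp (l * t) ≤ Real.exp (l * T) := fun t ht =>
    Real.exp_le_exp.2 (mul_le_mul_of_nonneg_left ht.2 hl.le)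
  -- Lipschitz bound in space
  have hlip : ∀ k x, ∀ t ∈ Icc 0 T,
      |F (x + k) t - F x t| ≤ 2 * (L * (C * |k| + C * |k|)) * Real.exp (l * t) := by
    intro k
    -- The term `0 * Z` only serves to bring the increment into the form of the shift lemmas.
    have := le_of_forall_improve (X := ℝ × ℝ) (D := {z | z.2 ∈ Icc 0 T})
      (e := fun z => F (z.1 + k) z.2 - F z.1 z.2 - 0 * Z z.1 z.2)
      (w := fun z => Real.exp (l * z.2)) (A := L * (C * |k| + C * |k|)) (N₀ := 2 * M) (by positivity)
      (by positivity) ?_ ?_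
    · intro x t ht
      simpa using this (x, t) ht
    · rintro ⟨x, t⟩ ht
      have h1 := hM (x + k) t
      have h2 := hM x t
      have h3 := hexp1 t ht
      have h4 : |F (x + k) t - F x t| ≤ 2 * M := (abs_sub _ _).trans (by linarith)
      simp only [zero_mul, sub_zero]
      nlinarith
    · rintro N hN hN' ⟨x, t⟩ ht
      have hb := mul_abs_duhamel_add_le_exp hL0 hN hl1 hl4 (fun x s hs => hN' (x, s) hs) x ht
      rw [duhamel_shift_sub hF hZc, duhamelVel_shift_sub hF hZc] at hb
      simp only [zero_mul, sub_zero] at hb ⊢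
      rw [hFe _ t ht, hFe _ t ht]
      refine (hHl _ _).trans ?_
      simp only
      have h1 : |U₀ (x + k) t + duhamel F (x + k) t - (U₀ x t + duhamel F x t)|
          ≤ C * |k| + |duhamel F (x + k) t - duhamel F x t| := by
        rw [add_sub_add_comm]
        exact (abs_add_le _ _).trans (by gcongr; exact hU₀l _ _ _)
      have h2 : |V₀ (x + k) t + duhamelVel F (x + k) t - (V₀ x t + duhamelVel F x t)|
          ≤ C * |k| + |duhamelVel F (x + k) t - duhamelVel F x t| := by
        rw [add_sub_add_comm]
        exact (abs_add_le _ _).trans (by gcongr; exact hV₀l _ _ _)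
      have h3 := hexp1 t ht
      have h4 : 0 ≤ L * (C * |k| + C * |k|) := by positivity
      calc _ ≤ L * ((C * |k| + |duhamel F (x + k) t - duhamel F x t|)
            + (C * |k| + |duhamelVel F (x + k) t - duhamelVel F x t|)) := by gcongr
        _ = L * (C * |k| + C * |k|) * 1 + L * (|duhamel F (x + k) t - duhamel F x t|
            + |duhamelVel F (x + k) t - duhamelVel F x t|) := by ring
        _ ≤ L * (C * |k| + C * |k|) * Real.exp (l * t) + N / 2 * Real.exp (l * t) := by gcongr
        _ = _ := by ring
  -- Lipschitz bound for the solution and its velocity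
  obtain ⟨C₂, hC₂, hWl⟩ : ∃ C₂ > 0, ∀ k x, ∀ t ∈ Icc 0 T, ‖W (x + k) t - W x t‖ ≤ C₂ * |k| := by
    set K := 2 * (L * (C + C)) with hK
    have hK0 : 0 ≤ K := by positivity
    refine ⟨C + K * Real.exp (l * T) + 1, by positivity, fun k x t ht => ?_⟩
    have hh : ∀ y, ∀ s ∈ Icc 0 T, |F (y + k) s - F y s - 0 * Z y s| ≤ (K * |k|) * Real.exp (l * s) := by
      intro y s hs
      refine le_trans (le_of_eq ?_) ((hlip k y s hs).trans (le_of_eq ?_))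
      · simp
      · rw [hK]; ring
    have h1 := abs_duhamel_le_exp (by positivity) hl hh x ht
    have h2 := abs_duhamelVel_le_exp (by positivity) hl hh x ht
    rw [duhamel_shift_sub hF hZc] at h1
    rw [duhamelVel_shift_sub hF hZc] at h2
    simp only [zero_mul, sub_zero] at h1 h2
    have h3 : K * |k| / l ≤ K * |k| := div_le_self (by positivity) hl1
    have h4 : K * |k| / l / l ≤ K * |k| := (div_le_self (by positivity) hl1).trans h3
    have h5 := hexpT t ht
    have h6 : K * |k| / l * Real.exp (l * t) ≤ K * |k| * Real.exp (l * T) := by gcongr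
    have h7 : K * |k| / l / l * Real.exp (l * t) ≤ K * |k| * Real.exp (l * T) := by gcongr
    have h8 := hU₀l x t k
    have h9 := hV₀l x t k
    have h10 : 0 ≤ |k| := abs_nonneg k
    have e1 : (C + K * Real.exp (l * T) + 1) * |k| = C * |k| + K * |k| * Real.exp (l * T) + |k| := by
      ring
    rw [e1]
    refine max_le ?_ ?_
    · simp only [hW, Prod.fst_sub, Real.norm_eq_abs]
      rw [add_sub_add_comm]
      refine (abs_add_le _ _).trans ?_
      linarith
    · simp only [hW, Prod.snd_sub, Real.norm_eq_abs]
      rw [add_sub_add_comm]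
      refine (abs_add_le _ _).trans ?_
      linarith
  -- first order expansion
  have hmain : ∀ η > 0, ∃ d > 0, ∀ k, |k| < d → ∀ x, ∀ t ∈ Icc 0 T,
      |F (x + k) t - F x t - k * Z x t| ≤ 2 * ((C₂ + 2 * L) * η * |k|) * Real.exp (l * t) := by
    intro η hη
    obtain ⟨d₁, hd₁, h₁⟩ := exists_forall_taylor_le hHd hDu hη
    obtain ⟨d₂, hd₂, h₂⟩ := hU₀d η hη
    obtain ⟨d₃, hd₃, h₃⟩ := hV₀d η hη
    refine ⟨min (d₁ / C₂) (min d₂ d₃), by positivity, fun k hk => ?_⟩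
    rw [lt_min_iff, lt_min_iff, lt_div_iff₀ hC₂] at hk
    obtain ⟨hk1, hk2, hk3⟩ := hk
    have := le_of_forall_improve (X := ℝ × ℝ) (D := {z | z.2 ∈ Icc 0 T})
      (e := fun z => F (z.1 + k) z.2 - F z.1 z.2 - k * Z z.1 z.2)
      (w := fun z => Real.exp (l * z.2)) (A := (C₂ + 2 * L) * η * |k|) (N₀ := 2 * M + |k| * MZ)
      (by positivity) (by positivity) ?_ ?_
    · intro x t ht
      exact this (x, t) ht
    · rintro ⟨x, t⟩ ht
      have h1 := hM (x + k) t
      have h2 := hM x t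
      have h3 := hexp1 t ht
      have h4 : |F (x + k) t - F x t| ≤ 2 * M := (abs_sub _ _).trans (by linarith)
      have h5 : |k * Z x t| ≤ |k| * MZ := by rw [abs_mul]; gcongr; exact hMZ x t
      have h6 := (abs_sub (F (x + k) t - F x t) (k * Z x t))
      have h7 : 0 ≤ 2 * M + |k| * MZ := by positivity
      simp only
      nlinarith
    · rintro N hN hN' ⟨x, t⟩ ht
      have hb := mul_abs_duhamel_add_le_exp hL0 hN hl1 hl4 (fun x s hs => hN' (x, s) hs) x ht
      rw [duhamel_shift_sub hF hZc, duhamelVel_shift_sub hF hZc] at hb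
      simp only
      set δ := W (x + k) t - W x t with hδ
      have hδn : ‖δ‖ ≤ C₂ * |k| := hWl k x t ht
      have hT1 := h₁ (W x t) δ (hδn.trans_lt (by linarith))
      have e1 : W x t + δ = W (x + k) t := by rw [hδ]; abel
      rw [e1] at hT1
      -- The remainder of `F` splits into the Taylor remainder of `H` at `W`, small because `W` is
      -- Lipschitz in space, and the derivative of `H` applied to the remainder of `W`. The latter
      -- is a free remainder plus Duhamel terms of the very quantity being estimated, which the
      -- weight absorbs.
      have eF : F (x + k) t - F x t - k * Z x t = (H (W (x + k) t) - H (W x t) - fderiv ℝ H (W x t) δ)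
          + fderiv ℝ H (W x t) (δ - k • (U₁ x t + duhamel Z x t, V₁ x t + duhamelVel Z x t)) := by
        rw [(fderiv ℝ H (W x t)).map_sub δ, map_smul, hFe _ t ht, hFe _ t ht, hZe _ t ht]
        simp only [hW, smul_eq_mul]
        ring
      have hT2 := hDa (W x t) (δ - k • (U₁ x t + duhamel Z x t, V₁ x t + duhamelVel Z x t))
      have e2 : (δ - k • (U₁ x t + duhamel Z x t, V₁ x t + duhamelVel Z x t)).1
          = (U₀ (x + k) t - U₀ x t - k * U₁ x t)
            + (duhamel F (x + k) t - duhamel F x t - k * duhamel Z x t) := by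
        simp [hδ, hW]; ring
      have e3 : (δ - k • (U₁ x t + duhamel Z x t, V₁ x t + duhamelVel Z x t)).2
          = (V₀ (x + k) t - V₀ x t - k * V₁ x t)
            + (duhamelVel F (x + k) t - duhamelVel F x t - k * duhamelVel Z x t) := by
        simp [hδ, hW]; ring
      rw [e2, e3] at hT2
      have h4 := (abs_add_le (U₀ (x + k) t - U₀ x t - k * U₁ x t)
        (duhamel F (x + k) t - duhamel F x t - k * duhamel Z x t)).trans
        (add_le_add (h₂ x t k hk2) le_rfl)
      have h5 := (abs_add_le (V₀ (x + k) t - V₀ x t - k * V₁ x t)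
        (duhamelVel F (x + k) t - duhamelVel F x t - k * duhamelVel Z x t)).trans
        (add_le_add (h₃ x t k hk3) le_rfl)
      have h6 := hexp1 t ht
      rw [eF]
      refine (abs_add_le _ _).trans ?_
      have h7 : 0 ≤ (C₂ + 2 * L) * η * |k| := by positivity
      calc _ ≤ η * (C₂ * |k|) + L * ((η * |k| + |duhamel F (x + k) t - duhamel F x t
                - k * duhamel Z x t|) + (η * |k| + |duhamelVel F (x + k) t - duhamelVel F x t
                - k * duhamelVel Z x t|)) := by
            refine add_le_add (hT1.trans (by gcongr)) (hT2.trans ?_)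
            gcongr
        _ = (C₂ + 2 * L) * η * |k| * 1 + L * (|duhamel F (x + k) t - duhamel F x t
                - k * duhamel Z x t| + |duhamelVel F (x + k) t - duhamelVel F x t
                - k * duhamelVel Z x t|) := by ring
        _ ≤ (C₂ + 2 * L) * η * |k| * Real.exp (l * t) + N / 2 * Real.exp (l * t) := by gcongr
        _ = _ := by ring
  intro x t ht
  refine hasDerivAt_of_forall_taylor_le fun η hη => ?_
  have hB : 0 < 2 * (C₂ + 2 * L) * Real.exp (l * T) := by positivity
  obtain ⟨d, hd, h⟩ := hmain (η / (2 * (C₂ + 2 * L) * Real.exp (l * T))) (by positivity)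
  refine ⟨d, hd, fun k hk => (h k hk x t ht).trans ?_⟩
  calc _ ≤ 2 * ((C₂ + 2 * L) * (η / (2 * (C₂ + 2 * L) * Real.exp (l * T))) * |k|)
        * Real.exp (l * T) := by
        have := hexpT t ht
        gcongr
    _ = η * |k| := by field_simp

end SpaceDerivative

/-! ### From a source differentiable in space to a `C²` solution -/

section Partial

variable {f f₁ f₂ : ℝ → ℝ → ℝ} (h₁ : ∀ x t, HasDerivAt (fun y => f y t) (f₁ x t) x)
  (h₂ : ∀ x t, HasDerivAt (fun s => f x s) (f₂ x t) t)

include h₁ h₂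

theorem hasFDerivAt_of_partial (c₁ : Continuous (Function.uncurry f₁))
    (c₂ : Continuous (Function.uncurry f₂)) (z : ℝ × ℝ) :
    HasFDerivAt (Function.uncurry f) (f₁ z.1 z.2 • ContinuousLinearMap.fst ℝ ℝ ℝ
      + f₂ z.1 z.2 • ContinuousLinearMap.snd ℝ ℝ ℝ) z := by
  have := hasStrictFDerivAt_uncurry_coprod (𝕜 := ℝ) (u := z) (f := f)
    (f₁ := fun x t => (ContinuousLinearMap.toSpanSingleton ℝ (f₁ x t)))
    (f₂ := fun x t => (ContinuousLinearMap.toSpanSingleton ℝ (f₂ x t)))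
    (Eventually.of_forall fun w => (h₁ w.1 w.2).hasFDerivAt)
    (Eventually.of_forall fun w => (h₂ w.1 w.2).hasFDerivAt)
    (Continuous.continuousAt ((ContinuousLinearMap.toSpanSingletonCLE (𝕜 := ℝ) (E := ℝ)).continuous.comp c₁))
    (Continuous.continuousAt ((ContinuousLinearMap.toSpanSingletonCLE (𝕜 := ℝ) (E := ℝ)).continuous.comp c₂))
  convert! this.hasFDerivAt using 1
  ext <;> simp [Function.HasUncurry.uncurry]

theorem contDiff_succ_of_partial {n : ℕ} (c₁ : ContDiff ℝ n (Function.uncurry f₁))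
    (c₂ : ContDiff ℝ n (Function.uncurry f₂)) : ContDiff ℝ (n + 1) (Function.uncurry f) := by
  have hd := hasFDerivAt_of_partial h₁ h₂ c₁.continuous c₂.continuous
  rw [contDiff_succ_iff_fderiv]
  refine ⟨fun z => (hd z).differentiableAt, by simp, ?_⟩
  rw [show fderiv ℝ (Function.uncurry f) = fun z => Function.uncurry f₁ z • ContinuousLinearMap.fst ℝ ℝ ℝ
      + Function.uncurry f₂ z • ContinuousLinearMap.snd ℝ ℝ ℝ from funext fun z => (hd z).fderiv]
  exact (c₁.smul contDiff_const).add (c₂.smul contDiff_const)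

end Partial

theorem hasDerivAt_parametric_integral {f f' : ℝ → ℝ → ℝ} (hf : Continuous (Function.uncurry f))
    (hf' : Continuous (Function.uncurry f')) (h : ∀ x s, HasDerivAt (fun y => f y s) (f' x s) x)
    (x t : ℝ) : HasDerivAt (fun y => ∫ s in (0 : ℝ)..t, f y s) (∫ s in (0 : ℝ)..t, f' x s) x := by
  obtain ⟨C, hC⟩ := ((isCompact_closedBall x 1).prod (isCompact_uIcc (a := (0 : ℝ)) (b := t))).exists_bound_of_continuousOn
    hf'.continuousOn
  refine (intervalIntegral.hasDerivAt_integral_of_dominated_loc_of_deriv_le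
    (bound := fun _ => C) (F := f) (F' := f') (s := Metric.closedBall x 1) (Metric.closedBall_mem_nhds x one_pos)
    (Eventually.of_forall fun y => ?_) ?_ ?_ ?_ intervalIntegrable_const ?_).2
  · exact (continuous_along hf continuous_const continuous_id).aestronglyMeasurable
  · exact (continuous_along hf continuous_const continuous_id).intervalIntegrable _ _
  · exact (continuous_along hf' continuous_const continuous_id).aestronglyMeasurable
  · exact Eventually.of_forall fun s hs y hy => hC (y, s) ⟨hy, uIoc_subset_uIcc hs⟩
  · exact Eventually.of_forall fun s _ y _ => h y s

section Source

variable {F Z : ℝ → ℝ → ℝ} (hF : Continuous (Function.uncurry F))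
  (hZ : Continuous (Function.uncurry Z)) (hd : ∀ x t, HasDerivAt (fun y => F y t) (Z x t) x)

include hF hZ hd

theorem hasDerivAt_charA_space (x t : ℝ) :
    HasDerivAt (fun y => charA F y t) (charA Z x t) x := by
  refine hasDerivAt_parametric_integral (f := fun y s => F (y + t - s) s)
    (f' := fun y s => Z (y + t - s) s) ?_ ?_ ?_ x t
  · exact hF.comp (f := fun z : ℝ × ℝ => (z.1 + t - z.2, z.2)) (by fun_prop)
  · exact hZ.comp (f := fun z : ℝ × ℝ => (z.1 + t - z.2, z.2)) (by fun_prop)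
  · intro y s
    have := (hd (y + t - s) s).comp y (((hasDerivAt_id y).add_const t).sub_const s)
    simpa [Function.comp_def] using this

/-- The base point of the characteristic and the end of integration both move with time. Writing the
integral as `κ (x + t) t`, with `κ ξ t` the integral along the fixed line `y + s = ξ`, separates the
two effects; only a space derivative of `F` is needed. -/
theorem hasDerivAt_charA_time (x t : ℝ) :
    HasDerivAt (fun s => charA F x s) (F x t + charA Z x t) t := by
  set κ : ℝ → ℝ → ℝ := fun ξ t => ∫ s in (0 : ℝ)..t, F (ξ - s) s with hκ
  have c2 : Continuous (Function.uncurry fun ξ t => F (ξ - t) t) :=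
    hF.comp (f := fun z : ℝ × ℝ => (z.1 - z.2, z.2)) (by fun_prop)
  have c1' : Continuous (Function.uncurry fun ξ t => Z (ξ - t) t) :=
    hZ.comp (f := fun z : ℝ × ℝ => (z.1 - z.2, z.2)) (by fun_prop)
  have h1 : ∀ ξ t, HasDerivAt (fun y => κ y t) (∫ s in (0 : ℝ)..t, Z (ξ - s) s) ξ := fun ξ t =>
    hasDerivAt_parametric_integral (f := fun y s => F (y - s) s) (f' := fun y s => Z (y - s) s)
      c2 c1' (fun y s => by
        have := (hd (y - s) s).comp y ((hasDerivAt_id y).sub_const s)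
        simpa [Function.comp_def] using this) ξ t
  have h2 : ∀ ξ t, HasDerivAt (fun s => κ ξ s) (F (ξ - t) t) t := fun ξ t => by
    have c : Continuous fun s => F (ξ - s) s := continuous_along hF (by fun_prop) (by fun_prop)
    exact intervalIntegral.integral_hasDerivAt_right (c.intervalIntegrable _ _)
      (c.stronglyMeasurableAtFilter _ _) c.continuousAt
  have c1 : Continuous (Function.uncurry fun ξ t => ∫ s in (0 : ℝ)..t, Z (ξ - s) s) := by
    refine intervalIntegral.continuous_parametric_intervalIntegral_of_continuous
      (f := fun (z : ℝ × ℝ) s => Z (z.1 - s) s) (s := fun z => z.2) ?_ continuous_snd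
    exact hZ.comp (f := fun w : (ℝ × ℝ) × ℝ => (w.1.1 - w.2, w.2)) (by fun_prop)
  have h3 := hasFDerivAt_of_partial h1 h2 c1 c2 (x + t, t)
  have h4 : HasDerivAt (fun s : ℝ => (x + s, s)) ((1 : ℝ), (1 : ℝ)) t :=
    ((hasDerivAt_id t).const_add x).prodMk (hasDerivAt_id t)
  have h5 := HasFDerivAt.comp_hasDerivAt (f := fun s : ℝ => (x + s, s)) t h3 h4
  have e : (Function.uncurry κ ∘ fun s : ℝ => (x + s, s)) = fun s => charA F x s := by
    ext s; simp [hκ, charA]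
  rw [e] at h5
  convert! h5 using 1
  simp [charA, add_comm]

omit hF hZ in
theorem hasDerivAt_reflect (x t : ℝ) :
    HasDerivAt (fun y => reflect F y t) (reflect (fun y s => -Z y s) x t) x := by
  have := (hd (-x) t).comp x (hasDerivAt_neg x)
  simpa [reflect, Function.comp_def] using this

theorem hasDerivAt_charB_space (x t : ℝ) :
    HasDerivAt (fun y => charB F y t) (charB Z x t) x := by
  simp_rw [charB_eq_charA_reflect]
  have h1 := hasDerivAt_charA_space (continuous_reflect hF)
    (continuous_reflect (F := fun y s => -Z y s) hZ.neg) (hasDerivAt_reflect hd) (-x) t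
  have h2 := h1.comp x (hasDerivAt_neg x)
  convert! h2 using 1
  simp [charA, reflect]

theorem hasDerivAt_charB_time (x t : ℝ) :
    HasDerivAt (fun s => charB F x s) (F x t - charB Z x t) t := by
  simp_rw [charB_eq_charA_reflect]
  have h1 := hasDerivAt_charA_time (continuous_reflect hF)
    (continuous_reflect (F := fun y s => -Z y s) hZ.neg) (hasDerivAt_reflect hd) (-x) t
  convert! h1 using 1
  simp [charA, reflect, sub_eq_add_neg]

theorem contDiff_charA : ContDiff ℝ 1 (Function.uncurry (charA F)) := by
  have := contDiff_succ_of_partial (n := 0) (hasDerivAt_charA_space hF hZ hd)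
    (hasDerivAt_charA_time hF hZ hd) (contDiff_zero.2 (continuous_charA hZ))
    (contDiff_zero.2 (hF.add (continuous_charA hZ)))
  simpa using this

theorem contDiff_charB : ContDiff ℝ 1 (Function.uncurry (charB F)) := by
  have := contDiff_succ_of_partial (n := 0) (hasDerivAt_charB_space hF hZ hd)
    (hasDerivAt_charB_time hF hZ hd) (contDiff_zero.2 (continuous_charB hZ))
    (contDiff_zero.2 (hF.sub (continuous_charB hZ)))
  simpa using this

omit hZ hd in
theorem hasDerivAt_duhamel_time (x t : ℝ) :
    HasDerivAt (fun s => duhamel F x s) (duhamelVel F x t) t := by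
  have c : Continuous fun s => duhamelVel F x s :=
    continuous_along (continuous_duhamelVel hF) (by fun_prop) (by fun_prop)
  exact intervalIntegral.integral_hasDerivAt_right (c.intervalIntegrable _ _)
    (c.stronglyMeasurableAtFilter _ _) c.continuousAt

/-- As `duhamel` integrates the velocity at fixed `x`, differentiating under the integral gives the
time integral of `duhamelVel Z`. This is evaluated by noting that in the time derivative of `charA F
- charB F` the two copies of `F` cancel, leaving `charA Z + charB Z`. -/
theorem hasDerivAt_duhamel_space (x t : ℝ) :
    HasDerivAt (fun y => duhamel F y t) ((charA F x t - charB F x t) / 2) x := by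
  have h1 := hasDerivAt_parametric_integral (continuous_duhamelVel hF) (continuous_duhamelVel hZ)
    (fun y s => ((hasDerivAt_charA_space hF hZ hd y s).add
      (hasDerivAt_charB_space hF hZ hd y s)).div_const 2) x t
  have h2 : ∫ s in (0 : ℝ)..t, duhamelVel Z x s = (charA F x t - charB F x t) / 2 := by
    rw [intervalIntegral.integral_eq_sub_of_hasDerivAt
      (f := fun s => (charA F x s - charB F x s) / 2)]
    · simp [charA, charB]
    · intro s _
      have := ((hasDerivAt_charA_time hF hZ hd x s).sub
        (hasDerivAt_charB_time hF hZ hd x s)).div_const 2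
      convert! this using 1
      unfold duhamelVel; ring
    · exact (continuous_along (continuous_duhamelVel hZ) (by fun_prop) (by fun_prop)).intervalIntegrable _ _
  rw [← h2]
  exact h1

/-- The solution of the inhomogeneous wave equation given by d'Alembert's and Duhamel's
formulas. -/
theorem wave_solution {P Q : ℝ → ℝ} (hP : ContDiff ℝ 2 P) (hQ : ContDiff ℝ 2 Q) :
    let u : ℝ → ℝ → ℝ := fun x t => P (x + t) + Q (x - t) + duhamel F x t
    ContDiff ℝ 2 (fun z : ℝ × ℝ => u z.1 z.2) ∧
    (∀ x t, HasDerivAt (fun s => u x s) (deriv P (x + t) - deriv Q (x - t) + duhamelVel F x t) t) ∧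
    ∀ x t, iteratedDeriv 2 (fun s => u x s) t - iteratedDeriv 2 (fun y => u y t) x = F x t := by
  intro u
  have hPd : ∀ y, HasDerivAt P (deriv P y) y := fun y =>
    (hP.differentiable (by norm_num) y).hasDerivAt
  have hQd : ∀ y, HasDerivAt Q (deriv Q y) y := fun y =>
    (hQ.differentiable (by norm_num) y).hasDerivAt
  have hP1 : ContDiff ℝ 1 (deriv P) := hP.deriv'
  have hQ1 : ContDiff ℝ 1 (deriv Q) := hQ.deriv'
  have hPd2 : ∀ y, HasDerivAt (deriv P) (deriv (deriv P) y) y := fun y =>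
    (hP1.differentiable (by norm_num) y).hasDerivAt
  have hQd2 : ∀ y, HasDerivAt (deriv Q) (deriv (deriv Q) y) y := fun y =>
    (hQ1.differentiable (by norm_num) y).hasDerivAt
  have hut : ∀ x t, HasDerivAt (fun s => u x s)
      (deriv P (x + t) - deriv Q (x - t) + duhamelVel F x t) t := by
    intro x t
    have h1 := (hPd (x + t)).comp t ((hasDerivAt_id t).const_add x)
    have h2 := (hQd (x - t)).comp t ((hasDerivAt_id t).const_sub x)
    have := (h1.add h2).add (hasDerivAt_duhamel_time hF x t)
    convert! this using 1
    ring
  have hux : ∀ x t, HasDerivAt (fun y => u y t)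
      (deriv P (x + t) + deriv Q (x - t) + (charA F x t - charB F x t) / 2) x := by
    intro x t
    have h1 := (hPd (x + t)).comp x ((hasDerivAt_id x).add_const t)
    have h2 := (hQd (x - t)).comp x ((hasDerivAt_id x).sub_const t)
    have := (h1.add h2).add (hasDerivAt_duhamel_space hF hZ hd x t)
    convert! this using 1
    ring
  refine ⟨?_, hut, ?_⟩
  · have hA := contDiff_charA hF hZ hd
    have hB := contDiff_charB hF hZ hd
    have hP2 : ContDiff ℝ 1 fun z : ℝ × ℝ => deriv P (z.1 + z.2) :=
      hP1.comp (contDiff_fst.add contDiff_snd)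
    have hQ2 : ContDiff ℝ 1 fun z : ℝ × ℝ => deriv Q (z.1 - z.2) :=
      hQ1.comp (contDiff_fst.sub contDiff_snd)
    exact contDiff_succ_of_partial (n := 1) hux hut
      ((hP2.add hQ2).add ((hA.sub hB).div_const 2)) ((hP2.sub hQ2).add ((hA.add hB).div_const 2))
  · intro x t
    simp only [iteratedDeriv_succ, iteratedDeriv_zero]
    have e1 : deriv (fun s => u x s)
        = fun s => deriv P (x + s) - deriv Q (x - s) + duhamelVel F x s :=
      funext fun s => (hut x s).deriv
    have e2 : deriv (fun y => u y t)
        = fun y => deriv P (y + t) + deriv Q (y - t) + (charA F y t - charB F y t) / 2 :=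
      funext fun y => (hux y t).deriv
    rw [e1, e2]
    have h1 := ((hPd2 (x + t)).comp t ((hasDerivAt_id t).const_add x)).sub
      ((hQd2 (x - t)).comp t ((hasDerivAt_id t).const_sub x))
    have h2 := ((hPd2 (x + t)).comp x ((hasDerivAt_id x).add_const t)).add
      ((hQd2 (x - t)).comp x ((hasDerivAt_id x).sub_const t))
    -- In `u_tt` the source appears twice with weight `1 / 2`; the integrals of `Z` are the same in
    -- `u_tt` and `u_xx` and cancel.
    have h3 := h1.add (((hasDerivAt_charA_time hF hZ hd x t).add
      (hasDerivAt_charB_time hF hZ hd x t)).div_const 2)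
    have h4 := h2.add (((hasDerivAt_charA_space hF hZ hd x t).sub
      (hasDerivAt_charB_space hF hZ hd x t)).div_const 2)
    have e3 := h3.deriv
    have e4 := h4.deriv
    refine (congrArg₂ (· - ·) e3 e4).trans ?_
    ring

end Source

/-! ### Profiles of the free solution -/

/-- A `C²` function which vanishes on `(-∞, -R]` and equals `c` on `[R, ∞)`. -/
structure IsProfile (P : ℝ → ℝ) (R c : ℝ) : Prop where
  contDiff : ContDiff ℝ 2 P
  left : ∀ x ≤ -R, P x = 0
  right : ∀ x, R ≤ x → P x = c

namespace IsProfile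

variable {P : ℝ → ℝ} {R c : ℝ} (hP : IsProfile P R c)

include hP

theorem hasDerivAt (x : ℝ) : HasDerivAt P (deriv P x) x :=
  (hP.contDiff.differentiable (by norm_num) x).hasDerivAt

theorem contDiff_deriv : ContDiff ℝ 1 (deriv P) := hP.contDiff.deriv'

/-- Uniqueness of one-sided derivatives covers the endpoint `-R`, near which `P` is known to be
constant only on the left. -/
theorem deriv_left {x : ℝ} (hx : x ≤ -R) : deriv P x = 0 := by
  have h1 : HasDerivWithinAt P (deriv P x) (Iic x) x := (hP.hasDerivAt x).hasDerivWithinAt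
  have h2 : HasDerivWithinAt P 0 (Iic x) x :=
    (hasDerivWithinAt_const x (Iic x) (0 : ℝ)).congr (fun y hy => hP.left y (le_trans hy hx))
      (hP.left x hx)
  exact (uniqueDiffOn_Iic x x self_mem_Iic).eq_deriv _ h1 h2

theorem deriv_right {x : ℝ} (hx : R ≤ x) : deriv P x = 0 := by
  have h1 : HasDerivWithinAt P (deriv P x) (Ici x) x := (hP.hasDerivAt x).hasDerivWithinAt
  have h2 : HasDerivWithinAt P 0 (Ici x) x :=
    (hasDerivWithinAt_const x (Ici x) c).congr (fun y hy => hP.right y (le_trans hx hy))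
      (hP.right x hx)
  exact (uniqueDiffOn_Ici x x self_mem_Ici).eq_deriv _ h1 h2

theorem hasCompactSupport_deriv : HasCompactSupport (deriv P) := by
  refine HasCompactSupport.intro (isCompact_Icc (a := -R) (b := R)) fun x hx => ?_
  rcases le_or_gt x (-R) with h | h
  · exact hP.deriv_left h
  · refine hP.deriv_right ?_
    by_contra! h'
    exact hx ⟨h.le, h'.le⟩

theorem smul (ε : ℝ) : IsProfile (fun x => ε * P x) R (ε * c) where
  contDiff := contDiff_const.mul hP.contDiff
  left x hx := by simp [hP.left x hx]
  right x hx := by simp [hP.right x hx]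

theorem deriv_smul (ε x : ℝ) : deriv (fun x => ε * P x) x = ε * deriv P x :=
  ((hP.hasDerivAt x).const_mul ε).deriv

theorem exists_bound : ∃ M, 0 < M ∧ ∀ x, |P x| ≤ M ∧ |deriv P x| ≤ M := by
  obtain ⟨M₁, h₁⟩ := (isCompact_Icc (a := -R) (b := R)).exists_bound_of_continuousOn
    hP.contDiff.continuous.continuousOn
  obtain ⟨M₂, h₂⟩ := hP.hasCompactSupport_deriv.exists_bound_of_continuous
    hP.contDiff_deriv.continuous
  refine ⟨|M₁| + |M₂| + |c| + 1, by positivity, fun x => ⟨?_, ?_⟩⟩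
  · have a1 := abs_nonneg M₁
    have a2 := abs_nonneg M₂
    have a3 := abs_nonneg c
    rcases le_or_gt x (-R) with h | h
    · rw [hP.left x h, abs_zero]; positivity
    rcases le_or_gt R x with h' | h'
    · rw [hP.right x h']; linarith
    · have := h₁ x ⟨h.le, h'.le⟩
      rw [Real.norm_eq_abs] at this
      linarith [le_abs_self M₁]
  · have := h₂ x
    rw [Real.norm_eq_abs] at this
    linarith [le_abs_self M₂, abs_nonneg M₁, abs_nonneg c]

end IsProfile

/-- Supplies the uniform hypotheses of `exists_hasDerivAt_source`. A profile is not compactly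
supported, but its derivative is; the lemma serves for the profiles and for their derivatives. -/
theorem exists_lipschitz_taylor_of_hasCompactSupport_deriv {φ : ℝ → ℝ} (hφ : ContDiff ℝ 1 φ)
    (hs : HasCompactSupport (deriv φ)) :
    ∃ C, 0 ≤ C ∧ (∀ y, |deriv φ y| ≤ C) ∧ (∀ y k, |φ (y + k) - φ y| ≤ C * |k|) ∧
      ∀ η > 0, ∃ d > 0, ∀ y k, |k| < d → |φ (y + k) - φ y - k * deriv φ y| ≤ η * |k| := by
  have hc : Continuous (deriv φ) := hφ.continuous_deriv (by norm_num)
  have hd : Differentiable ℝ φ := hφ.differentiable (by norm_num)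
  obtain ⟨C, hC⟩ := hs.exists_bound_of_continuous hc
  refine ⟨C, (norm_nonneg _).trans (hC 0), hC, fun y k => ?_, fun η hη => ?_⟩
  · have := Convex.norm_image_sub_le_of_norm_deriv_le (𝕜 := ℝ) (f := φ) (fun x _ => hd x)
      (fun x _ => hC x) convex_univ (mem_univ y) (mem_univ (y + k))
    simpa using this
  · have hu : UniformContinuous (fderiv ℝ φ) := by
      have h1 : UniformContinuous (deriv φ) := hs.uniformContinuous_of_continuous hc
      have h2 : fderiv ℝ φ = fun x => ContinuousLinearMap.toSpanSingletonCLE (𝕜 := ℝ) (E := ℝ)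
          (deriv φ x) := by
        ext x; simp
      rw [h2]
      exact (ContinuousLinearMap.toSpanSingletonCLE (𝕜 := ℝ) (E := ℝ)).toContinuousLinearMap.uniformContinuous.comp h1
    obtain ⟨d, hd0, h⟩ := exists_forall_taylor_le hd hu hη
    refine ⟨d, hd0, fun y k hk => ?_⟩
    have := h y k hk
    rwa [fderiv_eq_smul_deriv, smul_eq_mul, Real.norm_eq_abs] at this

/-! ### The nonlinearity -/

/-- The nonlinearity `A |v|^p |u|^q + B |u|^r`. -/
noncomputable def nonlin (p q r A B u v : ℝ) : ℝ := A * |v| ^ p * |u| ^ q + B * |u| ^ r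

theorem nonlin_nonneg {A B : ℝ} (hA : 0 ≤ A) (hB : 0 ≤ B) (p q r u v : ℝ) :
    0 ≤ nonlin p q r A B u v := by
  unfold nonlin; positivity

theorem nonlin_zero {p r : ℝ} (hp : 0 < p) (hr : 0 < r) (q A B : ℝ) : nonlin p q r A B 0 0 = 0 := by
  simp [nonlin, Real.zero_rpow hp.ne', Real.zero_rpow hr.ne']

theorem nonlin_le {p q r A B u v a b : ℝ} (hp : 0 ≤ p) (hq : 0 ≤ q) (hr : 0 ≤ r) (hA : 0 ≤ A)
    (hB : 0 ≤ B) (hu : |u| ≤ a) (hv : |v| ≤ b) :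
    nonlin p q r A B u v ≤ A * b ^ p * a ^ q + B * a ^ r := by
  have ha : 0 ≤ a := (abs_nonneg u).trans hu
  have hb : 0 ≤ b := (abs_nonneg v).trans hv
  unfold nonlin
  gcongr

/-- The power `|x|^s` is `C¹` for `s > 1`, and `|u|^q` is constant for `q = 0`; this is where the
restriction on `q` enters. -/
theorem contDiff_nonlin {p q r : ℝ} (hp : 1 < p) (hq : q = 0 ∨ 1 < q) (hr : 1 < r) (A B : ℝ) :
    ContDiff ℝ 1 fun w : ℝ × ℝ => nonlin p q r A B w.1 w.2 := by
  unfold nonlin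
  have h1 : ∀ s : ℝ, 1 < s → ContDiff ℝ 1 fun x : ℝ => |x| ^ s := fun s hs =>
    contDiff_norm_rpow (E := ℝ) hs
  have h2 : ContDiff ℝ 1 fun x : ℝ => |x| ^ q := by
    rcases hq with rfl | hq
    · simpa using contDiff_const
    · exact h1 q hq
  have e1 := (h1 p hp).comp (contDiff_snd (E := ℝ) (F := ℝ))
  have e2 := h2.comp (contDiff_fst (E := ℝ) (F := ℝ))
  have e3 := (h1 r hr).comp (contDiff_fst (E := ℝ) (F := ℝ))
  exact ((contDiff_const.mul e1).mul e2).add (contDiff_const.mul e3)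

/-! ### Duhamel terms of sources concentrated near the light cone -/

theorem integral_indicator_Icc_le {a b k t : ℝ} (hab : a ≤ b) (hk : 0 ≤ k) (ht : 0 ≤ t) :
    ∫ s in (0 : ℝ)..t, (Icc a b).indicator (fun _ => k) s ≤ k * (b - a) := by
  rw [intervalIntegral.integral_of_le ht]
  have hi : Integrable ((Icc a b).indicator fun _ : ℝ => k) :=
    (integrable_indicator_iff measurableSet_Icc).2 (by simp)
  refine (setIntegral_le_integral hi (Eventually.of_forall fun s =>
    indicator_nonneg (fun _ _ => hk) s)).trans (le_of_eq ?_)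
  rw [integral_indicator_const _ measurableSet_Icc]
  simp [Measure.real, hab, mul_comm]

theorem intervalIntegrable_indicator_Icc (a b k s t : ℝ) :
    IntervalIntegrable ((Icc a b).indicator fun _ : ℝ => k) volume s t :=
  ((integrable_indicator_iff measurableSet_Icc).2 (by simp)).intervalIntegrable

/-- A function on space-time with value `0` outside the domain of influence of `[-R, R]`, `k` near
the light cone and `l` inside the light cone. -/
noncomputable def coneBound (R k l x t : ℝ) : ℝ :=
  if t + R < |x| then 0 else if t - |x| ≤ R then k else l

section ConeBound

variable {R k l T : ℝ} {F : ℝ → ℝ → ℝ} (hR : 1 ≤ R) (hT : 1 ≤ T) (hk : 0 ≤ k) (hl : 0 ≤ l)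
  (hF : Continuous (Function.uncurry F))
  (hb : ∀ x, ∀ t ∈ Icc 0 T, F x t ∈ Icc 0 (coneBound R k l x t))

include hb in
theorem charA_nonneg_of_coneBound (x : ℝ) {t : ℝ} (ht : t ∈ Icc 0 T) : 0 ≤ charA F x t :=
  intervalIntegral.integral_nonneg ht.1 fun s hs => (hb _ s ⟨hs.1, hs.2.trans ht.2⟩).1

include hb in
theorem coneBound_reflect :
    ∀ x, ∀ t ∈ Icc 0 T, reflect F x t ∈ Icc 0 (coneBound R k l x t) := by
  intro x t ht
  have := hb (-x) t ht
  simpa [reflect, coneBound] using this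

include hb in
theorem eq_zero_of_coneBound {x t : ℝ} (ht : t ∈ Icc 0 T) (hx : t + R < |x|) : F x t = 0 := by
  have := hb x t ht
  rw [coneBound, if_pos hx] at this
  exact le_antisymm this.2 this.1

include hb in
theorem charA_eq_zero_of_coneBound {x t : ℝ} (ht : t ∈ Icc 0 T)
    (hx : x + t < -R ∨ t + R < |x|) : charA F x t = 0 := by
  unfold charA
  rw [intervalIntegral.integral_congr (g := fun _ => 0), intervalIntegral.integral_zero]
  intro s hs
  rw [uIcc_of_le ht.1] at hs
  refine eq_zero_of_coneBound hb ⟨hs.1, hs.2.trans ht.2⟩ ?_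
  have h1 := neg_abs_le (x + t - s)
  have h2 := le_abs_self (x + t - s)
  rcases hx with hx | hx
  · linarith
  · rcases lt_abs.1 hx with h | h
    · linarith [hs.2]
    · linarith [hs.2, hs.1]

-- A characteristic with `x + t > R` crosses the strip on the right during a time `R`, which costs
-- `R k`, and is otherwise inside the cone or outside it. A characteristic with `|x + t| ≤ R` never
-- enters the interior but may stay in the left strip all the time, which costs up to `T k`. For
-- fixed `x` this happens only for `t` in an interval of length `2 R`, whence the indicator.
include hR hk hl hF hb in
theorem charA_le_of_coneBound (x : ℝ) {t : ℝ} (ht : t ∈ Icc 0 T) :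
    charA F x t ≤ R * k + T * l + (Icc (-R - x) (R - x)).indicator (fun _ => T * k) t := by
  have hT0 : 0 ≤ T := ht.1.trans ht.2
  have hc : Continuous fun s => F (x + t - s) s := continuous_along hF (by fun_prop) (by fun_prop)
  rcases lt_or_ge (x + t) (-R) with h1 | h1
  · rw [charA_eq_zero_of_coneBound hb ht (Or.inl h1)]
    have := indicator_nonneg (s := Icc (-R - x) (R - x)) (f := fun _ => T * k)
      (fun _ _ => by positivity) t
    positivity
  rcases le_or_gt (x + t) R with h2 | h2
  · rw [indicator_of_mem (show t ∈ Icc (-R - x) (R - x) from ⟨by linarith, by linarith⟩)]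
    have : charA F x t ≤ ∫ s in (0 : ℝ)..t, k := by
      refine intervalIntegral.integral_mono_on ht.1 (hc.intervalIntegrable _ _)
        intervalIntegrable_const fun s hs => ?_
      have h3 := (hb (x + t - s) s ⟨hs.1, hs.2.trans ht.2⟩).2
      unfold coneBound at h3
      split_ifs at h3 with h4 h5
      · linarith
      · exact h3
      · linarith [neg_abs_le (x + t - s)]
    rw [intervalIntegral.integral_const, smul_eq_mul, sub_zero] at this
    have h3 : t * k ≤ T * k := by gcongr; exact ht.2
    have : 0 ≤ R * k + T * l := by positivity
    linarith
  · rw [indicator_of_notMem (fun h => by linarith [h.2])]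
    have hi : IntervalIntegrable ((Icc ((x + t - R) / 2) ((x + t + R) / 2)).indicator
      fun _ : ℝ => k) volume 0 t := intervalIntegrable_indicator_Icc _ _ _ _ _
    have : charA F x t ≤ ∫ s in (0 : ℝ)..t,
        (l + (Icc ((x + t - R) / 2) ((x + t + R) / 2)).indicator (fun _ => k) s) := by
      refine intervalIntegral.integral_mono_on ht.1 (hc.intervalIntegrable _ _)
        (intervalIntegrable_const.add hi) fun s hs => ?_
      have h3 := (hb (x + t - s) s ⟨hs.1, hs.2.trans ht.2⟩).2
      have h0 := indicator_nonneg (s := Icc ((x + t - R) / 2) ((x + t + R) / 2)) (f := fun _ => k)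
        (fun _ _ => by positivity) s
      unfold coneBound at h3
      split_ifs at h3 with h4 h5
      · linarith
      · rw [indicator_of_mem]
        · linarith
        · have h6 : x + t - s ≥ 0 := by
            by_contra! h7
            rw [abs_of_neg h7] at h5
            linarith
          rw [abs_of_nonneg h6] at h4 h5
          constructor <;> linarith
      · linarith
    rw [intervalIntegral.integral_add intervalIntegrable_const hi,
      intervalIntegral.integral_const, smul_eq_mul, sub_zero] at this
    have h4 := integral_indicator_Icc_le (a := (x + t - R) / 2) (b := (x + t + R) / 2) (by linarith)
      hk ht.1
    have h5 : t * l ≤ T * l := by gcongr; exact ht.2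
    have h6 : k * ((x + t + R) / 2 - (x + t - R) / 2) = R * k := by ring
    linarith

include hb in
theorem duhamelVel_nonneg_of_coneBound (x : ℝ) {t : ℝ} (ht : t ∈ Icc 0 T) :
    0 ≤ duhamelVel F x t := by
  unfold duhamelVel
  rw [charB_eq_charA_reflect]
  have h1 := charA_nonneg_of_coneBound hb x ht
  have h2 := charA_nonneg_of_coneBound (coneBound_reflect hb) (-x) ht
  linarith

include hb in
theorem duhamel_nonneg_of_coneBound (x : ℝ) {t : ℝ} (ht : t ∈ Icc 0 T) : 0 ≤ duhamel F x t :=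
  intervalIntegral.integral_nonneg ht.1 fun _ hs =>
    duhamelVel_nonneg_of_coneBound hb x ⟨hs.1, hs.2.trans ht.2⟩

include hR hk hl hF hb in
theorem duhamelVel_le_of_coneBound (x : ℝ) {t : ℝ} (ht : t ∈ Icc 0 T) :
    duhamelVel F x t ≤ R * k + T * l
      + ((Icc (-R - x) (R - x)).indicator (fun _ => T * k) t
        + (Icc (-R + x) (R + x)).indicator (fun _ => T * k) t) / 2 := by
  unfold duhamelVel
  rw [charB_eq_charA_reflect]
  have h1 := charA_le_of_coneBound hR hk hl hF hb x ht
  have h2 := charA_le_of_coneBound hR hk hl (continuous_reflect hF) (coneBound_reflect hb) (-x) ht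
  rw [sub_neg_eq_add, sub_neg_eq_add] at h2
  linarith

include hb in
theorem duhamelVel_eq_zero_of_coneBound {x t : ℝ} (ht : t ∈ Icc 0 T) (hx : t + R < |x|) :
    duhamelVel F x t = 0 := by
  unfold duhamelVel
  rw [charB_eq_charA_reflect, charA_eq_zero_of_coneBound hb ht (Or.inr hx),
    charA_eq_zero_of_coneBound (coneBound_reflect hb) ht (Or.inr (by rwa [abs_neg]))]
  simp

include hb in
theorem duhamel_eq_zero_of_coneBound {x t : ℝ} (ht : t ∈ Icc 0 T) (hx : t + R < |x|) :
    duhamel F x t = 0 := by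
  unfold duhamel
  rw [intervalIntegral.integral_congr (g := fun _ => 0), intervalIntegral.integral_zero]
  intro s hs
  rw [uIcc_of_le ht.1] at hs
  exact duhamelVel_eq_zero_of_coneBound hb ⟨hs.1, hs.2.trans ht.2⟩ (by linarith [hs.2])

include hR hT hk hl hF hb in
theorem duhamelVel_le_mul_of_coneBound (x : ℝ) {t : ℝ} (ht : t ∈ Icc 0 T) :
    duhamelVel F x t ≤ T * (3 * R * k + T * l) := by
  have h1 := duhamelVel_le_of_coneBound hR hk hl hF hb x ht
  have h2 : ∀ s : Set ℝ, s.indicator (fun _ => T * k) t ≤ T * k := fun s =>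
    indicator_le_self' (fun _ _ => by positivity) t
  have h3 := h2 (Icc (-R - x) (R - x))
  have h4 := h2 (Icc (-R + x) (R + x))
  have h5 : 0 ≤ R * k := by positivity
  have h6 : 0 ≤ T * l := by positivity
  have h7 : R * k ≤ T * (R * k) := le_mul_of_one_le_left h5 hT
  have h8 : T * l ≤ T * (T * l) := le_mul_of_one_le_left h6 hT
  have h9 : T * k ≤ R * (T * k) := le_mul_of_one_le_left (by positivity) hR
  nlinarith

-- Inside the cone both indicators vanish, so the velocity is smaller than the Duhamel term by a
-- factor of order `T`. This is what makes the mixed nonlinearity weak there.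
include hR hk hl hF hb in
theorem duhamelVel_le_inside_of_coneBound {x t : ℝ} (ht : t ∈ Icc 0 T) (hx : R < t - |x|) :
    duhamelVel F x t ≤ 3 * R * k + T * l := by
  have h1 := duhamelVel_le_of_coneBound hR hk hl hF hb x ht
  rw [indicator_of_notMem (fun h => by linarith [h.2, neg_abs_le x]),
    indicator_of_notMem (fun h => by linarith [h.2, le_abs_self x])] at h1
  have : 0 ≤ R * k := by positivity
  linarith

-- The velocity may be as large as `T k` in the strip, but a fixed `x` stays in each half of the
-- strip only for a time `2 R`, so integration yields `2 R T k` and not `T² k`.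
include hR hT hk hl hF hb in
theorem duhamel_le_of_coneBound (x : ℝ) {t : ℝ} (ht : t ∈ Icc 0 T) :
    duhamel F x t ≤ T * (3 * R * k + T * l) := by
  have i1 := intervalIntegrable_indicator_Icc (-R - x) (R - x) (T * k) 0 t
  have i2 := intervalIntegrable_indicator_Icc (-R + x) (R + x) (T * k) 0 t
  have h1 : duhamel F x t ≤ ∫ s in (0 : ℝ)..t, (R * k + T * l
      + ((Icc (-R - x) (R - x)).indicator (fun _ => T * k) s
        + (Icc (-R + x) (R + x)).indicator (fun _ => T * k) s) / 2) := by
    refine intervalIntegral.integral_mono_on ht.1 ?_ ?_ fun s hs =>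
      duhamelVel_le_of_coneBound hR hk hl hF hb x ⟨hs.1, hs.2.trans ht.2⟩
    · exact (continuous_along (continuous_duhamelVel hF) (by fun_prop)
        (by fun_prop)).intervalIntegrable _ _
    · exact intervalIntegrable_const.add ((i1.add i2).div_const 2)
  rw [intervalIntegral.integral_add intervalIntegrable_const ((i1.add i2).div_const 2),
    intervalIntegral.integral_div, intervalIntegral.integral_add i1 i2,
    intervalIntegral.integral_const, smul_eq_mul, sub_zero] at h1
  have h2 := integral_indicator_Icc_le (a := -R - x) (b := R - x) (k := T * k) (by linarith)
    (by positivity) ht.1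
  have h3 := integral_indicator_Icc_le (a := -R + x) (b := R + x) (k := T * k) (by linarith)
    (by positivity) ht.1
  have h4 : t * (R * k + T * l) ≤ T * (R * k + T * l) := by gcongr; exact ht.2
  linarith

end ConeBound

/-! ### Existence by a bootstrap on the size of the source -/

/-- Existence of a classical solution on `[0, T)` close to the free solution, provided that the
Duhamel term of the expected source is small. -/
theorem exists_controlled_solution {p q r A B : ℝ} (hp : 1 < p) (hq : q = 0 ∨ 1 < q) (hr : 1 < r)
    (hA : 0 ≤ A) (hB : 0 ≤ B) {P Q : ℝ → ℝ} {R c T δ E : ℝ} (hP : IsProfile P R c)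
    (hQ : IsProfile Q R (-c)) (hR : 1 ≤ R) (hT : 1 ≤ T) (hδ : 0 ≤ δ)
    (hE : ∀ x y, |P x + Q y| ≤ E ∧ |deriv P x - deriv Q y| ≤ E) (hE1 : E + δ ≤ 1)
    (hclose : T * (3 * R * (A * (E + δ) ^ p * (E + δ) ^ q + B * (E + δ) ^ r)
      + T * (A * (δ / T) ^ p * (|c| + δ) ^ q + B * (|c| + δ) ^ r)) ≤ δ) :
    ∃ u, IsClassicalSolution p q r A B (fun x => P x + Q x) (fun x => deriv P x - deriv Q x) T u ∧
      ∀ x, ∀ t ∈ Ico 0 T, u x t ≤ P (x + t) + Q (x - t) + δ := by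
  have hT0 : 0 < T := by linarith
  have hE0 : 0 ≤ E := (abs_nonneg _).trans (hE 0 0).1
  have hq0 : 0 ≤ q := by rcases hq with h | h <;> linarith
  set k := A * (E + δ) ^ p * (E + δ) ^ q + B * (E + δ) ^ r with hk
  set l := A * (δ / T) ^ p * (|c| + δ) ^ q + B * (|c| + δ) ^ r with hl
  have hk0 : 0 ≤ k := by positivity
  have hl0 : 0 ≤ l := by positivity
  -- The cut-off makes the nonlinearity globally Lipschitz. It equals `1` on the unit ball of the
  -- sup norm, where `(u, u_t)` turns out to lie by `hE1`, and it only decreases a non-negative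
  -- nonlinearity.
  let χ : ContDiffBump (0 : ℝ × ℝ) := ⟨1, 2, one_pos, one_lt_two⟩
  set H : ℝ × ℝ → ℝ := fun w => χ w * nonlin p q r A B w.1 w.2 with hH
  have hHc : ContDiff ℝ 1 H := χ.contDiff.mul (contDiff_nonlin hp hq hr A B)
  have hHs : HasCompactSupport H := χ.hasCompactSupport.mul_right
  have hHn : ∀ w, 0 ≤ H w := fun w => mul_nonneg χ.nonneg (nonlin_nonneg hA hB _ _ _ _ _)
  have hHle : ∀ w, H w ≤ nonlin p q r A B w.1 w.2 := fun w =>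
    mul_le_of_le_one_left (nonlin_nonneg hA hB _ _ _ _ _) χ.le_one
  have hHe : ∀ u v : ℝ, |u| ≤ 1 → |v| ≤ 1 → H (u, v) = nonlin p q r A B u v := by
    intro u v hu hv
    simp only [hH]
    rw [χ.one_of_mem_closedBall, one_mul]
    rw [mem_closedBall_zero_iff]
    exact max_le hu hv
  obtain ⟨C₁, hC₁, b₁, l₁, d₁⟩ := exists_lipschitz_taylor_of_hasCompactSupport_deriv
    (hP.contDiff.of_le (by norm_num)) hP.hasCompactSupport_deriv
  obtain ⟨C₂, hC₂, b₂, l₂, d₂⟩ := exists_lipschitz_taylor_of_hasCompactSupport_deriv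
    (hQ.contDiff.of_le (by norm_num)) hQ.hasCompactSupport_deriv
  obtain ⟨C₃, hC₃, b₃, l₃, d₃⟩ := exists_lipschitz_taylor_of_hasCompactSupport_deriv
    hP.contDiff_deriv hP.hasCompactSupport_deriv.deriv
  obtain ⟨C₄, hC₄, b₄, l₄, d₄⟩ := exists_lipschitz_taylor_of_hasCompactSupport_deriv
    hQ.contDiff_deriv hQ.hasCompactSupport_deriv.deriv
  have cP := hP.contDiff.continuous
  have cQ := hQ.contDiff.continuous
  have cP' := hP.contDiff_deriv.continuous
  have cQ' := hQ.contDiff_deriv.continuous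
  have cP'' := hP.contDiff_deriv.continuous_deriv (by norm_num)
  have cQ'' := hQ.contDiff_deriv.continuous_deriv (by norm_num)
  set U₀ : ℝ → ℝ → ℝ := fun x t => P (x + t) + Q (x - t) with hU₀
  set V₀ : ℝ → ℝ → ℝ := fun x t => deriv P (x + t) - deriv Q (x - t) with hV₀
  have cU₀ : Continuous (Function.uncurry U₀) := by
    have : Continuous fun z : ℝ × ℝ => P (z.1 + z.2) + Q (z.1 - z.2) := by fun_prop
    exact this
  have cV₀ : Continuous (Function.uncurry V₀) := by
    have : Continuous fun z : ℝ × ℝ => deriv P (z.1 + z.2) - deriv Q (z.1 - z.2) := by fun_prop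
    exact this
  obtain ⟨LH, hLH⟩ := hHc.lipschitzWith_of_hasCompactSupport hHs (by norm_num)
  have hlip : ∀ z w w' : ℝ × ℝ, |H (U₀ z.1 z.2 + w.1, V₀ z.1 z.2 + w.2)
      - H (U₀ z.1 z.2 + w'.1, V₀ z.1 z.2 + w'.2)| ≤ LH * (|w.1 - w'.1| + |w.2 - w'.2|) := by
    intro z w w'
    have := hLH.dist_le_mul (U₀ z.1 z.2 + w.1, V₀ z.1 z.2 + w.2)
      (U₀ z.1 z.2 + w'.1, V₀ z.1 z.2 + w'.2)
    rw [Real.dist_eq] at this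
    refine this.trans ?_
    gcongr
    rw [Prod.dist_eq, Real.dist_eq, Real.dist_eq]
    simp only [add_sub_add_left_eq_sub]
    exact max_le_add_of_nonneg (abs_nonneg _) (abs_nonneg _)
  obtain ⟨MH, hMH⟩ := hHs.exists_bound_of_continuous hHc.continuous
  obtain ⟨F, hFc, hFK, hFb, hFe⟩ := exists_volterra_solution (T := T) (L := LH) (M := MH) hT0.le
    LH.2 (fun z w => H (U₀ z.1 z.2 + w.1, V₀ z.1 z.2 + w.2))
    (by
      refine hHc.continuous.comp (Continuous.prodMk ?_ ?_)
      · exact (cU₀.comp continuous_fst).add (continuous_fst.comp continuous_snd)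
      · exact (cV₀.comp continuous_fst).add (continuous_snd.comp continuous_snd))
    hlip (fun z => hMH _)
    -- The invariant set of sources: zero outside the cone, at most `k` in the strip and at most `l`
    -- inside. Its invariance is the content of `hclose`.
    {F | ∀ x, ∀ t ∈ Icc 0 T, F x t ∈ Icc 0 (coneBound R k l x t)}
    (by
      simp only [ofPred_forall]
      refine isClosed_iInter fun x => isClosed_iInter fun t => isClosed_iInter fun _ => ?_
      have : Continuous fun F : ℝ → ℝ → ℝ => F x t := by fun_prop
      exact isClosed_Icc.preimage this)
    (fun x t _ => ⟨le_rfl, by unfold coneBound; split_ifs <;> simp [hk0, hl0]⟩)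
    (by
      intro F hF hb F' hF' x t ht
      rw [hF' x t ht]
      refine ⟨hHn _, ?_⟩
      have n1 := duhamel_nonneg_of_coneBound hb x ht
      have n2 := duhamelVel_nonneg_of_coneBound hb x ht
      have m1 := (duhamel_le_of_coneBound hR hT hk0 hl0 hF hb x ht).trans hclose
      have m2 := (duhamelVel_le_mul_of_coneBound hR hT hk0 hl0 hF hb x ht).trans hclose
      simp only
      unfold coneBound
      split_ifs with c1 c2
      · rw [duhamel_eq_zero_of_coneBound hb ht c1, duhamelVel_eq_zero_of_coneBound hb ht c1]
        have e1 : U₀ x t = 0 ∧ V₀ x t = 0 := by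
          simp only [hU₀, hV₀]
          rcases lt_abs.1 c1 with h | h
          · rw [hP.right _ (by linarith [ht.1]), hQ.right _ (by linarith),
              hP.deriv_right (by linarith [ht.1]), hQ.deriv_right (by linarith)]
            simp
          · rw [hP.left _ (by linarith), hQ.left _ (by linarith [ht.1]),
              hP.deriv_left (by linarith), hQ.deriv_left (by linarith [ht.1])]
            simp
        refine (hHle _).trans (le_of_eq ?_)
        rw [e1.1, e1.2]
        simp [nonlin_zero (by linarith : 0 < p) (by linarith : 0 < r)]
      · refine (hHle _).trans (nonlin_le (by linarith) hq0 (by linarith) hA hB ?_ ?_)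
        · refine (abs_add_le _ _).trans (add_le_add (hE _ _).1 ?_)
          rwa [abs_of_nonneg n1]
        · refine (abs_add_le _ _).trans (add_le_add (hE _ _).2 ?_)
          rwa [abs_of_nonneg n2]
      · rw [not_le] at c2
        have m3 := duhamelVel_le_inside_of_coneBound hR hk0 hl0 hF hb ht c2
        have e1 : U₀ x t = c ∧ V₀ x t = 0 := by
          simp only [hU₀, hV₀]
          have h1 := neg_abs_le x
          have h2 := le_abs_self x
          rw [hP.right _ (by linarith), hQ.left _ (by linarith),
            hP.deriv_right (by linarith), hQ.deriv_left (by linarith)]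
          simp
        refine (hHle _).trans (nonlin_le (by linarith) hq0 (by linarith) hA hB ?_ ?_)
        · refine (abs_add_le _ _).trans (add_le_add (by rw [e1.1]) ?_)
          rwa [abs_of_nonneg n1]
        -- The free velocity vanishes inside the cone, so `u_t` is the Duhamel velocity alone, and
        -- `T` times its bound is the left side of `hclose`.
        · rw [e1.2, zero_add, abs_of_nonneg n2, le_div_iff₀ hT0, mul_comm]
          exact (mul_le_mul_of_nonneg_left m3 hT0.le).trans hclose)
  obtain ⟨Z, hZc, hZd⟩ := exists_hasDerivAt_source (H := H) (U₀ := U₀) (V₀ := V₀)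
    (U₁ := fun x t => deriv P (x + t) + deriv Q (x - t))
    (V₁ := fun x t => deriv (deriv P) (x + t) - deriv (deriv Q) (x - t)) (F := F) (T := T)
    (C := C₁ + C₂ + C₃ + C₄) hT0.le (by positivity) hHc hHs cU₀ cV₀
    (by
      have : Continuous fun z : ℝ × ℝ => deriv P (z.1 + z.2) + deriv Q (z.1 - z.2) := by fun_prop
      exact this)
    (by
      have : Continuous fun z : ℝ × ℝ =>
        deriv (deriv P) (z.1 + z.2) - deriv (deriv Q) (z.1 - z.2) := by fun_prop
      exact this)
    (fun x t => (abs_add_le _ _).trans (by linarith [b₁ (x + t), b₂ (x - t)]))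
    (fun x t => (abs_sub _ _).trans (by linarith [b₃ (x + t), b₄ (x - t)]))
    (fun x t k => by
      have e : U₀ (x + k) t - U₀ x t
          = (P (x + t + k) - P (x + t)) + (Q (x - t + k) - Q (x - t)) := by
        simp only [hU₀, show x + k + t = x + t + k by ring, show x + k - t = x - t + k by ring]
        ring
      rw [e]
      have : 0 ≤ (C₃ + C₄) * |k| := by positivity
      exact (abs_add_le _ _).trans (by linarith [l₁ (x + t) k, l₂ (x - t) k]))
    (fun x t k => by
      have e : V₀ (x + k) t - V₀ x t = (deriv P (x + t + k) - deriv P (x + t))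
          - (deriv Q (x - t + k) - deriv Q (x - t)) := by
        simp only [hV₀, show x + k + t = x + t + k by ring, show x + k - t = x - t + k by ring]
        ring
      rw [e]
      have : 0 ≤ (C₁ + C₂) * |k| := by positivity
      exact (abs_sub _ _).trans (by linarith [l₃ (x + t) k, l₄ (x - t) k]))
    (fun η hη => by
      obtain ⟨a₁, ha₁, h₁⟩ := d₁ (η / 2) (by positivity)
      obtain ⟨a₂, ha₂, h₂⟩ := d₂ (η / 2) (by positivity)
      refine ⟨min a₁ a₂, by positivity, fun x t k hk => ?_⟩
      rw [lt_min_iff] at hk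
      have e : U₀ (x + k) t - U₀ x t - k * (deriv P (x + t) + deriv Q (x - t))
          = (P (x + t + k) - P (x + t) - k * deriv P (x + t))
            + (Q (x - t + k) - Q (x - t) - k * deriv Q (x - t)) := by
        simp only [hU₀, show x + k + t = x + t + k by ring, show x + k - t = x - t + k by ring]
        ring
      rw [e]
      exact (abs_add_le _ _).trans (by linarith [h₁ (x + t) k hk.1, h₂ (x - t) k hk.2]))
    (fun η hη => by
      obtain ⟨a₁, ha₁, h₁⟩ := d₃ (η / 2) (by positivity)
      obtain ⟨a₂, ha₂, h₂⟩ := d₄ (η / 2) (by positivity)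
      refine ⟨min a₁ a₂, by positivity, fun x t k hk => ?_⟩
      rw [lt_min_iff] at hk
      have e : V₀ (x + k) t - V₀ x t - k * (deriv (deriv P) (x + t) - deriv (deriv Q) (x - t))
          = (deriv P (x + t + k) - deriv P (x + t) - k * deriv (deriv P) (x + t))
            - (deriv Q (x - t + k) - deriv Q (x - t) - k * deriv (deriv Q) (x - t)) := by
        simp only [hV₀, show x + k + t = x + t + k by ring, show x + k - t = x - t + k by ring]
        ring
      rw [e]
      exact (abs_sub _ _).trans (by linarith [h₁ (x + t) k hk.1, h₂ (x - t) k hk.2]))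
    hFc hFb hFe
  set τ : ℝ → ℝ := fun t => max 0 (min t T) with hτ
  have hτc : Continuous τ := by fun_prop
  have hτm : ∀ t, τ t ∈ Icc 0 T := fun t => ⟨le_max_left _ _, max_le hT0.le (min_le_right _ _)⟩
  have hτe : ∀ t ∈ Icc 0 T, τ t = t := fun t ht => by
    simp only [hτ, min_eq_left ht.2, max_eq_right ht.1]
  -- Freezing the source outside `[0, T]` makes it differentiable in space at all times, as
  -- `wave_solution` requires, without changing the solution on `[0, T]`.
  set F₁ : ℝ → ℝ → ℝ := fun x t => F x (τ t) with hF₁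
  have hF₁e : ∀ x, ∀ t ∈ Icc 0 T, F₁ x t = F x t := fun x t ht => by simp only [hF₁, hτe t ht]
  have hV : ∀ x, ∀ t ∈ Icc 0 T, duhamelVel F₁ x t = duhamelVel F x t := by
    intro x t ht
    unfold duhamelVel charA charB
    congr 2 <;>
    · refine intervalIntegral.integral_congr fun s hs => ?_
      rw [uIcc_of_le ht.1] at hs
      exact hF₁e _ s ⟨hs.1, hs.2.trans ht.2⟩
  have hU : ∀ x, ∀ t ∈ Icc 0 T, duhamel F₁ x t = duhamel F x t := by
    intro x t ht
    refine intervalIntegral.integral_congr fun s hs => ?_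
    rw [uIcc_of_le ht.1] at hs
    exact hV _ s ⟨hs.1, hs.2.trans ht.2⟩
  obtain ⟨w1, w2, w3⟩ := wave_solution (F := F₁) (Z := fun x t => Z x (τ t))
    (hFc.comp (f := fun z : ℝ × ℝ => (z.1, τ z.2)) (by fun_prop))
    (hZc.comp (f := fun z : ℝ × ℝ => (z.1, τ z.2)) (by fun_prop))
    (fun x t => hZd x _ (hτm t)) hP.contDiff hQ.contDiff
  refine ⟨fun x t => P (x + t) + Q (x - t) + duhamel F₁ x t, ⟨w1.contDiffOn, ?_, ?_, ?_⟩, ?_⟩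
  · intro x t ht0 htT
    have ht : t ∈ Icc 0 T := ⟨ht0.le, htT.le⟩
    rw [w3, (w2 x t).deriv, hF₁e x t ht, hFe x t ht, hU x t ht, hV x t ht]
    have n1 := duhamel_nonneg_of_coneBound hFK x ht
    have n2 := duhamelVel_nonneg_of_coneBound hFK x ht
    have m1 := (duhamel_le_of_coneBound hR hT hk0 hl0 hFc hFK x ht).trans hclose
    have m2 := (duhamelVel_le_mul_of_coneBound hR hT hk0 hl0 hFc hFK x ht).trans hclose
    refine hHe _ _ (((abs_add_le _ _).trans (add_le_add (hE _ _).1 ?_)).trans hE1)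
      (((abs_add_le _ _).trans (add_le_add (hE _ _).2 ?_)).trans hE1)
    · rwa [abs_of_nonneg n1]
    · rwa [abs_of_nonneg n2]
  · intro x
    simp [duhamel]
  · intro x
    have := (w2 x 0).hasDerivWithinAt (s := Ici 0)
    simpa [duhamelVel, charA, charB] using this
  · intro x t ht
    have ht' : t ∈ Icc 0 T := ⟨ht.1, ht.2.le⟩
    have m1 := (duhamel_le_of_coneBound hR hT hk0 hl0 hFc hFK x ht').trans hclose
    simp only [hU x t ht']
    linarith

/-! ### Lower bounds for the lifespan -/

theorem tendsto_mul_rpow_neg_atTop {c θ : ℝ} (hc : 0 < c) (hθ : 0 < θ) :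
    Tendsto (fun ε : ℝ => c * ε ^ (-θ)) (𝓝[>] 0) atTop :=
  (tendsto_rpow_neg_nhdsGT_zero (by linarith : -θ < 0)).const_mul_atTop hc

theorem eventually_pos_le {b : ℝ} (hb : 0 < b) : ∀ᶠ ε : ℝ in 𝓝[>] 0, 0 < ε ∧ ε ≤ b := by
  filter_upwards [Ioc_mem_nhdsGT hb] with ε hε using hε

theorem rpow_neg_mul_rpow {ε : ℝ} (hε : 0 < ε) (θ s : ℝ) : ε ^ (-θ) * ε ^ s = ε ^ (s - θ) := by
  rw [← Real.rpow_add hε]; ring_nf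

/-- With `δ / T` as the bound of the interior velocity, one power of `T` suffices: it turns the
factor `T²` in front of the mixed interior source into `T`. -/
theorem div_rpow_le_div {T δ p : ℝ} (hT : 1 ≤ T) (hδ : 0 ≤ δ) (hp : 1 ≤ p) :
    (δ / T) ^ p ≤ δ ^ p / T := by
  rw [Real.div_rpow hδ (by linarith)]
  have := Real.rpow_le_rpow_of_exponent_le hT hp
  rw [Real.rpow_one] at this
  gcongr

theorem IsClassicalSolution.le_lifespan {p q r A B T ε : ℝ} {f g : ℝ → ℝ} {u : ℝ → ℝ → ℝ}
    (hT : 0 < T) (h : IsClassicalSolution p q r A B (fun x => ε * f x) (fun x => ε * g x) T u) :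
    ENNReal.ofReal T ≤ lifespan p q r A B f g ε :=
  le_sSup ⟨T, hT, rfl, u, h⟩

section LowerBounds

variable {p q r A B : ℝ} (hp : 1 < p) (hq : q = 0 ∨ 1 < q) (hr : 1 < r)
    (hA : 0 < A) (hB : 0 < B) {P Q : ℝ → ℝ} {R c : ℝ} (hP : IsProfile P R c)
    (hQ : IsProfile Q R (-c)) (hR : 1 ≤ R)

include hP hQ in
theorem exists_free_bound : ∃ M, 0 < M ∧ ∀ ε, 0 < ε → ∀ x y, |ε * P x + ε * Q y| ≤ M * ε ∧
    |deriv (fun x => ε * P x) x - deriv (fun x => ε * Q x) y| ≤ M * ε := by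
  obtain ⟨M₁, hM₁, h₁⟩ := hP.exists_bound
  obtain ⟨M₂, hM₂, h₂⟩ := hQ.exists_bound
  refine ⟨M₁ + M₂, by positivity, fun ε hε x y => ?_⟩
  rw [hP.deriv_smul, hQ.deriv_smul, ← mul_add, ← mul_sub, abs_mul, abs_mul, abs_of_pos hε,
    mul_comm _ ε]
  constructor
  · gcongr
    exact (abs_add_le _ _).trans (add_le_add (h₁ x).1 (h₂ y).1)
  · gcongr
    exact (abs_sub _ _).trans (add_le_add (h₁ x).2 (h₂ y).2)

include hP hQ in
theorem exists_controlled_solution_smul (hp : 1 < p) (hq : q = 0 ∨ 1 < q) (hr : 1 < r)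
    (hA : 0 < A) (hB : 0 < B) (hR : 1 ≤ R) {T δ M ε : ℝ} (hT : 1 ≤ T) (hδ : 0 ≤ δ)
    (hE : ∀ x y, |ε * P x + ε * Q y| ≤ M * ε ∧
      |deriv (fun x => ε * P x) x - deriv (fun x => ε * Q x) y| ≤ M * ε)
    (hE1 : M * ε + δ ≤ 1)
    (hclose : T * (3 * R * (A * (M * ε + δ) ^ p * (M * ε + δ) ^ q + B * (M * ε + δ) ^ r)
      + T * (A * (δ / T) ^ p * (|ε * c| + δ) ^ q + B * (|ε * c| + δ) ^ r)) ≤ δ) :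
    ∃ u, IsClassicalSolution p q r A B (fun x => ε * (P x + Q x))
        (fun x => ε * (deriv P x - deriv Q x)) T u ∧
      ∀ x, ∀ t ∈ Ico 0 T, u x t ≤ ε * P (x + t) + ε * Q (x - t) + δ := by
  have hQ' := hQ.smul ε
  rw [mul_neg] at hQ'
  have := exists_controlled_solution hp hq hr hA.le hB.le (hP.smul ε) hQ' hR hT hδ hE hE1 hclose
  simpa only [hP.deriv_smul, hQ.deriv_smul, ← mul_add, ← mul_sub] using this

include hp hq hr hA hB hP hQ hR

/-- Long time existence with small Duhamel term, for arbitrary data. -/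
theorem eventually_exists_solution {κ : ℝ} (hκ : 0 < κ) :
    ∃ c₁ > 0, ∀ᶠ ε : ℝ in 𝓝[>] 0, ∃ u, IsClassicalSolution p q r A B (fun x => ε * (P x + Q x))
        (fun x => ε * (deriv P x - deriv Q x)) (c₁ * ε ^ (-min (p + q - 1) ((r - 1) / 2))) u ∧
      ∀ x, ∀ t ∈ Ico 0 (c₁ * ε ^ (-min (p + q - 1) ((r - 1) / 2))),
        u x t ≤ ε * P (x + t) + ε * Q (x - t) + κ * ε := by
  have hq0 : 0 ≤ q := by rcases hq with h | h <;> linarith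
  obtain ⟨M, hM, hE⟩ := exists_free_bound hP hQ
  set θ := min (p + q - 1) ((r - 1) / 2) with hθ
  have hθ0 : 0 < θ := lt_min (by linarith) (by linarith)
  have hθ1 : θ ≤ p + q - 1 := min_le_left _ _
  have hθ2 : θ ≤ (r - 1) / 2 := min_le_right _ _
  set k₁ := A * (M + κ) ^ p * (M + κ) ^ q with hk₁
  set k₂ := B * (M + κ) ^ r with hk₂
  set k₃ := A * κ ^ p * (|c| + κ) ^ q with hk₃
  set k₄ := B * (|c| + κ) ^ r with hk₄
  have pk₁ : 0 ≤ k₁ := by positivity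
  have pk₂ : 0 ≤ k₂ := by positivity
  have pk₃ : 0 ≤ k₃ := by positivity
  have pk₄ : 0 ≤ k₄ := by positivity
  -- `S` collects the coefficients of the final estimate, in which `T ε^(p+q-1)` and `T² ε^(r-1)`
  -- are at most `c₁`; then `c₁ S ≤ κ` closes it.
  set S := 3 * R * (k₁ + k₂) + k₃ + k₄ + 1 with hS
  have hS0 : 0 < S := by positivity
  set c₁ := min 1 (κ / S) with hc₁
  have hc0 : 0 < c₁ := by positivity
  have hc1 : c₁ ≤ 1 := min_le_left _ _
  have hcS : c₁ * S ≤ κ := by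
    rw [← le_div_iff₀ hS0]; exact min_le_right _ _
  refine ⟨c₁, hc0, ?_⟩
  filter_upwards [eventually_pos_le one_pos, eventually_pos_le (b := 1 / (M + κ)) (by positivity),
    (tendsto_mul_rpow_neg_atTop hc0 hθ0).eventually_ge_atTop 1] with ε h1 h2 hT
  obtain ⟨hε, hε1⟩ := h1
  set T := c₁ * ε ^ (-θ) with hTdef
  have hT0 : 0 < T := by linarith
  have hX : T * ε ^ (p + q - 1) ≤ c₁ := by
    rw [hTdef, mul_assoc, rpow_neg_mul_rpow hε]
    exact mul_le_of_le_one_right hc0.le (Real.rpow_le_one hε.le hε1 (by linarith))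
  have hY : T * T * ε ^ (r - 1) ≤ c₁ := by
    have e : T * T * ε ^ (r - 1) = c₁ * (c₁ * (ε ^ (-θ) * (ε ^ (-θ) * ε ^ (r - 1)))) := by
      rw [hTdef]; ring
    rw [e, rpow_neg_mul_rpow hε, rpow_neg_mul_rpow hε]
    refine mul_le_of_le_one_right hc0.le (mul_le_one₀ hc1 (by positivity) ?_)
    exact Real.rpow_le_one hε.le hε1 (by linarith)
  refine exists_controlled_solution_smul hP hQ hp hq hr hA hB hR hT (by positivity) (hE ε hε) ?_ ?_
  · have := h2.2
    rw [le_div_iff₀ (by positivity)] at this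
    linarith
  · have e1 : M * ε + κ * ε = (M + κ) * ε := by ring
    have e2 : |ε * c| + κ * ε = (|c| + κ) * ε := by rw [abs_mul, abs_of_pos hε]; ring
    have ep : ε ^ p * ε ^ q = ε * ε ^ (p + q - 1) := by
      rw [← Real.rpow_add hε, ← Real.rpow_one_add' hε.le (by linarith)]; ring_nf
    have er : ε ^ r = ε * ε ^ (r - 1) := by
      rw [← Real.rpow_one_add' hε.le (by linarith)]; ring_nf
    have hd := div_rpow_le_div (δ := κ * ε) hT (by positivity) hp.le
    have hd2 : T * (T * (A * (κ * ε / T) ^ p * ((|c| + κ) * ε) ^ q))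
        ≤ T * (A * (κ * ε) ^ p * ((|c| + κ) * ε) ^ q) := by
      calc _ ≤ T * (T * (A * ((κ * ε) ^ p / T) * ((|c| + κ) * ε) ^ q)) := by gcongr
        _ = _ := by field_simp
    rw [e1, e2]
    have hw : T * ε ^ (r - 1) ≤ T * T * ε ^ (r - 1) := by
      exact (le_mul_of_one_le_left (by positivity) hT).trans (le_of_eq (by ring))
    set X := ε ^ (p + q - 1) with hXdef
    set Y := ε ^ (r - 1) with hYdef
    calc _ = T * (3 * R) * (A * ((M + κ) * ε) ^ p * ((M + κ) * ε) ^ q + B * ((M + κ) * ε) ^ r)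
          + T * (T * (A * (κ * ε / T) ^ p * ((|c| + κ) * ε) ^ q))
          + T * T * (B * ((|c| + κ) * ε) ^ r) := by ring
      _ ≤ T * (3 * R) * (A * ((M + κ) * ε) ^ p * ((M + κ) * ε) ^ q + B * ((M + κ) * ε) ^ r)
          + T * (A * (κ * ε) ^ p * ((|c| + κ) * ε) ^ q)
          + T * T * (B * ((|c| + κ) * ε) ^ r) := by gcongr
      _ = T * (3 * R) * (k₁ * (ε ^ p * ε ^ q) + k₂ * ε ^ r) + T * (k₃ * (ε ^ p * ε ^ q))
          + T * T * (k₄ * ε ^ r) := by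
          rw [Real.mul_rpow (by positivity) hε.le, Real.mul_rpow (by positivity) hε.le,
            Real.mul_rpow (by positivity) hε.le, Real.mul_rpow (by positivity) hε.le,
            Real.mul_rpow (by positivity) hε.le, Real.mul_rpow (by positivity) hε.le]
          ring
      _ = ε * (3 * R * k₁ * (T * X) + 3 * R * k₂ * (T * Y) + k₃ * (T * X) + k₄ * (T * T * Y)) := by
          rw [ep, er]; ring
      _ ≤ ε * (3 * R * k₁ * c₁ + 3 * R * k₂ * c₁ + k₃ * c₁ + k₄ * c₁) := by
          have := hw.trans hY
          gcongr
      _ ≤ ε * (c₁ * S) := by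
          gcongr
          rw [hS]
          nlinarith
      _ ≤ κ * ε := by
          rw [mul_comm κ]; gcongr

/-- Long time existence for data whose free solution vanishes inside the light cone. -/
theorem eventually_exists_solution_of_zero (hc : c = 0) {m : ℝ} (hm : m = min (p + q) r) :
    ∃ c₁ > 0, ∀ᶠ ε : ℝ in 𝓝[>] 0, ∃ u, IsClassicalSolution p q r A B (fun x => ε * (P x + Q x))
        (fun x => ε * (deriv P x - deriv Q x))
        (c₁ * ε ^ (-min (p + q - 1) (m * (r - 1) / (r + 1)))) u := by
  have hq0 : 0 ≤ q := by rcases hq with h | h <;> linarith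
  obtain ⟨M, hM, hE⟩ := exists_free_bound hP hQ
  have hm1 : 1 < m := hm ▸ lt_min (by linarith) hr
  have hmp : m ≤ p + q := hm ▸ min_le_left _ _
  have hmr : m ≤ r := hm ▸ min_le_right _ _
  set θ := min (p + q - 1) (m * (r - 1) / (r + 1)) with hθ
  have hθ0 : 0 < θ := lt_min (by linarith) (div_pos (mul_pos (by linarith) (by linarith)) (by linarith))
  have hθ1 : θ ≤ p + q - 1 := min_le_left _ _
  have hθ2 : θ * (r + 1) ≤ m * (r - 1) := by
    rw [← le_div_iff₀ (by linarith)]; exact min_le_right _ _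
  -- This makes `δ ≤ ε` below. For `m = p + q` it is the first entry of the minimum; for `m = r` it
  -- follows from `r / (r + 1) ≤ 1`.
  have hθ3 : θ ≤ m - 1 := by
    rcases min_cases (p + q) r with h | h
    · rw [hm, h.1]; exact hθ1
    · rw [hm, h.1] at hθ2 ⊢
      have : θ * (r + 1) ≤ (r - 1) * (r + 1) := by nlinarith
      exact le_of_mul_le_mul_right this (by linarith)
  set k₁ := A * (M + 1) ^ p * (M + 1) ^ q with hk₁
  set k₂ := B * (M + 1) ^ r with hk₂
  have pk₁ : 0 < k₁ := by positivity
  have pk₂ : 0 < k₂ := by positivity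
  set K := 6 * R * (k₁ + k₂) with hK
  have hK0 : 0 < K := by positivity
  set S := K + 4 * A + 4 * (B * K ^ (r - 1)) + 1 with hS
  have hS0 : 0 < S := by positivity
  set c₁ := 1 / S with hc₁
  have hc0 : 0 < c₁ := by positivity
  have pK : 0 ≤ B * K ^ (r - 1) := by positivity
  have hc1 : c₁ ≤ 1 := by
    rw [hc₁, div_le_one hS0]; linarith
  have hcS : c₁ * S = 1 := by rw [hc₁]; field_simp
  have hcK : K * c₁ ≤ 1 := by nlinarith
  have hcA : A * c₁ ≤ 1 / 4 := by nlinarith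
  have hcB : B * K ^ (r - 1) * c₁ ≤ 1 / 4 := by nlinarith
  refine ⟨c₁, hc0, ?_⟩
  filter_upwards [eventually_pos_le one_pos, eventually_pos_le (b := 1 / (M + 1)) (by positivity),
    (tendsto_mul_rpow_neg_atTop hc0 hθ0).eventually_ge_atTop 1] with ε h1 h2 hT
  obtain ⟨hε, hε1⟩ := h1
  set T := c₁ * ε ^ (-θ) with hTdef
  have hT0 : 0 < T := by linarith
  have hX : T * ε ^ (p + q - 1) ≤ c₁ := by
    rw [hTdef, mul_assoc, rpow_neg_mul_rpow hε]
    exact mul_le_of_le_one_right hc0.le (Real.rpow_le_one hε.le hε1 (by linarith))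
  -- Twice the contribution `3 R T (k₁ + k₂) ε^m` of the strip, hence the `6` in `K`. The two
  -- interior nonlinearities, which see only `δ` because `c = 0`, may then use `δ / 4` each.
  set δ := K * T * ε ^ m with hδ
  have hδ0 : 0 < δ := by positivity
  have hδε : δ ≤ ε := by
    have e : ε ^ m = ε * ε ^ (m - 1) := by
      rw [← Real.rpow_one_add' hε.le (by linarith)]; ring_nf
    have : δ = ε * (K * c₁ * (ε ^ (-θ) * ε ^ (m - 1))) := by rw [hδ, hTdef, e]; ring
    rw [this, rpow_neg_mul_rpow hε]
    refine mul_le_of_le_one_right hε.le (mul_le_one₀ hcK (by positivity) ?_)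
    exact Real.rpow_le_one hε.le hε1 (by linarith)
  -- As `δ` is itself proportional to `T`, this quantity is a multiple of `T^(r+1) ε^(m(r-1))`; here
  -- the exponent `m(r-1)/(r+1)` arises.
  have hY : T * T * δ ^ (r - 1) ≤ K ^ (r - 1) * c₁ := by
    have e1 : T * T * T ^ (r - 1) = T ^ (r + 1) := by
      rw [show r + 1 = 1 + (1 + (r - 1)) by ring, Real.rpow_add hT0, Real.rpow_add hT0,
        Real.rpow_one]; ring
    have e2 : T * T * δ ^ (r - 1) = K ^ (r - 1) * (T ^ (r + 1) * ε ^ (m * (r - 1))) := by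
      rw [hδ, Real.mul_rpow (by positivity) (by positivity), Real.mul_rpow hK0.le hT0.le,
        ← Real.rpow_mul hε.le, ← e1]
      ring
    rw [e2, hTdef, Real.mul_rpow hc0.le (by positivity), ← Real.rpow_mul hε.le, mul_assoc,
      ← Real.rpow_add hε]
    gcongr
    have h3 : c₁ ^ (r + 1) ≤ c₁ := by
      simpa using Real.rpow_le_rpow_of_exponent_ge hc0 hc1 (by linarith : (1 : ℝ) ≤ r + 1)
    refine (mul_le_of_le_one_right (by positivity) ?_).trans h3
    exact Real.rpow_le_one hε.le hε1 (by linarith)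
  have hmain := exists_controlled_solution_smul hP hQ hp hq hr hA hB hR hT hδ0.le (hE ε hε) ?_ ?_
  · obtain ⟨u, hu, -⟩ := hmain
    exact ⟨u, hu⟩
  · have := h2.2
    rw [le_div_iff₀ (by positivity)] at this
    linarith
  · rw [hc, mul_zero, abs_zero, zero_add]
    have hs : M * ε + δ ≤ (M + 1) * ε := by linarith
    have hFS : A * (M * ε + δ) ^ p * (M * ε + δ) ^ q + B * (M * ε + δ) ^ r ≤ (k₁ + k₂) * ε ^ m := by
      calc _ ≤ A * ((M + 1) * ε) ^ p * ((M + 1) * ε) ^ q + B * ((M + 1) * ε) ^ r := by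
            gcongr
        _ = k₁ * ε ^ (p + q) + k₂ * ε ^ r := by
            rw [Real.mul_rpow (by positivity) hε.le, Real.mul_rpow (by positivity) hε.le,
              Real.mul_rpow (by positivity) hε.le, Real.rpow_add hε]
            ring
        _ ≤ k₁ * ε ^ m + k₂ * ε ^ m := by
            gcongr ?_ * ?_ + ?_ * ?_
            · exact Real.rpow_le_rpow_of_exponent_ge hε hε1 hmp
            · exact Real.rpow_le_rpow_of_exponent_ge hε hε1 hmr
        _ = _ := by ring
    have hd := div_rpow_le_div hT hδ0.le hp.le
    have hI : T * (T * (A * (δ / T) ^ p * δ ^ q)) ≤ δ / 4 := by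
      calc _ ≤ T * (T * (A * (δ ^ p / T) * δ ^ q)) := by gcongr
        _ = A * T * (δ ^ p * δ ^ q) := by field_simp
        _ = A * T * (δ * δ ^ (p + q - 1)) := by
            rw [← Real.rpow_add hδ0, ← Real.rpow_one_add' hδ0.le (by linarith)]; ring_nf
        _ ≤ A * T * (δ * ε ^ (p + q - 1)) := by gcongr; linarith
        _ = δ * (A * (T * ε ^ (p + q - 1))) := by ring
        _ ≤ δ * (1 / 4) := by
            gcongr
            exact (mul_le_mul_of_nonneg_left hX hA.le).trans hcA
        _ = _ := by ring
    have hJ : T * (T * (B * δ ^ r)) ≤ δ / 4 := by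
      have e : δ ^ r = δ * δ ^ (r - 1) := by
        rw [← Real.rpow_one_add' hδ0.le (by linarith)]; ring_nf
      calc _ = δ * (B * (T * T * δ ^ (r - 1))) := by rw [e]; ring
        _ ≤ δ * (B * (K ^ (r - 1) * c₁)) := by gcongr
        _ ≤ δ * (1 / 4) := by
            rw [← mul_assoc B]; gcongr
        _ = _ := by ring
    calc _ = T * (3 * R) * (A * (M * ε + δ) ^ p * (M * ε + δ) ^ q + B * (M * ε + δ) ^ r)
          + T * (T * (A * (δ / T) ^ p * δ ^ q)) + T * (T * (B * δ ^ r)) := by ring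
      _ ≤ T * (3 * R) * ((k₁ + k₂) * ε ^ m) + δ / 4 + δ / 4 := by gcongr
      _ = δ := by rw [hδ, hK]; ring

end LowerBounds

/-! ### The first-order characteristic system -/

/-- The characteristic form of `u_tt - u_xx = G(u, u_t)`, with `a = u_t + u_x`, `b = u_t - u_x`. -/
structure CharSystem (G : ℝ → ℝ → ℝ) (φ a₀ b₀ : ℝ → ℝ) (T : ℝ) (u a b : ℝ → ℝ → ℝ) : Prop where
  continuousOn_u : ContinuousOn (Function.uncurry u) (univ ×ˢ Ico 0 T)
  continuousOn_a : ContinuousOn (Function.uncurry a) (univ ×ˢ Ico 0 T)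
  continuousOn_b : ContinuousOn (Function.uncurry b) (univ ×ˢ Ico 0 T)
  u_right : ∀ x t s, 0 ≤ t → 0 ≤ s → t + s < T →
    u (x + s) (t + s) - u x t = ∫ σ in (0 : ℝ)..s, a (x + σ) (t + σ)
  u_left : ∀ x t s, 0 ≤ t → 0 ≤ s → t + s < T →
    u (x - s) (t + s) - u x t = ∫ σ in (0 : ℝ)..s, b (x - σ) (t + σ)
  a_left : ∀ x t s, 0 ≤ t → 0 ≤ s → t + s < T → a (x - s) (t + s) - a x t
    = ∫ σ in (0 : ℝ)..s, G (u (x - σ) (t + σ)) ((a (x - σ) (t + σ) + b (x - σ) (t + σ)) / 2)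
  b_right : ∀ x t s, 0 ≤ t → 0 ≤ s → t + s < T → b (x + s) (t + s) - b x t
    = ∫ σ in (0 : ℝ)..s, G (u (x + σ) (t + σ)) ((a (x + σ) (t + σ) + b (x + σ) (t + σ)) / 2)
  u_zero : ∀ x, u x 0 = φ x
  a_zero : ∀ x, a x 0 = a₀ x
  b_zero : ∀ x, b x 0 = b₀ x

/-- The fundamental theorem of calculus along a line transversal to the initial line. -/
theorem sub_eq_integral_of_hasFDerivAt {f k : ℝ × ℝ → ℝ} {f' : ℝ × ℝ → ℝ × ℝ →L[ℝ] ℝ} {T e : ℝ}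
    (hf : ContinuousOn f (univ ×ˢ Ico 0 T)) (hk : ContinuousOn k (univ ×ˢ Ico 0 T))
    (hd : ∀ z : ℝ × ℝ, 0 < z.2 → z.2 < T → HasFDerivAt f (f' z) z)
    (he : ∀ z : ℝ × ℝ, 0 < z.2 → z.2 < T → f' z (e, 1) = k z) {x t s : ℝ} (ht : 0 ≤ t)
    (hs : 0 ≤ s) (hT : t + s < T) :
    f (x + e * s, t + s) - f (x, t) = ∫ σ in (0 : ℝ)..s, k (x + e * σ, t + σ) := by
  have hm : ∀ σ ∈ Icc 0 s, ((x + e * σ, t + σ) : ℝ × ℝ) ∈ univ ×ˢ Ico 0 T := fun σ hσ =>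
    ⟨mem_univ _, add_nonneg ht hσ.1, by linarith [hσ.2]⟩
  have hc : Continuous fun σ : ℝ => ((x + e * σ, t + σ) : ℝ × ℝ) := by fun_prop
  rw [intervalIntegral.integral_eq_sub_of_hasDerivAt_of_le
    (f := fun σ => f (x + e * σ, t + σ)) hs (hf.comp hc.continuousOn hm)]
  · simp
  · intro σ hσ
    have h1 : HasDerivAt (fun σ : ℝ => ((x + e * σ, t + σ) : ℝ × ℝ)) (e, 1) σ := by
      have := (((hasDerivAt_id σ).const_mul e).const_add x).prodMk ((hasDerivAt_id σ).const_add t)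
      simpa using this
    have h2 : 0 < (x + e * σ, t + σ).2 := by simp only; linarith [hσ.1]
    have h3 : (x + e * σ, t + σ).2 < T := by simp only; linarith [hσ.2]
    rw [← he _ h2 h3]
    exact (hd _ h2 h3).comp_hasDerivAt (f := fun σ : ℝ => ((x + e * σ, t + σ) : ℝ × ℝ)) σ h1
  · exact ((hk.comp hc.continuousOn hm).mono (by rw [uIcc_of_le hs])).intervalIntegrable

-- The wave operator factors as `(∂_t - ∂_x)(∂_t + ∂_x)`. Integrating along characteristics turns
-- the equation, known only for `t > 0`, into integral identities that reach down to the initial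
-- line by continuity.
set_option maxHeartbeats 1000000 in
theorem IsClassicalSolution.charSystem {p q r A B T : ℝ} {φ ψ φ' : ℝ → ℝ} {u : ℝ → ℝ → ℝ}
    (hG : Continuous fun w : ℝ × ℝ => nonlin p q r A B w.1 w.2)
    (hφ : ∀ x, HasDerivAt φ (φ' x) x) (hT : 0 < T) (h : IsClassicalSolution p q r A B φ ψ T u) :
    ∃ a b, CharSystem (nonlin p q r A B) φ (fun x => ψ x + φ' x) (fun x => ψ x - φ' x) T u a b := by
  set U : ℝ × ℝ → ℝ := fun z => u z.1 z.2 with hU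
  set S : Set (ℝ × ℝ) := univ ×ˢ Ico 0 T with hS
  have hSu : UniqueDiffOn ℝ S := uniqueDiffOn_univ.prod (uniqueDiffOn_Ico 0 T)
  have hSn : ∀ z : ℝ × ℝ, 0 < z.2 → z.2 < T → S ∈ 𝓝 z := fun z h1 h2 =>
    prod_mem_nhds univ_mem (Ico_mem_nhds h1 h2)
  have hC : ContDiffOn ℝ 2 U S := h.contDiffOn
  have hCa : ∀ z : ℝ × ℝ, 0 < z.2 → z.2 < T → ContDiffAt ℝ 2 U z := fun z h1 h2 =>
    hC.contDiffAt (hSn z h1 h2)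
  -- The derivative within the strip is continuous up to `t = 0` and agrees with the full derivative
  -- for `t > 0`; nothing is known about `u` at negative times.
  set D : ℝ × ℝ → ℝ × ℝ →L[ℝ] ℝ := fun z => fderivWithin ℝ U S z with hD
  have hDc : ContinuousOn D S := hC.continuousOn_fderivWithin hSu (by norm_num)
  have hDe : ∀ z : ℝ × ℝ, 0 < z.2 → z.2 < T → D =ᶠ[𝓝 z] fderiv ℝ U := by
    intro z h1 h2
    have : Ioo 0 T ∈ 𝓝 z.2 := Ioo_mem_nhds h1 h2
    filter_upwards [prod_mem_nhds univ_mem this] with w hw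
    exact fderivWithin_of_mem_nhds (hSn w hw.2.1 hw.2.2)
  have hUd : ∀ z : ℝ × ℝ, 0 < z.2 → z.2 < T → HasFDerivAt U (D z) z := by
    intro z h1 h2
    rw [(hDe z h1 h2).eq_of_nhds]
    exact ((hCa z h1 h2).differentiableAt (by norm_num)).hasFDerivAt
  set D₂ : ℝ × ℝ → ℝ × ℝ →L[ℝ] ℝ × ℝ →L[ℝ] ℝ := fun z => fderiv ℝ (fderiv ℝ U) z with hD₂
  have hDd : ∀ z : ℝ × ℝ, 0 < z.2 → z.2 < T → HasFDerivAt D (D₂ z) z := by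
    intro z h1 h2
    have h3 : DifferentiableAt ℝ (fderiv ℝ U) z :=
      ((hCa z h1 h2).fderiv_right (m := 1) (by norm_num)).differentiableAt (by norm_num)
    exact h3.hasFDerivAt.congr_of_eventuallyEq (hDe z h1 h2)
  have hsymm : ∀ z : ℝ × ℝ, 0 < z.2 → z.2 < T → ∀ v w, D₂ z v w = D₂ z w v := fun z h1 h2 v w =>
    ((hCa z h1 h2).isSymmSndFDerivAt (by simp)).eq v w
  have hct : ∀ x t : ℝ, HasDerivAt (fun s : ℝ => ((x, s) : ℝ × ℝ)) (0, 1) t := fun x t =>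
    (hasDerivAt_const t x).prodMk (hasDerivAt_id t)
  have hcx : ∀ x t : ℝ, HasDerivAt (fun y : ℝ => ((y, t) : ℝ × ℝ)) (1, 0) x := fun x t =>
    (hasDerivAt_id x).prodMk (hasDerivAt_const x t)
  have hut : ∀ x t : ℝ, 0 < t → t < T → HasDerivAt (fun s => u x s) (D (x, t) (0, 1)) t :=
    fun x t h1 h2 => (hUd (x, t) h1 h2).comp_hasDerivAt (f := fun s : ℝ => ((x, s) : ℝ × ℝ)) t (hct x t)
  have hux : ∀ x t : ℝ, 0 < t → t < T → HasDerivAt (fun y => u y t) (D (x, t) (1, 0)) x :=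
    fun x t h1 h2 => (hUd (x, t) h1 h2).comp_hasDerivAt (f := fun y : ℝ => ((y, t) : ℝ × ℝ)) x (hcx x t)
  have hDv : ∀ v z, 0 < z.2 → z.2 < T → HasFDerivAt (fun w => D w v) ((D₂ z).flip v) z := by
    intro v z h1 h2
    have := (hDd z h1 h2).clm_apply (hasFDerivAt_const v z)
    convert! this using 1
    ext <;> simp
  have hutt : ∀ x t : ℝ, 0 < t → t < T →
      iteratedDeriv 2 (fun s => u x s) t = D₂ (x, t) (0, 1) (0, 1) := by
    intro x t h1 h2
    simp only [iteratedDeriv_succ, iteratedDeriv_zero]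
    have e : deriv (fun s => u x s) =ᶠ[𝓝 t] fun s => D (x, s) (0, 1) := by
      filter_upwards [Ioo_mem_nhds h1 h2] with s hs using (hut x s hs.1 hs.2).deriv
    rw [e.deriv_eq]
    exact ((hDv (0, 1) (x, t) h1 h2).comp_hasDerivAt (f := fun s : ℝ => ((x, s) : ℝ × ℝ)) t
      (hct x t)).deriv
  have huxx : ∀ x t : ℝ, 0 < t → t < T →
      iteratedDeriv 2 (fun y => u y t) x = D₂ (x, t) (1, 0) (1, 0) := by
    intro x t h1 h2
    simp only [iteratedDeriv_succ, iteratedDeriv_zero]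
    have e : deriv (fun y => u y t) = fun y => D (y, t) (1, 0) :=
      funext fun y => (hux y t h1 h2).deriv
    rw [e]
    exact ((hDv (1, 0) (x, t) h1 h2).comp_hasDerivAt (f := fun y : ℝ => ((y, t) : ℝ × ℝ)) x
      (hcx x t)).deriv
  have hv : ∀ z, (D z (1, 1) + D z (-1, 1)) / 2 = D z (0, 1) := by
    intro z
    rw [← map_add, show ((1 : ℝ), (1 : ℝ)) + (-1, 1) = (2 : ℝ) • (0, 1) by ext <;> norm_num, map_smul]
    simp
  -- By symmetry of the second derivative, `u_tt - u_xx` is its value on the two characteristic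
  -- directions `(-1, 1)` and `(1, 1)`.
  have heq : ∀ z : ℝ × ℝ, 0 < z.2 → z.2 < T → D₂ z (-1, 1) (1, 1)
      = nonlin p q r A B (U z) ((D z (1, 1) + D z (-1, 1)) / 2) := by
    rintro ⟨x, t⟩ h1 h2
    have h3 := h.equation x t h1 h2
    rw [hutt x t h1 h2, huxx x t h1 h2, (hut x t h1 h2).deriv] at h3
    rw [hv]
    refine Eq.trans ?_ h3
    rw [show ((-1 : ℝ), (1 : ℝ)) = -(1, 0) + (0, 1) by ext <;> norm_num,
      show ((1 : ℝ), (1 : ℝ)) = (1, 0) + (0, 1) by ext <;> norm_num]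
    simp only [map_add, map_neg, add_apply, neg_apply]
    rw [hsymm (x, t) h1 h2 (1, 0) (0, 1)]
    ring
  have hae : ∀ v, ContinuousOn (fun z => D z v) S := fun v => hDc.clm_apply continuousOn_const
  have hGc : ContinuousOn (fun z => nonlin p q r A B (U z) ((D z (1, 1) + D z (-1, 1)) / 2)) S :=
    hG.comp_continuousOn (hC.continuousOn.prodMk (((hae _).add (hae _)).div_const 2))
  have hm0 : ∀ x, ((x, 0) : ℝ × ℝ) ∈ S := fun x => ⟨mem_univ _, left_mem_Ico.2 hT⟩
  have hD0 : ∀ x, HasFDerivWithinAt U (D (x, 0)) S (x, 0) := fun x =>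
    ((hC.differentiableOn (by norm_num)) _ (hm0 x)).hasFDerivWithinAt
  have hψ : ∀ x, D (x, 0) (0, 1) = ψ x := by
    intro x
    have h1 : HasDerivWithinAt (fun s => u x s) (D (x, 0) (0, 1)) (Ico 0 T) 0 :=
      (hD0 x).comp_hasDerivWithinAt (f := fun s : ℝ => ((x, s) : ℝ × ℝ)) 0
        (hct x 0).hasDerivWithinAt (fun s hs => ⟨mem_univ _, hs⟩)
    have h2 := (h.initial_speed x).mono (Ico_subset_Ici_self : Ico 0 T ⊆ Ici 0)
    exact (uniqueDiffOn_Ico 0 T 0 (left_mem_Ico.2 hT)).eq_deriv _ h1 h2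
  have hφ0 : ∀ x, D (x, 0) (1, 0) = φ' x := by
    intro x
    have h1 : HasDerivWithinAt (fun y => u y 0) (D (x, 0) (1, 0)) univ x :=
      (hD0 x).comp_hasDerivWithinAt (f := fun y : ℝ => ((y, 0) : ℝ × ℝ)) x
        (hcx x 0).hasDerivWithinAt (fun y _ => hm0 y)
    rw [hasDerivWithinAt_univ, show (fun y => u y 0) = φ from funext h.initial_value] at h1
    exact h1.unique (hφ x)
  refine ⟨fun x t => D (x, t) (1, 1), fun x t => D (x, t) (-1, 1), hC.continuousOn, hae _, hae _,
    ?_, ?_, ?_, ?_, h.initial_value, ?_, ?_⟩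
  · intro x t s ht hs hT
    simpa using sub_eq_integral_of_hasFDerivAt (e := 1) hC.continuousOn (hae (1, 1)) hUd
      (fun z _ _ => rfl) (x := x) ht hs hT
  · intro x t s ht hs hT
    simpa [← sub_eq_add_neg] using sub_eq_integral_of_hasFDerivAt (e := -1) hC.continuousOn (hae (-1, 1)) hUd
      (fun z _ _ => rfl) (x := x) ht hs hT
  · intro x t s ht hs hT
    simpa [← sub_eq_add_neg] using sub_eq_integral_of_hasFDerivAt (e := -1) (hae (1, 1)) hGc
      (hDv (1, 1)) (fun z h1 h2 => heq z h1 h2) (x := x) ht hs hT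
  · intro x t s ht hs hT
    simpa using sub_eq_integral_of_hasFDerivAt (e := 1) (hae (-1, 1)) hGc
      (hDv (-1, 1)) (fun z h1 h2 => (hsymm z h1 h2 _ _).trans (heq z h1 h2)) (x := x) ht hs hT
  · intro x
    rw [show ((1 : ℝ), (1 : ℝ)) = (0, 1) + (1, 0) by ext <;> norm_num, map_add, hψ, hφ0]
  · intro x
    rw [show ((-1 : ℝ), (1 : ℝ)) = (0, 1) - (1, 0) by ext <;> norm_num, map_sub, hψ, hφ0]

theorem intervalIntegrable_right {k : ℝ → ℝ → ℝ} {T x t s : ℝ}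
    (hk : ContinuousOn (Function.uncurry k) (univ ×ˢ Ico 0 T)) (ht : 0 ≤ t) (hs : 0 ≤ s)
    (hT : t + s < T) : IntervalIntegrable (fun σ => k (x + σ) (t + σ)) volume 0 s := by
  refine ContinuousOn.intervalIntegrable ?_
  refine hk.comp (f := fun σ : ℝ => (x + σ, t + σ)) (by fun_prop) fun σ hσ => ?_
  rw [uIcc_of_le hs] at hσ
  exact ⟨mem_univ _, add_nonneg ht hσ.1, by linarith [hσ.2]⟩

theorem intervalIntegrable_left {k : ℝ → ℝ → ℝ} {T x t s : ℝ}
    (hk : ContinuousOn (Function.uncurry k) (univ ×ˢ Ico 0 T)) (ht : 0 ≤ t) (hs : 0 ≤ s)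
    (hT : t + s < T) : IntervalIntegrable (fun σ => k (x - σ) (t + σ)) volume 0 s := by
  refine ContinuousOn.intervalIntegrable ?_
  refine hk.comp (f := fun σ : ℝ => (x - σ, t + σ)) (by fun_prop) fun σ hσ => ?_
  rw [uIcc_of_le hs] at hσ
  exact ⟨mem_univ _, add_nonneg ht hσ.1, by linarith [hσ.2]⟩

/-! ### Uniqueness and finite speed of propagation -/

namespace CharSystem

variable {G : ℝ → ℝ → ℝ} {φ a₀ b₀ : ℝ → ℝ} {T : ℝ} {u a b : ℝ → ℝ → ℝ}

theorem mono (h : CharSystem G φ a₀ b₀ T u a b) {T' : ℝ} (hT : T' ≤ T) :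
    CharSystem G φ a₀ b₀ T' u a b where
  continuousOn_u := h.continuousOn_u.mono (prod_mono_right (Ico_subset_Ico_right hT))
  continuousOn_a := h.continuousOn_a.mono (prod_mono_right (Ico_subset_Ico_right hT))
  continuousOn_b := h.continuousOn_b.mono (prod_mono_right (Ico_subset_Ico_right hT))
  u_right x t s h1 h2 h3 := h.u_right x t s h1 h2 (h3.trans_le hT)
  u_left x t s h1 h2 h3 := h.u_left x t s h1 h2 (h3.trans_le hT)
  a_left x t s h1 h2 h3 := h.a_left x t s h1 h2 (h3.trans_le hT)
  b_right x t s h1 h2 h3 := h.b_right x t s h1 h2 (h3.trans_le hT)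
  u_zero := h.u_zero
  a_zero := h.a_zero
  b_zero := h.b_zero

theorem continuousOn_source (h : CharSystem G φ a₀ b₀ T u a b)
    (hG : Continuous (Function.uncurry G)) :
    ContinuousOn (Function.uncurry fun x t => G (u x t) ((a x t + b x t) / 2))
      (univ ×ˢ Ico 0 T) :=
  hG.comp_continuousOn (h.continuousOn_u.prodMk
    ((h.continuousOn_a.add h.continuousOn_b).div_const 2))

/-- The zero solution. -/
theorem zero (hG : G 0 0 = 0) : CharSystem G (fun _ => 0) (fun _ => 0) (fun _ => 0) T
    (fun _ _ => 0) (fun _ _ => 0) (fun _ _ => 0) where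
  continuousOn_u := continuousOn_const
  continuousOn_a := continuousOn_const
  continuousOn_b := continuousOn_const
  u_right := by simp
  u_left := by simp
  a_left := by simp [hG]
  b_right := by simp [hG]
  u_zero := by simp
  a_zero := by simp
  b_zero := by simp

/-- Uniqueness in backward triangles. -/
theorem eq_of_eqOn (hG : ContDiff ℝ 1 (Function.uncurry G)) {φ' a₀' b₀' : ℝ → ℝ}
    {u' a' b' : ℝ → ℝ → ℝ} (h : CharSystem G φ a₀ b₀ T u a b)
    (h' : CharSystem G φ' a₀' b₀' T u' a' b') {x t : ℝ} (ht : 0 ≤ t) (htT : t < T)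
    (hφ : ∀ y, |y - x| ≤ t → φ y = φ' y) (ha : ∀ y, |y - x| ≤ t → a₀ y = a₀' y)
    (hb : ∀ y, |y - x| ≤ t → b₀ y = b₀' y) :
    u x t = u' x t ∧ a x t = a' x t ∧ b x t = b' x t := by
  set D : Set (ℝ × ℝ) := {z | z.2 ∈ Icc 0 t ∧ |z.1 - x| ≤ t - z.2} with hD
  have hDS : D ⊆ univ ×ˢ Ico 0 T := fun z hz => ⟨mem_univ _, hz.1.1, hz.1.2.trans_lt htT⟩
  have hDc : IsCompact D := by
    refine (isCompact_Icc (a := x - t) (b := x + t)).prod (isCompact_Icc (a := 0) (b := t))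
      |>.of_isClosed_subset ?_ ?_
    · have h1 : IsClosed {z : ℝ × ℝ | |z.1 - x| ≤ t - z.2} :=
        isClosed_le (by fun_prop) (by fun_prop)
      exact (isClosed_Icc.preimage continuous_snd).inter h1
    · rintro z ⟨h1, h2⟩
      rw [abs_le] at h2
      exact ⟨⟨by linarith [h1.1], by linarith [h1.1]⟩, h1⟩
  set w : ℝ × ℝ → ℝ × ℝ := fun z => (u z.1 z.2, (a z.1 z.2 + b z.1 z.2) / 2) with hw
  set w' : ℝ × ℝ → ℝ × ℝ := fun z => (u' z.1 z.2, (a' z.1 z.2 + b' z.1 z.2) / 2) with hw'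
  have hwc : ContinuousOn w D := ((h.continuousOn_u.prodMk
    ((h.continuousOn_a.add h.continuousOn_b).div_const 2))).mono hDS
  have hwc' : ContinuousOn w' D := ((h'.continuousOn_u.prodMk
    ((h'.continuousOn_a.add h'.continuousOn_b).div_const 2))).mono hDS
  obtain ⟨ρ₁, hρ₁⟩ := hDc.exists_bound_of_continuousOn hwc
  obtain ⟨ρ₂, hρ₂⟩ := hDc.exists_bound_of_continuousOn hwc'
  -- Both solutions are bounded on the compact triangle, so the `C¹` nonlinearity may be treated as
  -- Lipschitz.
  set ρ := max ρ₁ ρ₂ with hρ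
  obtain ⟨L, hL⟩ := (isCompact_closedBall (0 : ℝ × ℝ) ρ).exists_bound_of_continuousOn
    (hG.continuous_fderiv (by norm_num)).continuousOn
  have hLip : ∀ z ∈ D, |Function.uncurry G (w z) - Function.uncurry G (w' z)|
      ≤ |L| * (|u z.1 z.2 - u' z.1 z.2|
        + |(a z.1 z.2 + b z.1 z.2) / 2 - (a' z.1 z.2 + b' z.1 z.2) / 2|) := by
    intro z hz
    have := Convex.norm_image_sub_le_of_norm_fderiv_le (𝕜 := ℝ) (f := Function.uncurry G)
      (C := |L|) (s := Metric.closedBall 0 ρ) (x := w' z) (y := w z)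
      (fun y _ => hG.differentiable (by norm_num) y)
      (fun y hy => (hL y hy).trans (le_abs_self L)) (convex_closedBall _ _)
      (by rw [mem_closedBall_zero_iff]; exact (hρ₂ z hz).trans (le_max_right _ _))
      (by rw [mem_closedBall_zero_iff]; exact (hρ₁ z hz).trans (le_max_left _ _))
    refine this.trans ?_
    gcongr
    exact max_le_add_of_nonneg (abs_nonneg _) (abs_nonneg _)
  set e : ℝ → ℝ → ℝ := fun y s => G (u y s) ((a y s + b y s) / 2)
    - G (u' y s) ((a' y s + b' y s) / 2) with he
  have hGc := hG.continuous
  have hsrc := h.continuousOn_source hGc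
  have hsrc' := h'.continuousOn_source hGc
  have hleft : ∀ z ∈ D, ∀ σ ∈ Icc 0 z.2, ((z.1 + z.2 - σ, σ) : ℝ × ℝ) ∈ D := by
    rintro z ⟨h1, h2⟩ σ hσ
    refine ⟨⟨hσ.1, hσ.2.trans h1.2⟩, ?_⟩
    rw [abs_le] at h2 ⊢
    constructor <;> simp only <;> linarith [hσ.2]
  have hright : ∀ z ∈ D, ∀ σ ∈ Icc 0 z.2, ((z.1 - z.2 + σ, σ) : ℝ × ℝ) ∈ D := by
    rintro z ⟨h1, h2⟩ σ hσ
    refine ⟨⟨hσ.1, hσ.2.trans h1.2⟩, ?_⟩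
    rw [abs_le] at h2 ⊢
    constructor <;> simp only <;> linarith [hσ.2]
  have hbase : ∀ z ∈ D, |z.1 + z.2 - x| ≤ t ∧ |z.1 - z.2 - x| ≤ t := by
    rintro z ⟨h1, h2⟩
    rw [abs_le] at h2
    simp only [abs_le]
    refine ⟨⟨?_, ?_⟩, ?_, ?_⟩ <;> linarith [h1.1]
  have hda : ∀ z ∈ D, a z.1 z.2 - a' z.1 z.2 = ∫ σ in (0 : ℝ)..z.2, e (z.1 + z.2 - σ) σ := by
    intro z hz
    have hs := hz.1.1
    have hT : 0 + z.2 < T := by linarith [hz.1.2]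
    have h1 := h.a_left (z.1 + z.2) 0 z.2 le_rfl hs hT
    have h2 := h'.a_left (z.1 + z.2) 0 z.2 le_rfl hs hT
    have i1 := intervalIntegrable_left (x := z.1 + z.2) hsrc le_rfl hs hT
    have i2 := intervalIntegrable_left (x := z.1 + z.2) hsrc' le_rfl hs hT
    have h3 := intervalIntegral.integral_sub i1 i2
    rw [← h1, ← h2] at h3
    simp only [add_sub_cancel_right, zero_add, h.a_zero, h'.a_zero, ha _ (hbase z hz).1] at h3
    simp only [he]
    linarith
  have hdb : ∀ z ∈ D, b z.1 z.2 - b' z.1 z.2 = ∫ σ in (0 : ℝ)..z.2, e (z.1 - z.2 + σ) σ := by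
    intro z hz
    have hs := hz.1.1
    have hT : 0 + z.2 < T := by linarith [hz.1.2]
    have h1 := h.b_right (z.1 - z.2) 0 z.2 le_rfl hs hT
    have h2 := h'.b_right (z.1 - z.2) 0 z.2 le_rfl hs hT
    have i1 := intervalIntegrable_right (x := z.1 - z.2) hsrc le_rfl hs hT
    have i2 := intervalIntegrable_right (x := z.1 - z.2) hsrc' le_rfl hs hT
    have h3 := intervalIntegral.integral_sub i1 i2
    rw [← h1, ← h2] at h3
    simp only [sub_add_cancel, zero_add, h.b_zero, h'.b_zero, hb _ (hbase z hz).2] at h3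
    simp only [he]
    linarith
  have hdu : ∀ z ∈ D, u z.1 z.2 - u' z.1 z.2
      = ∫ σ in (0 : ℝ)..z.2, (a (z.1 - z.2 + σ) σ - a' (z.1 - z.2 + σ) σ) := by
    intro z hz
    have hs := hz.1.1
    have hT : 0 + z.2 < T := by linarith [hz.1.2]
    have h1 := h.u_right (z.1 - z.2) 0 z.2 le_rfl hs hT
    have h2 := h'.u_right (z.1 - z.2) 0 z.2 le_rfl hs hT
    have i1 := intervalIntegrable_right (x := z.1 - z.2) h.continuousOn_a le_rfl hs hT
    have i2 := intervalIntegrable_right (x := z.1 - z.2) h'.continuousOn_a le_rfl hs hT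
    have h3 := intervalIntegral.integral_sub i1 i2
    rw [← h1, ← h2] at h3
    simp only [sub_add_cancel, zero_add, h.u_zero, h'.u_zero, hφ _ (hbase z hz).2] at h3
    linarith
  obtain ⟨l, hl1, hl4⟩ : ∃ l : ℝ, 1 ≤ l ∧ 4 * |L| ≤ l :=
    ⟨max 1 (4 * |L|), le_max_left _ _, le_max_right _ _⟩
  have hl : 0 < l := by linarith
  have bnd : ∀ N, 0 ≤ N → (∀ z ∈ D, |e z.1 z.2| ≤ N * Real.exp (l * z.2)) → ∀ z ∈ D,
      |a z.1 z.2 - a' z.1 z.2| ≤ N / l * Real.exp (l * z.2) ∧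
      |b z.1 z.2 - b' z.1 z.2| ≤ N / l * Real.exp (l * z.2) ∧
      |u z.1 z.2 - u' z.1 z.2| ≤ N / l / l * Real.exp (l * z.2) := by
    intro N hN hN'
    have k1 : ∀ z ∈ D, |a z.1 z.2 - a' z.1 z.2| ≤ N / l * Real.exp (l * z.2) := by
      intro z hz
      rw [hda z hz]
      exact abs_integral_le_exp hN hl hz.1.1 fun σ hσ => hN' _ (hleft z hz σ hσ)
    refine fun z hz => ⟨k1 z hz, ?_, ?_⟩
    · rw [hdb z hz]
      exact abs_integral_le_exp hN hl hz.1.1 fun σ hσ => hN' _ (hright z hz σ hσ)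
    · rw [hdu z hz]
      exact abs_integral_le_exp (by positivity) hl hz.1.1 fun σ hσ => k1 _ (hright z hz σ hσ)
  obtain ⟨M₁, hM₁⟩ := hDc.exists_bound_of_continuousOn ((hsrc.sub hsrc').mono hDS)
  -- With `A = 0` the halving argument forces the difference of the sources to vanish on the
  -- triangle.
  have hzero := le_of_forall_improve (D := D) (e := fun z => e z.1 z.2)
    (w := fun z => Real.exp (l * z.2)) (A := 0) (N₀ := |M₁|) le_rfl (abs_nonneg _)
    (fun z hz => by
      have h1 : 1 ≤ Real.exp (l * z.2) := Real.one_le_exp (mul_nonneg hl.le hz.1.1)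
      have h2 : |e z.1 z.2| ≤ |M₁| := (hM₁ z hz).trans (le_abs_self _)
      exact h2.trans (le_mul_of_one_le_right (abs_nonneg _) h1))
    (fun N hN hN' z hz => by
      obtain ⟨k1, k2, k3⟩ := bnd N hN hN' z hz
      refine (hLip z hz).trans ?_
      set X := N * Real.exp (l * z.2) with hX
      have hX0 : 0 ≤ X := by positivity
      have e1 : N / l * Real.exp (l * z.2) = X / l := by rw [hX]; ring
      have e2 : N / l / l * Real.exp (l * z.2) = X / l / l := by rw [hX]; ring
      rw [e1] at k1 k2
      rw [e2] at k3
      have k4 : |(a z.1 z.2 + b z.1 z.2) / 2 - (a' z.1 z.2 + b' z.1 z.2) / 2| ≤ X / l := by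
        rw [abs_le] at *
        constructor <;> linarith [k1.1, k1.2, k2.1, k2.2]
      have k5 : X / l / l ≤ X / l := div_le_self (by positivity) hl1
      have k6 : |L| * (X / l) ≤ X / 4 := by
        rw [← mul_div_assoc, div_le_div_iff₀ hl (by norm_num)]
        nlinarith
      calc _ ≤ |L| * (X / l + X / l) := by gcongr; exact k3.trans k5
        _ ≤ (0 + N / 2) * Real.exp (l * z.2) := by rw [hX] at k6 ⊢; linarith)
  obtain ⟨k1, k2, k3⟩ := bnd 0 le_rfl (fun z hz => by simpa using hzero z hz) (x, t)
    ⟨⟨ht, le_rfl⟩, by simp⟩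
  simp only [zero_div, zero_mul, abs_nonpos_iff, sub_eq_zero] at k1 k2 k3
  exact ⟨k3, k1, k2⟩

end CharSystem

/-! ### Blow-up by doubling, and two inequalities for powers -/

/-- If a continuous quantity doubles from each of its values `N ≥ M` within time `K N ^ (-γ)`, its
lifespan is bounded in terms of its initial value. -/
theorem lifespan_le_of_doubling {y : ℝ → ℝ} {T s₀ M K γ : ℝ} (hK : 0 ≤ K) (hγ : 0 < γ) (hM : 0 < M)
    (hc : ContinuousOn y (Ico s₀ T)) (h0 : M ≤ y s₀)
    (step : ∀ s N, s₀ ≤ s → M ≤ N → N ≤ y s → s + K * N ^ (-γ) < T →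
      2 * N ≤ y (s + K * N ^ (-γ))) :
    T ≤ s₀ + K * M ^ (-γ) / (1 - 2 ^ (-γ)) := by
  by_contra! hT
  -- The `n`-th doubling takes time `K M^(-γ) ρ^n`. The total time is finite, so `y` would be
  -- unbounded on a compact interval on which it is continuous.
  set ρ : ℝ := 2 ^ (-γ) with hρ
  have hρ0 : 0 < ρ := by positivity
  have hρ1 : ρ < 1 := Real.rpow_lt_one_of_one_lt_of_neg (by norm_num) (by linarith)
  have hL : 0 ≤ K * M ^ (-γ) := by positivity
  set S := s₀ + K * M ^ (-γ) / (1 - ρ) with hS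
  have hsn : ∀ n : ℕ, s₀ + K * M ^ (-γ) * ∑ i ∈ Finset.range n, ρ ^ i ∈ Icc s₀ S := by
    intro n
    have h1 : 0 ≤ ∑ i ∈ Finset.range n, ρ ^ i := by positivity
    have h2 : ∑ i ∈ Finset.range n, ρ ^ i ≤ 1 / (1 - ρ) := by
      rw [geom_sum_eq hρ1.ne, ← neg_div_neg_eq, neg_sub, neg_sub]
      have : 0 ≤ ρ ^ n := by positivity
      gcongr
      linarith
    refine ⟨le_add_of_nonneg_right (by positivity), ?_⟩
    rw [hS, div_eq_mul_one_div]
    gcongr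
  have key : ∀ n : ℕ, 2 ^ n * M ≤ y (s₀ + K * M ^ (-γ) * ∑ i ∈ Finset.range n, ρ ^ i) := by
    intro n
    induction n with
    | zero => simpa using h0
    | succ n ih =>
      have e : (2 ^ n * M) ^ (-γ) = ρ ^ n * M ^ (-γ) := by
        rw [Real.mul_rpow (by positivity) hM.le, hρ, ← Real.rpow_natCast, ← Real.rpow_natCast,
          ← Real.rpow_mul (by norm_num), ← Real.rpow_mul (by norm_num), mul_comm (n : ℝ)]
      have e2 : s₀ + K * M ^ (-γ) * ∑ i ∈ Finset.range n, ρ ^ i + K * (2 ^ n * M) ^ (-γ)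
          = s₀ + K * M ^ (-γ) * ∑ i ∈ Finset.range (n + 1), ρ ^ i := by
        rw [e, Finset.sum_range_succ]; ring
      have h1 := step _ (2 ^ n * M) (hsn n).1
        (le_mul_of_one_le_left hM.le (one_le_pow₀ (by norm_num))) ih
        (by rw [e2]; exact (hsn (n + 1)).2.trans_lt hT)
      rw [e2] at h1
      rw [pow_succ]
      linarith
  obtain ⟨C, hC⟩ := (isCompact_Icc (a := s₀) (b := S)).exists_bound_of_continuousOn
    (hc.mono fun s hs => ⟨hs.1, hs.2.trans_lt hT⟩)
  obtain ⟨n, hn⟩ := pow_unbounded_of_one_lt (C / M) (by norm_num : (1 : ℝ) < 2)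
  rw [div_lt_iff₀ hM] at hn
  have h1 := hC _ (hsn n)
  rw [Real.norm_eq_abs] at h1
  linarith [key n, le_abs_self (y (s₀ + K * M ^ (-γ) * ∑ i ∈ Finset.range n, ρ ^ i))]

/-- Bernoulli's inequality as a tangent line of `w^p` at `l`. Integrated with `l` equal to a mean
value, it replaces Jensen's inequality. -/
theorem rpow_tangent_le {p w l : ℝ} (hp : 1 ≤ p) (hw : 0 ≤ w) (hl : 0 < l) :
    p * l ^ (p - 1) * w - (p - 1) * l ^ p ≤ w ^ p := by
  have h1 := one_add_mul_self_le_rpow_one_add (s := w / l - 1) (by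
    have : 0 ≤ w / l := by positivity
    linarith) hp
  rw [add_sub_cancel, Real.div_rpow hw hl.le, le_div_iff₀ (by positivity)] at h1
  refine le_trans (le_of_eq ?_) h1
  have e : l ^ p = l ^ (p - 1) * l := by
    rw [← Real.rpow_add_one hl.ne']; ring_nf
  rw [e]
  field_simp
  ring

/-- The interval of integration contains `[0, m]` or `[-m, 0]`. Applied after the change of
variables `z = u` along a characteristic. -/
theorem le_integral_abs_rpow {α m z₁ z₂ : ℝ} (hα : 0 ≤ α) (hm : 0 ≤ m)
    (h : (z₁ ≤ 0 ∧ m ≤ z₂) ∨ (z₁ ≤ -m ∧ 0 ≤ z₂)) :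
    m ^ (α + 1) / (α + 1) ≤ ∫ z in z₁..z₂, |z| ^ α := by
  have hc : Continuous fun z : ℝ => |z| ^ α := continuous_abs.rpow_const fun _ => Or.inr hα
  have h0 : ∫ z in (0 : ℝ)..m, |z| ^ α = m ^ (α + 1) / (α + 1) := by
    have : ∫ z in (0 : ℝ)..m, |z| ^ α = ∫ z in (0 : ℝ)..m, z ^ α := by
      refine intervalIntegral.integral_congr fun z hz => ?_
      rw [uIcc_of_le hm] at hz
      simp only [abs_of_nonneg hz.1]
    rw [this, integral_rpow (Or.inl (by linarith)), Real.zero_rpow (by linarith), sub_zero]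
  rcases h with ⟨h1, h2⟩ | ⟨h1, h2⟩
  · rw [← h0]
    exact intervalIntegral.integral_mono_interval h1 hm h2 (Eventually.of_forall fun z => by positivity)
      (hc.intervalIntegrable _ _)
  · rw [← h0]
    have : ∫ z in (0 : ℝ)..m, |z| ^ α = ∫ z in (-m)..0, |z| ^ α := by
      have := intervalIntegral.integral_comp_neg (fun z : ℝ => |z| ^ α) (a := 0) (b := m)
      simpa using this
    rw [this]
    exact intervalIntegral.integral_mono_interval h1 (by linarith) h2
      (Eventually.of_forall fun z => by positivity) (hc.intervalIntegrable _ _)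

/-! ### Monotonicity and superadditivity of solutions -/

/-- The characteristic system for `u_tt - u_xx = A |u_t|^p |u|^q + B |u|^r` with free solution
`P (x + t) + Q (x - t)`. -/
def WaveSystem (p q r A B : ℝ) (P Q : ℝ → ℝ) (T : ℝ) (u a b : ℝ → ℝ → ℝ) : Prop :=
  CharSystem (nonlin p q r A B) (fun x => P x + Q x) (fun x => 2 * deriv P x)
    (fun x => -2 * deriv Q x) T u a b

namespace WaveSystem

variable {p q r A B : ℝ} {P Q : ℝ → ℝ} {R c T : ℝ} {u a b : ℝ → ℝ → ℝ}
  (hA : 0 ≤ A) (hB : 0 ≤ B) (hP : IsProfile P R c) (hQ : IsProfile Q R (-c))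
  (h : WaveSystem p q r A B P Q T u a b)

-- The source is non-negative, so `u_t + u_x` can only grow along left-going characteristics. All
-- comparisons with the free solution rest on this and on its mirror image.
include hA hB h in
theorem a_left_mono {x t s : ℝ} (ht : 0 ≤ t) (hs : 0 ≤ s) (hT : t + s < T) :
    a x t ≤ a (x - s) (t + s) := by
  have := h.a_left x t s ht hs hT
  have h2 : 0 ≤ ∫ σ in (0 : ℝ)..s, nonlin p q r A B (u (x - σ) (t + σ))
      ((a (x - σ) (t + σ) + b (x - σ) (t + σ)) / 2) :=
    intervalIntegral.integral_nonneg hs fun σ _ => nonlin_nonneg hA hB _ _ _ _ _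
  linarith

include hA hB h in
theorem b_right_mono {x t s : ℝ} (ht : 0 ≤ t) (hs : 0 ≤ s) (hT : t + s < T) :
    b x t ≤ b (x + s) (t + s) := by
  have := h.b_right x t s ht hs hT
  have h2 : 0 ≤ ∫ σ in (0 : ℝ)..s, nonlin p q r A B (u (x + σ) (t + σ))
      ((a (x + σ) (t + σ) + b (x + σ) (t + σ)) / 2) :=
    intervalIntegral.integral_nonneg hs fun σ _ => nonlin_nonneg hA hB _ _ _ _ _
  linarith

include hA hB h in
theorem le_a {x t : ℝ} (ht : 0 ≤ t) (hT : t < T) : 2 * deriv P (x + t) ≤ a x t := by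
  have := h.a_left_mono hA hB (x := x + t) le_rfl ht (by simpa using hT)
  rw [h.a_zero] at this
  simpa using this

include hA hB h in
theorem le_b {x t : ℝ} (ht : 0 ≤ t) (hT : t < T) : -2 * deriv Q (x - t) ≤ b x t := by
  have := h.b_right_mono hA hB (x := x - t) le_rfl ht (by simpa using hT)
  rw [h.b_zero] at this
  simpa using this

include hA hB hP h in
theorem a_nonneg {x t : ℝ} (hx : R ≤ x + t) (ht : 0 ≤ t) (hT : t < T) : 0 ≤ a x t := by
  have := h.le_a hA hB (x := x) ht hT
  rw [hP.deriv_right hx] at this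
  linarith

include hA hB hP h in
theorem le_u_right {x t s : ℝ} (ht : 0 ≤ t) (hs : 0 ≤ s) (hT : t + s < T) :
    P (x + t + 2 * s) - P (x + t) ≤ u (x + s) (t + s) - u x t := by
  rw [h.u_right x t s ht hs hT]
  have hd : ∀ σ ∈ uIcc 0 s, HasDerivAt (fun σ => P (x + t + 2 * σ)) (2 * deriv P (x + t + 2 * σ)) σ := by
    intro σ _
    have := (hP.hasDerivAt (x + t + 2 * σ)).comp σ (((hasDerivAt_id σ).const_mul 2).const_add (x + t))
    convert! this using 1
    ring
  have hc := hP.contDiff_deriv.continuous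
  have hi : IntervalIntegrable (fun σ => 2 * deriv P (x + t + 2 * σ)) volume 0 s :=
    Continuous.intervalIntegrable (by fun_prop) _ _
  have e := intervalIntegral.integral_eq_sub_of_hasDerivAt hd hi
  rw [mul_zero, add_zero] at e
  rw [← e]
  refine intervalIntegral.integral_mono_on hs hi
    (intervalIntegrable_right h.continuousOn_a ht hs hT) fun σ hσ => ?_
  have := h.le_a hA hB (x := x + σ) (t := t + σ) (by linarith [hσ.1]) (by linarith [hσ.2])
  rwa [show x + σ + (t + σ) = x + t + 2 * σ by ring] at this

include hA hB hQ h in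
theorem le_u_left {x t s : ℝ} (ht : 0 ≤ t) (hs : 0 ≤ s) (hT : t + s < T) :
    Q (x - t - 2 * s) - Q (x - t) ≤ u (x - s) (t + s) - u x t := by
  rw [h.u_left x t s ht hs hT]
  have hd : ∀ σ ∈ uIcc 0 s, HasDerivAt (fun σ => Q (x - t - 2 * σ)) (-2 * deriv Q (x - t - 2 * σ)) σ := by
    intro σ _
    have := (hQ.hasDerivAt (x - t - 2 * σ)).comp σ (((hasDerivAt_id σ).const_mul 2).const_sub (x - t))
    convert! this using 1
    ring
  have hc := hQ.contDiff_deriv.continuous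
  have hi : IntervalIntegrable (fun σ => -2 * deriv Q (x - t - 2 * σ)) volume 0 s :=
    Continuous.intervalIntegrable (by fun_prop) _ _
  have e := intervalIntegral.integral_eq_sub_of_hasDerivAt hd hi
  rw [mul_zero, sub_zero] at e
  rw [← e]
  refine intervalIntegral.integral_mono_on hs hi
    (intervalIntegrable_left h.continuousOn_b ht hs hT) fun σ hσ => ?_
  have := h.le_b hA hB (x := x - σ) (t := t + σ) (by linarith [hσ.1]) (by linarith [hσ.2])
  rwa [show x - σ - (t + σ) = x - t - 2 * σ by ring] at this

include hA hB hP h in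
theorem free_le {x t : ℝ} (ht : 0 ≤ t) (hT : t < T) : P (x + t) + Q (x - t) ≤ u x t := by
  have := h.le_u_right hA hB hP (x := x - t) le_rfl ht (by simpa using hT)
  rw [h.u_zero] at this
  simp only [add_zero, zero_add, sub_add_cancel] at this
  rw [show x - t + 2 * t = x + t by ring] at this
  linarith

-- Beyond `x + t = R` the profile `P` is constant, so the lower bound `2 P'` of `u_t + u_x` is zero.
include hA hB hP h in
theorem u_right_mono {x t s : ℝ} (hx : R ≤ x + t) (ht : 0 ≤ t) (hs : 0 ≤ s) (hT : t + s < T) :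
    u x t ≤ u (x + s) (t + s) := by
  have := h.le_u_right hA hB hP (x := x) ht hs hT
  rw [hP.right _ hx, hP.right _ (by linarith)] at this
  linarith

include hA hB hQ h in
theorem u_left_mono {x t s : ℝ} (hx : x - t ≤ -R) (ht : 0 ≤ t) (hs : 0 ≤ s) (hT : t + s < T) :
    u x t ≤ u (x - s) (t + s) := by
  have := h.le_u_left hA hB hQ (x := x) ht hs hT
  rw [hQ.left _ hx, hQ.left _ (by linarith)] at this
  linarith

include h in
/-- Superadditivity of `u` on characteristic rectangles on which the source is at least `k`. -/
theorem rectangle (hcont : Continuous fun w : ℝ × ℝ => nonlin p q r A B w.1 w.2)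
    {x t k l₁ l₂ : ℝ} (ht : 0 ≤ t) (h₁ : 0 ≤ l₁) (h₂ : 0 ≤ l₂)
    (hT : t + l₁ + l₂ < T)
    (hk : ∀ i ∈ Icc 0 l₁, ∀ j ∈ Icc 0 l₂, k ≤ nonlin p q r A B (u (x + i - j) (t + i + j))
      ((a (x + i - j) (t + i + j) + b (x + i - j) (t + i + j)) / 2)) :
    u (x + l₁) (t + l₁) + u (x - l₂) (t + l₂) - u x t + k * l₁ * l₂
      ≤ u (x + l₁ - l₂) (t + l₁ + l₂) := by
  have h3 := h.u_right x t l₁ ht h₁ (by linarith)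
  have h4 := h.u_right (x - l₂) (t + l₂) l₁ (by linarith) h₁ (by linarith)
  rw [show x - l₂ + l₁ = x + l₁ - l₂ by ring, show t + l₂ + l₁ = t + l₁ + l₂ by ring] at h4
  have i3 := intervalIntegrable_right (x := x) h.continuousOn_a ht h₁ (by linarith : t + l₁ < T)
  have i4 := intervalIntegrable_right (x := x - l₂) h.continuousOn_a
    (by linarith : 0 ≤ t + l₂) h₁ (by linarith)
  have h5 : ∫ σ in (0 : ℝ)..l₁, (a (x + σ) (t + σ) + k * l₂)
      ≤ ∫ σ in (0 : ℝ)..l₁, a (x - l₂ + σ) (t + l₂ + σ) := by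
    refine intervalIntegral.integral_mono_on h₁ (i3.add intervalIntegrable_const) i4
      fun σ hσ => ?_
    have h6 := h.a_left (x + σ) (t + σ) l₂ (by linarith [hσ.1]) h₂ (by linarith [hσ.2])
    have h7 : ∫ _ in (0 : ℝ)..l₂, k ≤ ∫ j in (0 : ℝ)..l₂, nonlin p q r A B (u (x + σ - j) (t + σ + j))
        ((a (x + σ - j) (t + σ + j) + b (x + σ - j) (t + σ + j)) / 2) := by
      refine intervalIntegral.integral_mono_on h₂ intervalIntegrable_const
        (intervalIntegrable_left (h.continuousOn_source hcont) (by linarith [hσ.1]) h₂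
          (by linarith [hσ.2])) fun j hj => hk σ hσ j hj
    rw [intervalIntegral.integral_const, smul_eq_mul, sub_zero] at h7
    rw [show x - l₂ + σ = x + σ - l₂ by ring, show t + l₂ + σ = t + σ + l₂ by ring]
    linarith
  rw [intervalIntegral.integral_add i3 intervalIntegrable_const, intervalIntegral.integral_const,
    smul_eq_mul, sub_zero] at h5
  linarith

end WaveSystem

theorem le_nonlin_pow_u {p q r A B : ℝ} (hA : 0 ≤ A) (u v : ℝ) :
    B * |u| ^ r ≤ nonlin p q r A B u v :=
  le_add_of_nonneg_left (by positivity)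

theorem le_nonlin_mixed {p q r A B : ℝ} (hB : 0 ≤ B) (u v : ℝ) :
    A * |v| ^ p * |u| ^ q ≤ nonlin p q r A B u v :=
  le_add_of_nonneg_right (by positivity)

/-! ### Blow-up inside the cone and gain across the strip -/

namespace WaveSystem

variable {p q r A B : ℝ} {P Q : ℝ → ℝ} {R c T : ℝ} {u a b : ℝ → ℝ → ℝ}
  (hp : 1 < p) (hq : q = 0 ∨ 1 < q) (hr : 1 < r)
  (hA : 0 < A) (hB : 0 < B) (hP : IsProfile P R c) (hQ : IsProfile Q R (-c)) (hR : 1 ≤ R)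
  (h : WaveSystem p q r A B P Q T u a b)

include h in
theorem continuousOn_along {k l : ℝ → ℝ} {S : Set ℝ} (hk : Continuous k) (hl : Continuous l)
    (hS : ∀ s ∈ S, l s ∈ Ico 0 T) : ContinuousOn (fun s => u (k s) (l s)) S :=
  h.continuousOn_u.comp (f := fun s => (k s, l s)) (hk.prodMk hl).continuousOn
    fun s hs => ⟨mem_univ _, hS s hs⟩

include hp hq hr hP hQ h in
theorem eq_zero_outside {x t : ℝ} (ht : 0 ≤ t) (hT : t < T) (hx : t + R ≤ x) :
    u x t = 0 ∧ a x t = 0 := by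
  have := CharSystem.eq_of_eqOn (G := nonlin p q r A B) (contDiff_nonlin hp hq hr A B) h
    (CharSystem.zero (nonlin_zero (by linarith) (by linarith) q A B)) ht hT (x := x)
    (fun y hy => by
      rw [abs_le] at hy
      simp [hP.right y (by linarith), hQ.right y (by linarith)])
    (fun y hy => by
      rw [abs_le] at hy
      simp [hP.deriv_right (x := y) (by linarith)])
    (fun y hy => by
      rw [abs_le] at hy
      simp [hQ.deriv_right (x := y) (by linarith)])
  exact ⟨this.1, this.2.1⟩

include hp hq hr hA hB hP hQ h in
/-- Blow-up caused by `|u|^r` inside the light cone. -/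
theorem lifespan_le_of_pos_inside {x t M : ℝ} (ht : 0 ≤ t) (hx₁ : R ≤ x + t) (hx₂ : x - t ≤ -R)
    (hM : 0 < M) (hu : M ≤ u x t) :
    T ≤ t + 2 / √B * M ^ (-((r - 1) / 2)) / (1 - 2 ^ (-((r - 1) / 2))) := by
  refine lifespan_le_of_doubling (y := fun s => u x s) (by positivity) (by linarith) hM
    (h.continuousOn_along (k := fun _ => x) (l := fun s => s) (by fun_prop) (by fun_prop)
      fun s hs => ⟨ht.trans hs.1, hs.2⟩) hu ?_
  intro s N hs hMN hN hT
  have hN0 : 0 < N := hM.trans_le hMN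
  set l := 1 / √B * N ^ (-((r - 1) / 2)) with hl
  have hl0 : 0 ≤ l := by positivity
  have e1 : s + 2 / √B * N ^ (-((r - 1) / 2)) = s + l + l := by rw [hl]; ring
  rw [e1] at hT ⊢
  have hs0 : 0 ≤ s := ht.trans hs
  have hrect := h.rectangle (contDiff_nonlin hp hq hr A B).continuous (x := x) (t := s) (k := B * N ^ r)
    hs0 hl0 hl0 hT (fun i hi j hj => by
      refine le_trans ?_ (le_nonlin_pow_u hA.le _ _)
      have h1 := h.u_right_mono hA.le hB.le hP (x := x) (t := s) (by linarith) hs0 hi.1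
        (by linarith [hi.2])
      have h2 := h.u_left_mono hA.le hB.le hQ (x := x + i) (t := s + i) (by linarith)
        (by linarith [hi.1]) hj.1 (by linarith [hi.2, hj.2])
      have h3 : N ≤ |u (x + i - j) (s + i + j)| := by
        refine le_trans ?_ (le_abs_self _)
        linarith
      gcongr)
  have h1 := h.u_right_mono hA.le hB.le hP (x := x) (t := s) (by linarith) hs0 hl0 (by linarith)
  have h2 := h.u_left_mono hA.le hB.le hQ (x := x) (t := s) (by linarith) hs0 hl0 (by linarith)
  have e2 : B * N ^ r * l * l = N := by
    have h4 : √B * √B = B := Real.mul_self_sqrt hB.le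
    have h5 : N ^ r * (N ^ (-((r - 1) / 2)) * N ^ (-((r - 1) / 2))) = N := by
      rw [← Real.rpow_add hN0, ← Real.rpow_add hN0]
      convert! Real.rpow_one N using 2; ring
    calc B * N ^ r * l * l = B / (√B * √B) * (N ^ r * (N ^ (-((r - 1) / 2)) * N ^ (-((r - 1) / 2)))) := by
          rw [hl]; field_simp
      _ = N := by rw [h4, h5, div_self hB.ne', one_mul]
  rw [e2] at hrect
  rw [show x + l - l = x by ring] at hrect
  linarith

include hp hq hr hA hB hP hR h in
/-- Lower bound of `u_t + u_x` after crossing a strip in which `u` varies by the amount `m`. -/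
theorem le_a_of_variation {x t l m : ℝ} (hx : R ≤ x + t) (ht : 0 ≤ t) (hl : 0 ≤ l) (hlR : l ≤ R)
    (hT : t + l < T) (hm : 0 < m)
    (hcase : (u x t ≤ 0 ∧ m ≤ u (x - l) (t + l)) ∨ (u x t ≤ -m ∧ 0 ≤ u (x - l) (t + l))) :
    A / 2 ^ p * R ^ (1 - p) / (q / p + 1) ^ p * m ^ (p + q) ≤ a (x - l) (t + l) := by
  have hR0 : 0 < R := by linarith
  have hq0 : 0 ≤ q := by rcases hq with h | h <;> linarith
  have hα : 0 ≤ q / p := by positivity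
  -- With `α = q / p` the mixed term is the `p`-th power of `|u|^α |u_t|`, and `|u|^α` times the
  -- derivative of `u` along the characteristic integrates to a function of the end values of `u`.
  -- Hence `Y`, whose `p`-th power is of order `m^(p+q)`.
  set α := q / p with hαd
  set Y := m ^ (α + 1) / (α + 1) with hY
  have hY0 : 0 < Y := by positivity
  have hYI := le_integral_abs_rpow hα hm.le hcase
  rw [← hY] at hYI
  set k : ℝ → ℝ := fun σ => u (x - σ) (t + σ) with hk
  set β : ℝ → ℝ := fun σ => b (x - σ) (t + σ) with hβ
  set S := Icc 0 l
  have hS : ∀ σ ∈ S, ((x - σ, t + σ) : ℝ × ℝ) ∈ univ ×ˢ Ico 0 T := fun σ hσ =>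
    ⟨mem_univ _, add_nonneg ht hσ.1, by linarith [hσ.2]⟩
  have hkc : ContinuousOn k S := h.continuousOn_u.comp (f := fun σ : ℝ => (x - σ, t + σ))
    (by fun_prop) hS
  have hβc : ContinuousOn β S := h.continuousOn_b.comp (f := fun σ : ℝ => (x - σ, t + σ))
    (by fun_prop) hS
  have huI : uIcc 0 l = S := uIcc_of_le hl
  have hkd : ∀ σ ∈ Ioo 0 l, HasDerivAt k (β σ) σ := by
    intro σ hσ
    have h1 : HasDerivAt (fun σ => u x t + ∫ s in (0 : ℝ)..σ, β s) (β σ) σ := by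
      refine HasDerivAt.const_add _ (intervalIntegral.integral_hasDerivAt_right ?_ ?_ ?_)
      · refine (hβc.mono ?_).intervalIntegrable
        rw [uIcc_of_le hσ.1.le]
        exact Icc_subset_Icc_right hσ.2.le
      · exact (hβc.mono Ioo_subset_Icc_self).stronglyMeasurableAtFilter isOpen_Ioo σ hσ
      · exact (hβc.mono Ioo_subset_Icc_self).continuousAt (Ioo_mem_nhds hσ.1 hσ.2)
    refine h1.congr_of_eventuallyEq ?_
    filter_upwards [Ioo_mem_nhds hσ.1 hσ.2] with s hs
    have := h.u_left x t s ht hs.1.le (by linarith [hs.2])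
    simp only [hk, hβ]
    linarith
  have hpow : Continuous fun z : ℝ => |z| ^ α := continuous_abs.rpow_const fun _ => Or.inr hα
  have hchange : ∫ σ in (0 : ℝ)..l, |k σ| ^ α * β σ = ∫ z in k 0..k l, |z| ^ α := by
    have := intervalIntegral.integral_comp_mul_deriv'' (a := 0) (b := l) (f := k) (f' := β)
      (g := fun z => |z| ^ α) (by rwa [huI])
      (fun σ hσ => by
        rw [min_eq_left hl, max_eq_right hl] at hσ
        exact (hkd σ hσ).hasDerivWithinAt) (by rwa [huI]) hpow.continuousOn
    exact this
  have hk0 : k 0 = u x t := by simp [hk]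
  rw [hk0] at hchange
  set w : ℝ → ℝ := fun σ => |k σ| ^ α * max (β σ) 0 with hw
  have hw0 : ∀ σ, 0 ≤ w σ := fun σ => mul_nonneg (by positivity) (le_max_right _ _)
  have hkαc : ContinuousOn (fun σ => |k σ| ^ α) S := hpow.comp_continuousOn hkc
  have hwc : ContinuousOn w S := hkαc.mul (hβc.sup continuousOn_const)
  have hwi : IntervalIntegrable w volume 0 l := (by rwa [huI] : ContinuousOn w (uIcc 0 l)).intervalIntegrable
  have hYw : Y ≤ ∫ σ in (0 : ℝ)..l, w σ := by
    refine (hYI.trans (le_of_eq hchange.symm)).trans ?_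
    refine intervalIntegral.integral_mono_on hl
      (by rw [huI]; exact hkαc.mul hβc : ContinuousOn (fun σ => |k σ| ^ α * β σ) (uIcc 0 l)).intervalIntegrable
      hwi fun σ _ => ?_
    exact mul_le_mul_of_nonneg_left (le_max_left _ _) (by positivity)
  have hsrc := intervalIntegrable_left (x := x) (h.continuousOn_source
    (contDiff_nonlin hp hq hr A B).continuous) ht hl hT
  -- The tangent point: the mean over a strip of width `R`, which is optimal for the Jensen type
  -- bound `hfin`.
  set lam := Y / R with hlam
  have hlam0 : 0 < lam := by positivity
  have hlow : ∫ σ in (0 : ℝ)..l, A / 2 ^ p * (p * lam ^ (p - 1) * w σ - (p - 1) * lam ^ p)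
      ≤ a (x - l) (t + l) - a x t := by
    rw [h.a_left x t l ht hl hT]
    refine intervalIntegral.integral_mono_on hl
      (((hwi.const_mul _).sub intervalIntegrable_const).const_mul _) hsrc fun σ hσ => ?_
    refine le_trans ?_ (le_nonlin_mixed hB.le _ _)
    have h1 := rpow_tangent_le hp.le (hw0 σ) hlam0
    have h2 : w σ ^ p = |k σ| ^ q * max (β σ) 0 ^ p := by
      simp only [hw]
      rw [Real.mul_rpow (by positivity) (le_max_right _ _), ← Real.rpow_mul (abs_nonneg _), hαd,
        div_mul_cancel₀ _ (by linarith : p ≠ 0)]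
    have h3 := h.a_nonneg hA.le hB.le hP (x := x - σ) (t := t + σ) (by linarith)
      (by linarith [hσ.1]) (by linarith [hσ.2])
    -- Since `a ≥ 0` here, `u_t = (a + b) / 2` is at least half of the positive part of `b`, the
    -- derivative of `u` along this characteristic.
    have h4 : max (β σ) 0 / 2 ≤ |(a (x - σ) (t + σ) + b (x - σ) (t + σ)) / 2| := by
      rcases le_or_gt 0 (β σ) with h5 | h5
      · refine le_trans ?_ (le_abs_self _)
        rw [max_eq_left h5]
        simp only [hβ]
        linarith
      · rw [max_eq_right h5.le, zero_div]
        positivity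
    calc _ ≤ A / 2 ^ p * w σ ^ p := by gcongr
      _ = A * (max (β σ) 0 / 2) ^ p * |k σ| ^ q := by
          rw [h2, Real.div_rpow (le_max_right _ _) (by norm_num)]; ring
      _ ≤ _ := by
          have := le_max_right (β σ) 0
          gcongr
  have ha := h.a_nonneg hA.le hB.le hP hx ht (by linarith)
  rw [intervalIntegral.integral_const_mul, intervalIntegral.integral_sub (hwi.const_mul _)
    intervalIntegrable_const, intervalIntegral.integral_const_mul, intervalIntegral.integral_const,
    smul_eq_mul, sub_zero] at hlow
  have hfin : R ^ (1 - p) * Y ^ p ≤ p * lam ^ (p - 1) * (∫ σ in (0 : ℝ)..l, w σ)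
      - l * ((p - 1) * lam ^ p) := by
    have e1 : R ^ (1 - p) * Y ^ p = p * lam ^ (p - 1) * Y - R * ((p - 1) * lam ^ p) := by
      have h1 : lam ^ (p - 1) * Y = R ^ (1 - p) * Y ^ p := by
        rw [hlam, Real.div_rpow hY0.le hR0.le, show (1 : ℝ) - p = -(p - 1) by ring,
          Real.rpow_neg hR0.le, Real.rpow_sub_one hY0.ne']
        field_simp
      have h2 : R * lam ^ p = R ^ (1 - p) * Y ^ p := by
        rw [hlam, Real.div_rpow hY0.le hR0.le, Real.rpow_sub hR0, Real.rpow_one]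
        field_simp
      calc _ = p * (R ^ (1 - p) * Y ^ p) - (p - 1) * (R ^ (1 - p) * Y ^ p) := by ring
        _ = p * (lam ^ (p - 1) * Y) - (p - 1) * (R * lam ^ p) := by rw [h1, h2]
        _ = _ := by ring
    rw [e1]
    have h1 : 0 ≤ (p - 1) * lam ^ p := mul_nonneg (by linarith) (by positivity)
    have h2 : 0 ≤ p * lam ^ (p - 1) := by positivity
    gcongr
  have hYp : Y ^ p = m ^ (p + q) / (α + 1) ^ p := by
    rw [hY, Real.div_rpow (by positivity) (by positivity), ← Real.rpow_mul hm.le]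
    congr 2
    rw [hαd]; field_simp; ring
  have h1 : 0 ≤ A / 2 ^ p := by positivity
  have h2 := mul_le_mul_of_nonneg_left hfin h1
  rw [hYp] at h2
  calc _ = A / 2 ^ p * (R ^ (1 - p) * (m ^ (p + q) / (α + 1) ^ p)) := by ring
    _ ≤ _ := by linarith

end WaveSystem

/-- The constant in the growth estimate along the light cone due to `|u_t|^p |u|^q`. -/
noncomputable def mixedConst (p q A R : ℝ) : ℝ := A / 2 ^ p * R ^ (1 - p) / (q / p + 1) ^ p

theorem mixedConst_pos {p q A R : ℝ} (hp : 1 < p) (hq : 0 ≤ q) (hA : 0 < A) (hR : 1 ≤ R) :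
    0 < mixedConst p q A R := by
  have : 0 < R := by linarith
  unfold mixedConst
  positivity

/-- By continuity a nonzero profile keeps one sign and stays away from zero on a short interval to
the right of a point where it does not vanish. -/
theorem IsProfile.exists_interval {Q : ℝ → ℝ} {R : ℝ} (hQ : IsProfile Q R 0) (h : Q ≠ 0) :
    ∃ y₂ y₃ μ : ℝ, -R ≤ y₂ ∧ y₂ < y₃ ∧ y₃ ≤ R ∧ 0 < μ ∧
      ((∀ y ∈ Icc y₂ y₃, μ ≤ Q y) ∨ ∀ y ∈ Icc y₂ y₃, Q y ≤ -μ) := by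
  obtain ⟨x, hx⟩ := Function.ne_iff.1 h
  rw [Pi.zero_apply] at hx
  have h1 : -R < x := by
    by_contra! hc; exact hx (hQ.left x hc)
  have h2 : x < R := by
    by_contra! hc; exact hx (hQ.right x hc)
  have hc := hQ.contDiff.continuous
  rcases lt_or_gt_of_ne hx with hs | hs
  · have : ∀ᶠ y in 𝓝[≥] x, Q y < Q x / 2 :=
      nhdsWithin_le_nhds (hc.continuousAt.eventually_lt continuousAt_const (by linarith))
    obtain ⟨z, hz, hz2⟩ := mem_nhdsGE_iff_exists_Icc_subset.1 this
    refine ⟨x, min z R, -(Q x / 2), h1.le, lt_min hz h2, min_le_right _ _, by linarith,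
      Or.inr fun y hy => ?_⟩
    have := hz2 ⟨hy.1, hy.2.trans (min_le_left _ _)⟩
    simp only [mem_ofPred_eq] at this
    linarith
  · have : ∀ᶠ y in 𝓝[≥] x, Q x / 2 < Q y :=
      nhdsWithin_le_nhds (continuousAt_const.eventually_lt hc.continuousAt (by linarith))
    obtain ⟨z, hz, hz2⟩ := mem_nhdsGE_iff_exists_Icc_subset.1 this
    refine ⟨x, min z R, Q x / 2, h1.le, lt_min hz h2, min_le_right _ _, by linarith,
      Or.inl fun y hy => ?_⟩
    have := hz2 ⟨hy.1, hy.2.trans (min_le_left _ _)⟩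
    simp only [mem_ofPred_eq] at this
    linarith

/-! ### Blow-up along the cone, change of sign, and growth at the edge -/

namespace WaveSystem

variable {p q r A B : ℝ} {P Q : ℝ → ℝ} {R c T : ℝ} {u a b : ℝ → ℝ → ℝ}
  (hp : 1 < p) (hq : q = 0 ∨ 1 < q) (hr : 1 < r)
  (hA : 0 < A) (hB : 0 < B) (hR : 1 ≤ R)

section General

variable (hP : IsProfile P R c) (hQ : IsProfile Q R (-c)) (h : WaveSystem p q r A B P Q T u a b)

include hp hq hr hA hB hP hQ hR h

/-- Follow the left-going characteristic back to the outer edge of the cone, where `u = 0`. From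
there `u` rises to `m` within a time `(R - y₀) / 2 ≤ R`. -/
theorem le_a_of_pos_level {y₀ t m : ℝ} (h₁ : -R ≤ y₀) (h₂ : y₀ ≤ R) (ht : R ≤ t) (hT : t < T)
    (hm : 0 < m) (hu : m ≤ u (y₀ + t) t) :
    mixedConst p q A R * m ^ (p + q) ≤ a (y₀ + t) t := by
  have e1 : (y₀ + 2 * t + R) / 2 - (R - y₀) / 2 = y₀ + t := by ring
  have e2 : (y₀ + 2 * t - R) / 2 + (R - y₀) / 2 = t := by ring
  have h0 := h.eq_zero_outside hp hq hr hP hQ (x := (y₀ + 2 * t + R) / 2)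
    (t := (y₀ + 2 * t - R) / 2) (by linarith) (by linarith) (by linarith)
  have := h.le_a_of_variation hp hq hr hA hB hP hR (x := (y₀ + 2 * t + R) / 2)
    (t := (y₀ + 2 * t - R) / 2) (l := (R - y₀) / 2) (m := m) (by linarith) (by linarith)
    (by linarith) (by linarith) (by linarith) hm (Or.inl ⟨h0.1.le, by rwa [e1, e2]⟩)
  rwa [e1, e2] at this

/-- Blow-up caused by `|u_t|^p |u|^q` along the light cone. -/
theorem lifespan_le_of_pos_level {y₀ t M : ℝ} (h₁ : -R ≤ y₀) (h₂ : y₀ ≤ R) (ht : R ≤ t)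
    (hM : 0 < M) (hu : M ≤ u (y₀ + t) t) :
    T ≤ t + 1 / mixedConst p q A R * M ^ (-(p + q - 1)) / (1 - 2 ^ (-(p + q - 1))) := by
  have hq0 : 0 ≤ q := by rcases hq with h | h <;> linarith
  have hk := mixedConst_pos hp hq0 hA hR
  set κ := mixedConst p q A R with hκ
  refine lifespan_le_of_doubling (y := fun s => u (y₀ + s) s) (by positivity) (by linarith) hM
    (h.continuousOn_along (k := fun s => y₀ + s) (l := fun s => s) (by fun_prop) (by fun_prop)
      fun s hs => ⟨by linarith [hs.1], hs.2⟩) hu ?_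
  intro s N hs hMN hN hT
  have hN0 : 0 < N := hM.trans_le hMN
  -- Chosen so that the growth rate `κ N^(p+q)` along the line `x - t = y₀`, acting for the time
  -- `l`, adds exactly `N`.
  set l := 1 / κ * N ^ (-(p + q - 1)) with hl
  have hl0 : 0 ≤ l := by positivity
  have h3 := h.u_right (y₀ + s) s l (by linarith) hl0 hT
  have h4 : ∫ _ in (0 : ℝ)..l, κ * N ^ (p + q) ≤ ∫ σ in (0 : ℝ)..l, a (y₀ + s + σ) (s + σ) := by
    refine intervalIntegral.integral_mono_on hl0 intervalIntegrable_const
      (intervalIntegrable_right h.continuousOn_a (by linarith) hl0 hT) fun σ hσ => ?_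
    have h5 := h.u_right_mono hA.le hB.le hP (x := y₀ + s) (t := s) (by linarith) (by linarith) hσ.1
      (by linarith [hσ.2])
    rw [add_assoc] at h5 ⊢
    exact h.le_a_of_pos_level hp hq hr hA hB hR hP hQ h₁ h₂ (by linarith [hσ.1])
      (by linarith [hσ.2]) hN0 (hN.trans h5)
  have e : l * (κ * N ^ (p + q)) = N := by
    have : N ^ (-(p + q - 1)) * N ^ (p + q) = N := by
      rw [← Real.rpow_add hN0]
      convert! Real.rpow_one N using 2; ring
    calc l * (κ * N ^ (p + q)) = κ / κ * (N ^ (-(p + q - 1)) * N ^ (p + q)) := by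
          rw [hl]; field_simp
      _ = N := by rw [this, div_self hk.ne', one_mul]
  rw [intervalIntegral.integral_const, smul_eq_mul, sub_zero, e] at h4
  simp only [← add_assoc]
  linarith

/-- If the free solution is negative inside the light cone and `u` is still close to it at the
corner `(0, L)`, then `u` becomes positive by the time `R + 2 Λ`. -/
theorem pos_of_neg_corner {L Λ : ℝ} (hc : c < 0) (hL : R < L) (hu : u 0 L ≤ 9 / 10 * c)
    (hΛ : (L - R) / 2 ≤ Λ) (hprod : -c ≤ B * (-c / 16) ^ r * Λ * ((L - R) / 2))
    (hT : R + 2 * Λ < T) : -c / 2 ≤ u 0 (R + 2 * Λ) := by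
  set l := (L - R) / 2 with hl
  have hl0 : 0 < l := by rw [hl]; linarith
  have hLl : L = R + l + l := by rw [hl]; ring
  have hGc := (contDiff_nonlin hp hq hr A B).continuous
  have hmono : ∀ i j i' j' : ℝ, 0 ≤ i → i ≤ i' → 0 ≤ j → j ≤ j' → R + i' + j' < T →
      u (i - j) (R + i + j) ≤ u (i' - j') (R + i' + j') := by
    intro i j i' j' h1 h2 h3 h4 h5
    have m1 := h.u_right_mono hA.le hB.le hP (x := i - j) (t := R + i + j) (s := i' - i)
      (by linarith) (by linarith) (by linarith) (by linarith)
    have m2 := h.u_left_mono hA.le hB.le hQ (x := i' - j) (t := R + i' + j) (s := j' - j)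
      (by linarith) (by linarith) (by linarith) (by linarith)
    rw [show i - j + (i' - i) = i' - j by ring, show R + i + j + (i' - i) = R + i' + j by ring] at m1
    rw [show i' - j - (j' - j) = i' - j' by ring, show R + i' + j + (j' - j) = R + i' + j' by ring] at m2
    exact m1.trans m2
  have hfree : ∀ i j : ℝ, 0 ≤ i → 0 ≤ j → R + i + j < T → c ≤ u (i - j) (R + i + j) := by
    intro i j h1 h2 h3
    have := h.free_le hA.le hB.le hP (x := i - j) (t := R + i + j) (by linarith) h3
    rwa [hP.right _ (by linarith), hQ.left _ (by linarith), add_zero] at this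
  -- If the top corner were still below `c / 16`, monotonicity would keep `|u| ≥ -c / 16` on the
  -- whole rectangle, and the source would add at least `-c`. As one side corner is at least `c` and
  -- the other at least the bottom corner, the top would be non-negative.
  have key : ∀ l₁ l₂ : ℝ, 0 ≤ l₁ → 0 ≤ l₂ → R + l₁ + l₂ < T → -c ≤ B * (-c / 16) ^ r * l₁ * l₂ →
      c / 16 < u (l₁ - l₂) (R + l₁ + l₂) := by
    intro l₁ l₂ h1 h2 h3 h4
    by_contra! hle
    have hrect := h.rectangle hGc (x := 0) (t := R) (k := B * (-c / 16) ^ r) (by linarith) h1 h2 h3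
      (fun i hi j hj => by
        refine le_trans ?_ (le_nonlin_pow_u hA.le _ _)
        have h5 := hmono i j l₁ l₂ hi.1 hi.2 hj.1 hj.2 h3
        have h6 : -c / 16 ≤ |u (0 + i - j) (R + i + j)| := by
          refine le_trans ?_ (neg_le_abs _)
          rw [zero_add]
          linarith
        gcongr
        linarith)
    have h7 := hfree l₁ 0 h1 le_rfl (by linarith)
    have h8 := hmono 0 0 0 l₂ le_rfl le_rfl le_rfl h2 (by linarith)
    simp only [sub_zero, add_zero, zero_add, zero_sub] at h7 h8 hrect
    linarith
  have k1 := key Λ l (by linarith) hl0.le (by linarith) hprod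
  have k2 := key l Λ hl0.le (by linarith) (by linarith) (by rw [mul_right_comm]; exact hprod)
  -- In the square with bottom `(0, L)` both side corners exceed `c / 16` while the bottom is at
  -- most `9 c / 10`. Superadditivity gives `c / 8 - 9 c / 10 ≥ -c / 2` at the top, with no further
  -- use of the source.
  have hrect := h.rectangle hGc (x := 0) (t := L) (l₁ := Λ - l) (l₂ := Λ - l) (k := 0) (by linarith)
    (by linarith) (by linarith) (by linarith) (fun _ _ _ _ => nonlin_nonneg hA.le hB.le _ _ _ _ _)
  rw [show 0 + (Λ - l) - (Λ - l) = 0 by ring, show L + (Λ - l) + (Λ - l) = R + 2 * Λ by linarith,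
    show 0 + (Λ - l) = Λ - l by ring, show 0 - (Λ - l) = l - Λ by ring,
    show L + (Λ - l) = R + Λ + l by linarith] at hrect
  rw [show R + l + Λ = R + Λ + l by ring] at k2
  linarith

end General

section Zero

variable (hP : IsProfile P R 0) (hQ : IsProfile Q R 0)

include hp hq hr hA hB hR hP hQ

/-- On the left-going characteristic through `(-R + t, t)`, the difference `u - Q(x - t)` is
non-negative and nondecreasing, hence squeezed by the edge value. If that value is small, `u`
follows `Q` closely in the strip: it has to vary by `μ / 2`, which feeds the mixed term, and `|u| ≥
μ / 2` on the interval found for `Q`, which feeds the pure power. -/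
theorem le_a_of_small (h : WaveSystem p q r A B P Q T u a b) {y₂ y₃ μ t : ℝ} (h₁ : -R ≤ y₂)
    (h₂ : y₂ ≤ y₃) (h₃ : y₃ ≤ R) (hμ : 0 < μ)
    (hcase : (∀ y ∈ Icc y₂ y₃, μ ≤ Q y) ∨ ∀ y ∈ Icc y₂ y₃, Q y ≤ -μ) (ht : R ≤ t) (hT : t < T)
    (hu : u (-R + t) t ≤ μ / 2) :
    mixedConst p q A R * (μ / 2) ^ (p + q) ≤ a (-R + t) t ∧
      B * (μ / 2) ^ r * ((y₃ - y₂) / 2) ≤ a (-R + t) t := by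
  have hq0 : 0 ≤ q := by rcases hq with h | h <;> linarith
  have hQ' : IsProfile Q R (-0) := by rwa [neg_zero]
  have hlow : ∀ y ∈ Icc (-R) R, Q y ≤ u ((2 * t - R + y) / 2) ((2 * t - R - y) / 2) := by
    intro y hy
    have := h.free_le hA.le hB.le hP (x := (2 * t - R + y) / 2) (t := (2 * t - R - y) / 2)
      (by linarith [hy.2]) (by linarith [hy.1])
    rw [hP.right _ (by linarith)] at this
    rwa [zero_add, show (2 * t - R + y) / 2 - (2 * t - R - y) / 2 = y by ring] at this
  have hup : ∀ y ∈ Icc (-R) R,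
      u ((2 * t - R + y) / 2) ((2 * t - R - y) / 2) ≤ Q y + u (-R + t) t := by
    intro y hy
    have := h.le_u_left hA.le hB.le hQ' (x := (2 * t - R + y) / 2) (t := (2 * t - R - y) / 2)
      (s := (y + R) / 2) (by linarith [hy.2]) (by linarith [hy.1]) (by linarith)
    rw [show (2 * t - R + y) / 2 - (2 * t - R - y) / 2 - 2 * ((y + R) / 2) = -R by ring,
      show (2 * t - R + y) / 2 - (2 * t - R - y) / 2 = y by ring,
      show (2 * t - R + y) / 2 - (y + R) / 2 = -R + t by ring,
      show (2 * t - R - y) / 2 + (y + R) / 2 = t by ring, hQ.left _ le_rfl] at this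
    linarith
  have hy₂ : y₂ ∈ Icc (-R) R := ⟨h₁, h₂.trans h₃⟩
  have hend : a ((2 * t - R + y₂) / 2) ((2 * t - R - y₂) / 2) ≤ a (-R + t) t := by
    have := h.a_left_mono hA.le hB.le (x := (2 * t - R + y₂) / 2) (t := (2 * t - R - y₂) / 2)
      (s := (y₂ + R) / 2) (by linarith) (by linarith) (by linarith)
    rwa [show (2 * t - R + y₂) / 2 - (y₂ + R) / 2 = -R + t by ring,
      show (2 * t - R - y₂) / 2 + (y₂ + R) / 2 = t by ring] at this
  constructor
  · rcases hcase with hc | hc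
    · have h4 := hc y₂ ⟨le_rfl, h₂⟩
      have h5 := hlow y₂ hy₂
      have h0 := h.eq_zero_outside hp hq hr hP hQ' (x := t) (t := t - R) (by linarith)
        (by linarith) (by linarith)
      have h6 := h.le_a_of_variation hp hq hr hA hB hP hR (x := t) (t := t - R) (l := (R - y₂) / 2)
        (m := μ / 2) (by linarith) (by linarith) (by linarith) (by linarith) (by linarith)
        (by linarith) (Or.inl ⟨h0.1.le, by
          rw [show t - (R - y₂) / 2 = (2 * t - R + y₂) / 2 by ring,
            show t - R + (R - y₂) / 2 = (2 * t - R - y₂) / 2 by ring]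
          linarith⟩)
      rw [show t - (R - y₂) / 2 = (2 * t - R + y₂) / 2 by ring,
            show t - R + (R - y₂) / 2 = (2 * t - R - y₂) / 2 by ring] at h6
      exact h6.trans hend
    · have h4 := hc y₂ ⟨le_rfl, h₂⟩
      have h5 := hup y₂ hy₂
      have h0 := hlow (-R) ⟨le_rfl, by linarith⟩
      rw [hQ.left _ le_rfl, show (2 * t - R + -R) / 2 = -R + t by ring,
        show (2 * t - R - -R) / 2 = t by ring] at h0
      have e1 : (2 * t - R + y₂) / 2 - (y₂ + R) / 2 = -R + t := by ring
      have e2 : (2 * t - R - y₂) / 2 + (y₂ + R) / 2 = t := by ring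
      have h6 := h.le_a_of_variation hp hq hr hA hB hP hR (x := (2 * t - R + y₂) / 2)
        (t := (2 * t - R - y₂) / 2) (l := (y₂ + R) / 2)
        (m := μ / 2) (by linarith) (by linarith) (by linarith) (by linarith) (by linarith)
        (by linarith) (Or.inr ⟨by linarith, by rwa [e1, e2]⟩)
      rwa [e1, e2] at h6
  · refine le_trans ?_ hend
    have h4 := h.a_left ((2 * t - R + y₃) / 2) ((2 * t - R - y₃) / 2) ((y₃ - y₂) / 2) (by linarith)
      (by linarith) (by linarith)
    rw [show (2 * t - R + y₃) / 2 - (y₃ - y₂) / 2 = (2 * t - R + y₂) / 2 by ring,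
      show (2 * t - R - y₃) / 2 + (y₃ - y₂) / 2 = (2 * t - R - y₂) / 2 by ring] at h4
    have h5 := h.a_nonneg hA.le hB.le hP (x := (2 * t - R + y₃) / 2) (t := (2 * t - R - y₃) / 2)
      (by linarith) (by linarith) (by linarith)
    have h6 : ∫ _ in (0 : ℝ)..((y₃ - y₂) / 2), B * (μ / 2) ^ r ≤
        a ((2 * t - R + y₂) / 2) ((2 * t - R - y₂) / 2)
          - a ((2 * t - R + y₃) / 2) ((2 * t - R - y₃) / 2) := by
      rw [h4]
      refine intervalIntegral.integral_mono_on (by linarith) intervalIntegrable_const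
        (intervalIntegrable_left (h.continuousOn_source (contDiff_nonlin hp hq hr A B).continuous)
          (by linarith) (by linarith) (by linarith)) fun σ hσ => ?_
      refine le_trans ?_ (le_nonlin_pow_u hA.le _ _)
      have h7 : y₃ - 2 * σ ∈ Icc y₂ y₃ := ⟨by linarith [hσ.2], by linarith [hσ.1]⟩
      have h8 : y₃ - 2 * σ ∈ Icc (-R) R := ⟨h₁.trans h7.1, h7.2.trans h₃⟩
      rw [show (2 * t - R + y₃) / 2 - σ = (2 * t - R + (y₃ - 2 * σ)) / 2 by ring,
        show (2 * t - R - y₃) / 2 + σ = (2 * t - R - (y₃ - 2 * σ)) / 2 by ring]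
      have h9 : μ / 2 ≤ |u ((2 * t - R + (y₃ - 2 * σ)) / 2) ((2 * t - R - (y₃ - 2 * σ)) / 2)| := by
        rcases hcase with hc | hc
        · refine le_trans ?_ (le_abs_self _)
          linarith [hc _ h7, hlow _ h8]
        · refine le_trans ?_ (neg_le_abs _)
          linarith [hc _ h7, hup _ h8]
      gcongr
    rw [intervalIntegral.integral_const, smul_eq_mul, sub_zero, mul_comm] at h6
    linarith

/-- Growth of `u` along the edge of the light cone when the free solution vanishes inside it. -/
theorem exists_growth (hne : Q ≠ 0) {m : ℝ} (hm : m = p + q ∨ m = r) :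
    ∃ κ > 0, ∃ k > 0, ∀ ε > 0, ∀ T u a b,
      WaveSystem p q r A B (fun x => ε * P x) (fun x => ε * Q x) T u a b →
      ∀ t, R ≤ t → t < T → κ * ε ≤ u (-R + t) t ∨ k * ε ^ m * (t - R) ≤ u (-R + t) t := by
  have hq0 : 0 ≤ q := by rcases hq with h | h <;> linarith
  obtain ⟨y₂, y₃, μ, h₁, h₂, h₃, hμ, hcase⟩ := hQ.exists_interval hne
  have hk0 := mixedConst_pos hp hq0 hA hR
  obtain ⟨k, hk, hka⟩ : ∃ k > 0, ∀ ε > 0, ∀ X,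
      mixedConst p q A R * (ε * μ / 2) ^ (p + q) ≤ X ∧ B * (ε * μ / 2) ^ r * ((y₃ - y₂) / 2) ≤ X →
      k * ε ^ m ≤ X := by
    rcases hm with rfl | rfl
    · refine ⟨mixedConst p q A R * (μ / 2) ^ (p + q), by positivity, fun ε hε X hX => ?_⟩
      refine le_trans (le_of_eq ?_) hX.1
      rw [mul_div_assoc, Real.mul_rpow hε.le (by positivity)]; ring
    · refine ⟨B * (μ / 2) ^ m * ((y₃ - y₂) / 2), ?_, fun ε hε X hX => ?_⟩
      · have : 0 < y₃ - y₂ := by linarith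
        positivity
      · refine le_trans (le_of_eq ?_) hX.2
        rw [mul_div_assoc, Real.mul_rpow hε.le (by positivity)]; ring
  refine ⟨μ / 2, by positivity, k, hk, fun ε hε T u a b h t ht hT => ?_⟩
  have hPε := hP.smul ε
  have hQε := hQ.smul ε
  rw [mul_zero] at hPε hQε
  by_contra! hcon
  obtain ⟨hc1, hc2⟩ := hcon
  have h4 := h.u_right (-R + R) R (t - R) (by linarith) (by linarith) (by linarith)
  have h5 : ∫ _ in (0 : ℝ)..(t - R), k * ε ^ m ≤ ∫ σ in (0 : ℝ)..(t - R), a (-R + R + σ) (R + σ) := by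
    refine intervalIntegral.integral_mono_on (by linarith) intervalIntegrable_const
      (intervalIntegrable_right h.continuousOn_a (by linarith) (by linarith) (by linarith))
      fun σ hσ => ?_
    -- `u` is nondecreasing along the edge, so smallness at time `t` gives smallness at every
    -- earlier time and the growth rate holds throughout.
    have h6 := h.u_right_mono hA.le hB.le hPε (x := -R + (R + σ)) (t := R + σ) (s := t - R - σ)
      (by linarith [hσ.1]) (by linarith [hσ.1]) (by linarith [hσ.2]) (by linarith)
    rw [show -R + (R + σ) + (t - R - σ) = -R + t by ring,
      show R + σ + (t - R - σ) = t by ring] at h6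
    rw [add_assoc]
    refine hka ε hε _ (h.le_a_of_small hp hq hr hA hB hR hPε hQε h₁ h₂.le h₃ (mul_pos hε hμ) ?_
      (by linarith [hσ.1]) (by linarith [hσ.2]) (by linarith))
    rcases hcase with hc | hc
    · exact Or.inl fun y hy => mul_le_mul_of_nonneg_left (hc y hy) hε.le
    · refine Or.inr fun y hy => ?_
      rw [← mul_neg]
      exact mul_le_mul_of_nonneg_left (hc y hy) hε.le
  rw [intervalIntegral.integral_const, smul_eq_mul, sub_zero, ← h4,
    show -R + R + (t - R) = -R + t by ring, show R + (t - R) = t by ring] at h5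
  have h7 := h.free_le hA.le hB.le hPε (x := -R + R) (t := R) (by linarith) (by linarith)
  rw [hPε.right _ (by linarith), hQε.left _ (by linarith)] at h7
  linarith

end Zero

end WaveSystem

/-! ### Reflection symmetry -/

/-- The system is invariant under the reflection `x ↦ -x`. -/
theorem CharSystem.reflect {G : ℝ → ℝ → ℝ} {φ a₀ b₀ : ℝ → ℝ} {T : ℝ} {u a b : ℝ → ℝ → ℝ}
    (h : CharSystem G φ a₀ b₀ T u a b) :
    CharSystem G (fun x => φ (-x)) (fun x => b₀ (-x)) (fun x => a₀ (-x)) T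
      (fun x t => u (-x) t) (fun x t => b (-x) t) (fun x t => a (-x) t) := by
  have hc : ∀ {k : ℝ → ℝ → ℝ}, ContinuousOn (Function.uncurry k) (univ ×ˢ Ico 0 T) →
      ContinuousOn (Function.uncurry fun x t => k (-x) t) (univ ×ˢ Ico 0 T) := fun hk =>
    hk.comp (f := fun z : ℝ × ℝ => (-z.1, z.2)) (by fun_prop) fun z hz => ⟨mem_univ _, hz.2⟩
  have e₁ : ∀ x s : ℝ, -(x + s) = -x - s := fun x s => by ring
  have e₂ : ∀ x s : ℝ, -(x - s) = -x + s := fun x s => by ring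
  refine ⟨hc h.continuousOn_u, hc h.continuousOn_b, hc h.continuousOn_a, ?_, ?_, ?_, ?_,
    fun x => h.u_zero _, fun x => h.b_zero _, fun x => h.a_zero _⟩
  · intro x t s h1 h2 h3
    simpa only [e₁] using h.u_left (-x) t s h1 h2 h3
  · intro x t s h1 h2 h3
    simpa only [e₂] using h.u_right (-x) t s h1 h2 h3
  · intro x t s h1 h2 h3
    simpa only [e₂, add_comm (b _ _)] using h.b_right (-x) t s h1 h2 h3
  · intro x t s h1 h2 h3
    simpa only [e₁, add_comm (b _ _)] using h.a_left (-x) t s h1 h2 h3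

/-- The added constant restores the normalization that a profile vanishes on the left. For the pair
`P`, `Q` the two constants are opposite and leave the free solution unchanged. -/
theorem IsProfile.reflect {P : ℝ → ℝ} {R c d : ℝ} (hP : IsProfile P R c) (hd : d = -c) :
    IsProfile (fun y => P (-y) + d) R d where
  contDiff := (hP.contDiff.comp contDiff_neg).add contDiff_const
  left x hx := by rw [hP.right _ (by linarith), hd]; ring
  right x hx := by rw [hP.left _ (by linarith), zero_add]

theorem IsProfile.deriv_reflect {P : ℝ → ℝ} {R c : ℝ} (hP : IsProfile P R c) (d x : ℝ) :
    deriv (fun y => P (-y) + d) x = -deriv P (-x) := by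
  have := ((hP.hasDerivAt (-x)).comp x (hasDerivAt_neg x)).add_const d
  simpa using this.deriv

theorem WaveSystem.reflect {p q r A B : ℝ} {P Q : ℝ → ℝ} {R c T : ℝ} {u a b : ℝ → ℝ → ℝ}
    (hP : IsProfile P R c) (hQ : IsProfile Q R (-c)) (h : WaveSystem p q r A B P Q T u a b) :
    WaveSystem p q r A B (fun y => Q (-y) + c) (fun y => P (-y) + -c) T
      (fun x t => u (-x) t) (fun x t => b (-x) t) (fun x t => a (-x) t) := by
  have := CharSystem.reflect h
  unfold WaveSystem
  convert! this using 1
  · funext x; ring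
  · funext x; rw [hQ.deriv_reflect]; ring
  · funext x; rw [hP.deriv_reflect]; ring

/-! ### Upper bounds for the existence time -/

/-- Solutions with small data `ε P`, `ε Q` exist at most up to a time of order `ε ^ (-θ)`. -/
def UpperPowerBound (p q r A B : ℝ) (P Q : ℝ → ℝ) (θ : ℝ) : Prop :=
  ∃ C > 0, ∀ᶠ ε in 𝓝[>] (0 : ℝ), ∀ (T : ℝ) (u a b : ℝ → ℝ → ℝ),
    WaveSystem p q r A B (fun x => ε * P x) (fun x => ε * Q x) T u a b → T ≤ C * ε ^ (-θ)

theorem one_le_rpow_neg {ε θ : ℝ} (h0 : 0 < ε) (h1 : ε ≤ 1) (hθ : 0 ≤ θ) : 1 ≤ ε ^ (-θ) :=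
  Real.one_le_rpow_of_pos_of_le_one_of_nonpos h0 h1 (by linarith)

namespace UpperPowerBound

variable {p q r A B : ℝ} {P Q : ℝ → ℝ} {R c θ : ℝ}

theorem of_reflect (hP : IsProfile P R c) (hQ : IsProfile Q R (-c))
    (h : UpperPowerBound p q r A B (fun y => Q (-y) + c) (fun y => P (-y) + -c) θ) :
    UpperPowerBound p q r A B P Q θ := by
  obtain ⟨C, hC, h⟩ := h
  refine ⟨C, hC, h.mono fun ε hε T u a b hw => ?_⟩
  have hQ' := hQ.smul ε
  rw [mul_neg] at hQ'
  have h1 := WaveSystem.reflect (hP.smul ε) hQ' hw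
  refine hε T (fun x t => u (-x) t) (fun x t => b (-x) t) (fun x t => a (-x) t) ?_
  simp only [mul_add, mul_neg]
  exact h1

/-- A bound of the form which the doubling argument yields. -/
theorem of_doubling {K μ γ s N : ℝ} (hK : 0 ≤ K) (hμ : 0 < μ) (hN : 0 < N) (hγ : 0 < γ)
    (hθ : θ = s * γ)
    (h : ∀ᶠ ε in 𝓝[>] (0 : ℝ), ∀ (T : ℝ) (u a b : ℝ → ℝ → ℝ),
      WaveSystem p q r A B (fun x => ε * P x) (fun x => ε * Q x) T u a b → T ≤ N * ε ^ (-θ) ∨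
        T ≤ N * ε ^ (-θ) + K * (μ * ε ^ s) ^ (-γ) / (1 - 2 ^ (-γ))) :
    UpperPowerBound p q r A B P Q θ := by
  have h2 : (0 : ℝ) < 1 - 2 ^ (-γ) :=
    sub_pos.2 (Real.rpow_lt_one_of_one_lt_of_neg (by norm_num) (by linarith))
  refine ⟨N + K * μ ^ (-γ) / (1 - 2 ^ (-γ)), by positivity, ?_⟩
  filter_upwards [h, eventually_pos_le one_pos] with ε h1 hε T u a b hw
  have e : K * (μ * ε ^ s) ^ (-γ) / (1 - 2 ^ (-γ)) = K * μ ^ (-γ) / (1 - 2 ^ (-γ)) * ε ^ (-θ) := by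
    have h0 := hε.1
    rw [Real.mul_rpow hμ.le (by positivity), ← Real.rpow_mul hε.1.le, hθ]
    ring_nf
  have h3 : 0 ≤ K * μ ^ (-γ) / (1 - 2 ^ (-γ)) * ε ^ (-θ) := by
    have := hε.1; positivity
  rw [add_mul]
  rcases h1 T u a b hw with h4 | h4
  · linarith
  · rw [e] at h4; exact h4

section

variable (hp : 1 < p) (hq : q = 0 ∨ 1 < q) (hr : 1 < r) (hA : 0 < A) (hB : 0 < B) (hR : 1 ≤ R)

include hp hq hr hA hB hR

/-- At `(0, R)` the free solution already has its positive interior value `c ε`, from which the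
doubling by `|u|^r` starts. -/
theorem of_pos_sum (hP : IsProfile P R c) (hQ : IsProfile Q R (-c)) (hc : 0 < c) :
    UpperPowerBound p q r A B P Q ((r - 1) / 2) := by
  refine of_doubling (K := 2 / √B) (μ := c) (γ := (r - 1) / 2) (s := 1) (N := R) (by positivity) hc
    (by linarith) (by linarith) (by ring) ?_
  filter_upwards [eventually_pos_le one_pos] with ε hε T u a b hw
  have hN : R ≤ R * ε ^ (-((r - 1) / 2)) :=
    le_mul_of_one_le_right (by linarith) (one_le_rpow_neg hε.1 hε.2 (by linarith))
  have hQ' := hQ.smul ε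
  rw [mul_neg] at hQ'
  rcases le_or_gt T R with hT | hT
  · exact Or.inl (hT.trans hN)
  refine Or.inr ?_
  have h1 := hw.free_le hA.le hB.le (hP.smul ε) (x := 0) (t := R) (by linarith) hT
  rw [hP.right _ (by linarith), hQ.left _ (by linarith), mul_zero, add_zero, mul_comm] at h1
  have := hw.lifespan_le_of_pos_inside hp hq hr hA hB (hP.smul ε) hQ' (x := 0) (t := R)
    (by linarith) (by linarith) (by linarith) (mul_pos hc hε.1) h1
  rw [Real.rpow_one]
  linarith

/-- From time `R` on the free solution equals `ε (Q y₀ + c) > 0` on the line `x - t = y₀` in the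
strip, from which the doubling by the mixed term starts. -/
theorem of_pos_level (hP : IsProfile P R c) (hQ : IsProfile Q R (-c)) {y₀ : ℝ} (h₁ : -R ≤ y₀)
    (h₂ : y₀ ≤ R) (hy : 0 < Q y₀ + c) :
    UpperPowerBound p q r A B P Q (p + q - 1) := by
  have hq0 : 0 ≤ q := by rcases hq with h | h <;> linarith
  have hk := mixedConst_pos hp hq0 hA hR
  refine of_doubling (K := 1 / mixedConst p q A R) (μ := Q y₀ + c) (γ := p + q - 1) (s := 1)
    (N := R) (by positivity) hy (by linarith) (by linarith) (by ring) ?_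
  filter_upwards [eventually_pos_le one_pos] with ε hε T u a b hw
  have hN : R ≤ R * ε ^ (-(p + q - 1)) :=
    le_mul_of_one_le_right (by linarith) (one_le_rpow_neg hε.1 hε.2 (by linarith))
  have hQ' := hQ.smul ε
  rw [mul_neg] at hQ'
  rcases le_or_gt T R with hT | hT
  · exact Or.inl (hT.trans hN)
  refine Or.inr ?_
  have h1 := hw.free_le hA.le hB.le (hP.smul ε) (x := y₀ + R) (t := R) (by linarith) hT
  rw [hP.right _ (by linarith), add_sub_cancel_right] at h1
  have := hw.lifespan_le_of_pos_level hp hq hr hA hB hR (hP.smul ε) hQ' h₁ h₂ le_rfl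
    (mul_pos hy hε.1) (by linarith)
  rw [Real.rpow_one]
  linarith

theorem of_pos_level_left (hP : IsProfile P R c) (hQ : IsProfile Q R (-c)) {y₀ : ℝ} (h₁ : -R ≤ y₀)
    (h₂ : y₀ ≤ R) (hy : 0 < P y₀) :
    UpperPowerBound p q r A B P Q (p + q - 1) := by
  refine of_reflect hP hQ (of_pos_level hp hq hr hA hB hR (c := c) (hQ.reflect (by ring))
    (hP.reflect rfl) (y₀ := -y₀) (by linarith) (by linarith) ?_)
  simpa using hy

/-- By the existence theorem and uniqueness, every solution is still close to the negative constant
`ε c` at a time `L` of order `ε^(-(r-1)/2)`. Then `pos_of_neg_corner` makes it positive of order `ε`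
within a time of the same order, and the doubling by `|u|^r` takes over. -/
theorem of_neg_sum (hP : IsProfile P R c) (hQ : IsProfile Q R (-c)) (hc : c < 0)
    (hpq : (r - 1) / 2 ≤ p + q - 1) :
    UpperPowerBound p q r A B P Q ((r - 1) / 2) := by
  set γ := (r - 1) / 2 with hγ
  have hγ0 : 0 < γ := by rw [hγ]; linarith
  have hGd := contDiff_nonlin hp hq hr A B
  obtain ⟨c₁, hc₁, hex⟩ := eventually_exists_solution hp hq hr hA hB hP hQ hR (κ := -c / 10)
    (by linarith)
  rw [min_eq_right hpq] at hex
  have hd : 0 < -c := by linarith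
  set D : ℝ := B * (-c / 16) ^ r * (c₁ / 8) with hD
  have hD0 : 0 < D := by positivity
  -- The first summand makes `Λ = K X` exceed `L`; the second makes the source on the rectangle with
  -- sides `Λ` and `(L - R) / 2` add at least `-ε c`.
  set K : ℝ := c₁ + -c / D with hK
  have hK0 : 0 < K := by positivity
  refine of_doubling (K := 2 / √B) (μ := -c / 2) (γ := γ) (s := 1) (N := R + 2 * K)
    (by positivity) (by linarith) (by linarith) hγ0 (by ring) ?_
  filter_upwards [hex, eventually_pos_le one_pos,
    (tendsto_mul_rpow_neg_atTop (c := c₁ / 2) (by positivity) hγ0).eventually_ge_atTop (2 * R)]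
    with ε ⟨u', hu', hb⟩ hε hL T u a b hw
  have hε0 := hε.1
  set X := ε ^ (-γ) with hX
  have hX1 : 1 ≤ X := one_le_rpow_neg hε.1 hε.2 hγ0.le
  have hX0 : 0 < X := by linarith
  have hN : R + 2 * (K * X) ≤ (R + 2 * K) * X := by nlinarith
  have hQ' := hQ.smul ε
  rw [mul_neg] at hQ'
  rcases le_or_gt T (R + 2 * (K * X)) with hT | hT
  · exact Or.inl (hT.trans hN)
  refine Or.inr ?_
  have hKc : c₁ ≤ K := by rw [hK]; linarith [div_pos hd hD0]
  have hKX : c₁ * X ≤ K * X := by gcongr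
  set L := c₁ / 2 * X with hLdef
  have hL1 : L < c₁ * X := by rw [hLdef]; nlinarith
  have hLT : L < T := by linarith
  -- The given solution and the constructed one agree as long as both exist. The tolerance `κ = -c /
  -- 10` then yields the bound `9 / 10 * (ε * c)`.
  have hval : u 0 L = u' 0 L := by
    obtain ⟨a', b', h'⟩ := hu'.charSystem (φ' := fun x => ε * (deriv P x + deriv Q x))
      hGd.continuous (fun x => ((hP.hasDerivAt x).add (hQ.hasDerivAt x)).const_mul ε) (by linarith)
    refine (CharSystem.eq_of_eqOn (G := nonlin p q r A B) (T := min T (c₁ * X)) hGd (CharSystem.mono hw (min_le_left _ _))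
      (h'.mono (min_le_right _ _)) (by linarith) (lt_min hLT hL1) ?_ ?_ ?_).1
    · intro y _; exact (mul_add _ _ _).symm
    · intro y _
      rw [hP.deriv_smul]; ring
    · intro y _
      rw [hQ.deriv_smul]; ring
  have h1 : u 0 L ≤ 9 / 10 * (ε * c) := by
    have := hb 0 L ⟨by linarith, hL1⟩
    rw [hP.right _ (by linarith), hQ.left _ (by linarith)] at this
    rw [hval]; linarith
  have hprod : -(ε * c) ≤ B * (-(ε * c) / 16) ^ r * (K * X) * ((L - R) / 2) := by
    have e1 : (-(ε * c) / 16) ^ r = ε ^ r * (-c / 16) ^ r := by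
      rw [← Real.mul_rpow hε0.le (by positivity)]; congr 1; ring
    have e2 : ε ^ r * X * X = ε := by
      rw [hX, ← Real.rpow_add hε0, ← Real.rpow_add hε0]
      convert! Real.rpow_one ε using 2; rw [hγ]; ring
    have h2 : c₁ / 8 * X ≤ (L - R) / 2 := by linarith
    calc -(ε * c) = D * (-c / D) * ε := by field_simp
      _ ≤ D * K * ε := by
          have : -c / D ≤ K := by rw [hK]; linarith
          gcongr
      _ = B * (ε ^ r * (-c / 16) ^ r) * (K * X) * (c₁ / 8 * X) := by
          nth_rewrite 1 [← e2]; rw [hD]; ring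
      _ ≤ B * (-(ε * c) / 16) ^ r * (K * X) * ((L - R) / 2) := by
          rw [e1]; gcongr
  have h3 := hw.pos_of_neg_corner hp hq hr hA hB hR (hP.smul ε) hQ' (L := L) (Λ := K * X)
    (mul_neg_of_pos_of_neg hε0 hc) (by linarith) h1 (by linarith) hprod hT
  have h4 := hw.lifespan_le_of_pos_inside hp hq hr hA hB (hP.smul ε) hQ' (x := 0)
    (t := R + 2 * (K * X)) (M := -c / 2 * ε) (by positivity) (by nlinarith) (by nlinarith)
    (by positivity) (by linarith)
  rw [Real.rpow_one]
  linarith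

/-- Growth at rate `k ε^(p+q)` along the edge reaches order `ε` within a time of order
`ε^(-(p+q-1))`. The doubling by the mixed term at `y₀ = -R` takes a time of the same order. -/
theorem of_zero_sum_mixed (hP : IsProfile P R 0) (hQ : IsProfile Q R 0) (hne : Q ≠ 0) :
    UpperPowerBound p q r A B P Q (p + q - 1) := by
  have hq0 : 0 ≤ q := by rcases hq with h | h <;> linarith
  have hk := mixedConst_pos hp hq0 hA hR
  obtain ⟨κ, hκ, k, hk0, hgr⟩ := WaveSystem.exists_growth hp hq hr hA hB hR hP hQ hne
    (Or.inl (rfl : p + q = p + q))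
  refine of_doubling (K := 1 / mixedConst p q A R) (μ := κ) (γ := p + q - 1) (s := 1)
    (N := R + κ / k) (by positivity) hκ (by positivity) (by linarith) (by ring) ?_
  filter_upwards [eventually_pos_le one_pos] with ε hε T u a b hw
  have hε0 := hε.1
  set X := ε ^ (-(p + q - 1)) with hX
  have hX1 : 1 ≤ X := one_le_rpow_neg hε.1 hε.2 (by linarith)
  have hN : R + κ / k * X ≤ (R + κ / k) * X := by nlinarith
  have hQ' := hQ.smul ε
  have hP' := hP.smul ε
  rw [mul_zero] at hQ' hP'
  rcases le_or_gt T (R + κ / k * X) with hT | hT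
  · exact Or.inl (hT.trans hN)
  refine Or.inr ?_
  have hkX : 0 ≤ κ / k * X := by positivity
  have h1 : κ * ε ≤ u (-R + (R + κ / k * X)) (R + κ / k * X) := by
    rcases hgr ε hε0 T u a b hw (R + κ / k * X) (by linarith) hT with h1 | h1
    · exact h1
    · refine le_trans (le_of_eq ?_) h1
      have : ε ^ (p + q) * X = ε := by
        rw [hX, ← Real.rpow_add hε0]
        convert! Real.rpow_one ε using 2; ring
      calc κ * ε = κ * (ε ^ (p + q) * X) := by rw [this]
        _ = k * ε ^ (p + q) * (R + κ / k * X - R) := by field_simp; ring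
  have h2 := hw.lifespan_le_of_pos_level hp hq hr hA hB hR (c := 0) hP' (by simpa using hQ')
    (y₀ := -R) le_rfl (by linarith) (by linarith) (by positivity) h1
  rw [Real.rpow_one]
  linarith

/-- Two phases of equal order, with `θ = m(r-1)/(r+1)`: after a time `ε^(-θ)` the edge value is of
order `ε^(m-θ) = ε^(2m/(r+1))`, and doubling it by `|u|^r` again takes `ε^(-θ)`. The condition
`(r+1)/2 ≤ m` means `2m/(r+1) ≥ 1`, so the alternative of an edge value of order `ε` is at least as
good. -/
theorem of_zero_sum (hP : IsProfile P R 0) (hQ : IsProfile Q R 0) (hne : Q ≠ 0) {m : ℝ}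
    (hm : m = p + q ∨ m = r) (hmr : (r + 1) / 2 ≤ m) :
    UpperPowerBound p q r A B P Q (m * (r - 1) / (r + 1)) := by
  obtain ⟨κ, hκ, k, hk0, hgr⟩ := WaveSystem.exists_growth hp hq hr hA hB hR hP hQ hne hm
  have hr1 : 0 < r + 1 := by linarith
  have hs1 : 1 ≤ 2 * m / (r + 1) := by rw [le_div_iff₀ hr1]; linarith
  have hθ0 : 0 ≤ m * (r - 1) / (r + 1) :=
    div_nonneg (mul_nonneg (by linarith) (by linarith)) hr1.le
  refine of_doubling (K := 2 / √B) (μ := min κ k) (γ := (r - 1) / 2) (s := 2 * m / (r + 1))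
    (N := R + 1) (by positivity) (lt_min hκ hk0) (by positivity) (by linarith)
    (by field_simp) ?_
  filter_upwards [eventually_pos_le one_pos] with ε hε T u a b hw
  have hε0 := hε.1
  set X := ε ^ (-(m * (r - 1) / (r + 1))) with hX
  have hX1 : 1 ≤ X := one_le_rpow_neg hε.1 hε.2 hθ0
  have hN : R + X ≤ (R + 1) * X := by nlinarith
  have hQ' := hQ.smul ε
  have hP' := hP.smul ε
  rw [mul_zero] at hQ' hP'
  rcases le_or_gt T (R + X) with hT | hT
  · exact Or.inl (hT.trans hN)
  refine Or.inr ?_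
  have h1 : min κ k * ε ^ (2 * m / (r + 1)) ≤ u (-R + (R + X)) (R + X) := by
    rcases hgr ε hε0 T u a b hw (R + X) (by linarith) hT with h1 | h1
    · refine le_trans ?_ h1
      have h2 : ε ^ (2 * m / (r + 1)) ≤ ε := by
        simpa using Real.rpow_le_rpow_of_exponent_ge hε0 hε.2 hs1
      exact mul_le_mul (min_le_left _ _) h2 (by positivity) hκ.le
    · refine le_trans ?_ h1
      have : ε ^ m * X = ε ^ (2 * m / (r + 1)) := by
        rw [hX, ← Real.rpow_add hε0]
        congr 1; field_simp; ring
      rw [add_sub_cancel_left, mul_assoc, this]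
      gcongr
      exact min_le_right _ _
  have h2 := hw.lifespan_le_of_pos_inside hp hq hr hA hB (c := 0) hP' (by simpa using hQ')
    (by linarith) (by linarith) (by linarith) (mul_pos (lt_min hκ hk0) (by positivity)) h1
  linarith

end

end UpperPowerBound

/-! ### Splitting of the data, and passage to the lifespan -/

theorem hasDerivAt_integral_Iic {g : ℝ → ℝ} (hg : Continuous g) (hgc : HasCompactSupport g) (x : ℝ) :
    HasDerivAt (fun x => ∫ y in Iic x, g y) (g x) x := by
  have hi := hg.integrable_of_hasCompactSupport hgc (μ := volume)
  have e : (fun x => ∫ y in Iic x, g y) = fun x => (∫ y in Iic (0 : ℝ), g y) + ∫ y in (0 : ℝ)..x, g y := by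
    funext x
    rw [← intervalIntegral.integral_Iic_sub_Iic hi.integrableOn hi.integrableOn]
    ring
  rw [e]
  exact (intervalIntegral.integral_hasDerivAt_right hi.intervalIntegrable
    (hg.stronglyMeasurableAtFilter _ _) hg.continuousAt).const_add _

theorem contDiff_integral_Iic {g : ℝ → ℝ} (hg : ContDiff ℝ 1 g) (hgc : HasCompactSupport g) :
    ContDiff ℝ 2 (fun x => ∫ y in Iic x, g y) := by
  have h := hasDerivAt_integral_Iic hg.continuous hgc
  have e : (2 : WithTop ℕ∞) = 1 + 1 := by norm_num
  rw [e, contDiff_succ_iff_deriv]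
  refine ⟨fun x => (h x).differentiableAt, by simp, ?_⟩
  rwa [show deriv (fun x => ∫ y in Iic x, g y) = g from funext fun x => (h x).deriv]

/-- The splitting of the data into the profiles of d'Alembert's formula. -/
theorem exists_profiles {f g : ℝ → ℝ} (hf : ContDiff ℝ 2 f) (hg : ContDiff ℝ 1 g)
    (hfc : HasCompactSupport f) (hgc : HasCompactSupport g) :
    ∃ (P Q : ℝ → ℝ) (R : ℝ), 1 ≤ R ∧ IsProfile P R ((∫ x, g x) / 2) ∧
      IsProfile Q R (-((∫ x, g x) / 2)) ∧ (f = fun x => P x + Q x) ∧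
      (g = fun x => deriv P x - deriv Q x) ∧ (∀ x, f x + (∫ y in Iic x, g y) = 2 * P x) ∧
      ∀ x, f x + (∫ y in Ioi x, g y) = 2 * (Q x + (∫ x, g x) / 2) := by
  obtain ⟨R₀, hR₀⟩ := (hfc.isCompact.union hgc.isCompact).isBounded.subset_closedBall 0
  set R := |R₀| + 1 with hR
  have hout : ∀ x, R ≤ |x| → f x = 0 ∧ g x = 0 := by
    intro x hx
    have : x ∉ tsupport f ∪ tsupport g := fun h => by
      have := hR₀ h
      rw [mem_closedBall_zero_iff, Real.norm_eq_abs] at this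
      linarith [le_abs_self R₀]
    exact ⟨image_eq_zero_of_notMem_tsupport fun h => this (Or.inl h),
      image_eq_zero_of_notMem_tsupport fun h => this (Or.inr h)⟩
  have hgi := hg.continuous.integrable_of_hasCompactSupport hgc (μ := volume)
  have hleft : ∀ x ≤ -R, f x = 0 ∧ ∫ y in Iic x, g y = 0 := fun x hx =>
    ⟨(hout x (by rw [abs_of_neg (by linarith [abs_nonneg R₀])]; linarith)).1,
      setIntegral_eq_zero_of_forall_eq_zero fun y hy => (hout y (by
        have : y ≤ x := hy
        rw [abs_of_neg (by linarith [abs_nonneg R₀])]; linarith)).2⟩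
  have hsum : ∀ x, (∫ y in Iic x, g y) + ∫ y in Ioi x, g y = ∫ y, g y := fun x => by
    rw [← compl_Iic]
    exact integral_add_compl measurableSet_Iic hgi
  have hright : ∀ x, R ≤ x → f x = 0 ∧ ∫ y in Iic x, g y = ∫ y, g y := fun x hx =>
    ⟨(hout x (hx.trans (le_abs_self x))).1, by
      rw [← hsum x, setIntegral_eq_zero_of_forall_eq_zero (t := Ioi x) fun y hy => (hout y (by
        have : x < y := hy
        exact (hx.trans this.le).trans (le_abs_self y))).2, add_zero]⟩
  have hG := contDiff_integral_Iic hg hgc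
  have hGd := hasDerivAt_integral_Iic hg.continuous hgc
  have hfd : ∀ x, HasDerivAt f (deriv f x) x := fun x =>
    (hf.differentiable (by norm_num) x).hasDerivAt
  refine ⟨fun x => (f x + ∫ y in Iic x, g y) / 2, fun x => (f x - ∫ y in Iic x, g y) / 2, R,
    by linarith [abs_nonneg R₀], ⟨(hf.add hG).div_const 2, ?_, ?_⟩,
    ⟨(hf.sub hG).div_const 2, ?_, ?_⟩, ?_, ?_, ?_, ?_⟩
  · intro x hx
    simp [(hleft x hx).1, (hleft x hx).2]
  · intro x hx
    simp [(hright x hx).1, (hright x hx).2]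
  · intro x hx
    simp [(hleft x hx).1, (hleft x hx).2]
  · intro x hx
    simp only [(hright x hx).1, (hright x hx).2]
    ring
  · funext x; ring
  · funext x
    have h1 : deriv (fun x => (f x + ∫ y in Iic x, g y) / 2) x = (deriv f x + g x) / 2 :=
      (((hfd x).add (hGd x)).div_const 2).deriv
    have h2 : deriv (fun x => (f x - ∫ y in Iic x, g y) / 2) x = (deriv f x - g x) / 2 :=
      (((hfd x).sub (hGd x)).div_const 2).deriv
    rw [h1, h2]
    ring
  · intro x; ring
  · intro x
    rw [← hsum x]; ring

theorem exists_forall_of_eventually {p : ℝ → Prop} (h : ∀ᶠ ε in 𝓝[>] (0 : ℝ), p ε) :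
    ∃ ε₀ > 0, ∀ ε : ℝ, 0 < ε → ε ≤ ε₀ → p ε := by
  obtain ⟨ε₀, h1, h2⟩ := mem_nhdsGT_iff_exists_Ioc_subset.1 h
  exact ⟨ε₀, h1, fun ε h3 h4 => h2 ⟨h3, h4⟩⟩

theorem IsClassicalSolution.waveSystem {p q r A B : ℝ} (hp : 1 < p) (hq : q = 0 ∨ 1 < q)
    (hr : 1 < r) {P Q : ℝ → ℝ} {R c ε T : ℝ} (hP : IsProfile P R c) (hQ : IsProfile Q R (-c))
    (hT : 0 < T) {u : ℝ → ℝ → ℝ} (h : IsClassicalSolution p q r A B (fun x => ε * (P x + Q x))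
      (fun x => ε * (deriv P x - deriv Q x)) T u) :
    ∃ a b, WaveSystem p q r A B (fun x => ε * P x) (fun x => ε * Q x) T u a b := by
  obtain ⟨a, b, h⟩ := h.charSystem (φ' := fun x => ε * (deriv P x + deriv Q x))
    (contDiff_nonlin hp hq hr A B).continuous
    (fun x => ((hP.hasDerivAt x).add (hQ.hasDerivAt x)).const_mul ε) hT
  refine ⟨a, b, ?_⟩
  unfold WaveSystem
  convert! h using 1
  · funext x; exact (mul_add _ _ _).symm
  · funext x; rw [hP.deriv_smul]; ring
  · funext x; rw [hQ.deriv_smul]; ring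

theorem UpperPowerBound.eventually_lifespan_le {p q r A B : ℝ} (hp : 1 < p) (hq : q = 0 ∨ 1 < q)
    (hr : 1 < r) {P Q : ℝ → ℝ} {R c θ : ℝ} (hP : IsProfile P R c) (hQ : IsProfile Q R (-c))
    (h : UpperPowerBound p q r A B P Q θ) : ∃ C > 0, ∀ᶠ ε in 𝓝[>] (0 : ℝ),
      lifespan p q r A B (fun x => P x + Q x) (fun x => deriv P x - deriv Q x) ε
        ≤ ENNReal.ofReal (C * ε ^ (-θ)) := by
  obtain ⟨C, hC, h⟩ := h
  refine ⟨C, hC, h.mono fun ε hε => sSup_le ?_⟩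
  rintro τ ⟨T, hT, rfl, u, hu⟩
  obtain ⟨a, b, hw⟩ := hu.waveSystem hp hq hr hP hQ hT
  exact ENNReal.ofReal_le_ofReal (hε T u a b hw)

theorem eventually_le_lifespan {p q r A B : ℝ} {P Q : ℝ → ℝ} {θ c₁ : ℝ} (hc₁ : 0 < c₁)
    (h : ∀ᶠ ε in 𝓝[>] (0 : ℝ), ∃ u, IsClassicalSolution p q r A B (fun x => ε * (P x + Q x))
      (fun x => ε * (deriv P x - deriv Q x)) (c₁ * ε ^ (-θ)) u) :
    LowerPowerBound (lifespan p q r A B (fun x => P x + Q x) fun x => deriv P x - deriv Q x) θ := by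
  obtain ⟨ε₀, h0, h1⟩ := exists_forall_of_eventually h
  refine ⟨ε₀, h0, c₁, hc₁, fun ε h2 h3 => ?_⟩
  obtain ⟨u, hu⟩ := h1 ε h2 h3
  exact IsClassicalSolution.le_lifespan (by positivity) hu

theorem LowerPowerBound.simPower {L : ℝ → ℝ≥0∞} {θ : ℝ} (h : LowerPowerBound L θ)
    (h' : ∃ C > 0, ∀ᶠ ε in 𝓝[>] (0 : ℝ), L ε ≤ ENNReal.ofReal (C * ε ^ (-θ))) : SimPower L θ := by
  obtain ⟨ε₁, h1, C₁, hC₁, h⟩ := h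
  obtain ⟨C₂, hC₂, h'⟩ := h'
  obtain ⟨ε₂, h2, h'⟩ := exists_forall_of_eventually h'
  exact ⟨min ε₁ ε₂, lt_min h1 h2, C₁, hC₁, C₂, hC₂, fun ε h3 h4 =>
    ⟨h ε h3 (h4.trans (min_le_left _ _)), h' ε h3 (h4.trans (min_le_right _ _))⟩⟩

theorem eventually_lt_of_exponent_lt {L : ℝ → ℝ≥0∞} {θ θ' : ℝ} (hθ : θ < θ')
    (h : ∃ C > 0, ∀ᶠ ε in 𝓝[>] (0 : ℝ), L ε ≤ ENNReal.ofReal (C * ε ^ (-θ))) {c : ℝ} (hc : 0 < c) :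
    ∀ᶠ ε in 𝓝[>] (0 : ℝ), L ε < ENNReal.ofReal (c * ε ^ (-θ')) := by
  obtain ⟨C, hC, h⟩ := h
  filter_upwards [h, eventually_pos_le one_pos,
    (tendsto_mul_rpow_neg_atTop hc (sub_pos.2 hθ)).eventually_gt_atTop C] with ε h1 hε h2
  refine h1.trans_lt ((ENNReal.ofReal_lt_ofReal_iff ?_).2 ?_)
  · have := hε.1; positivity
  · have e : ε ^ (-θ') = ε ^ (-(θ' - θ)) * ε ^ (-θ) := by
      rw [← Real.rpow_add hε.1]; congr 1; ring
    rw [e, ← mul_assoc]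
    exact mul_lt_mul_of_pos_right h2 (Real.rpow_pos_of_pos hε.1 _)

/-- The growth estimate is made at the edge governed by `Q`. Reflection exchanges the roles of the
two profiles, so it is enough that one of them is nonzero. -/
theorem UpperPowerBound.of_nonzero_profiles {p q r A B R θ : ℝ} {P Q : ℝ → ℝ}
    (hP : IsProfile P R 0) (hQ : IsProfile Q R 0) (hne : P ≠ 0 ∨ Q ≠ 0)
    (h : ∀ P Q : ℝ → ℝ, IsProfile P R 0 → IsProfile Q R 0 → Q ≠ 0 →
      UpperPowerBound p q r A B P Q θ) : UpperPowerBound p q r A B P Q θ := by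
  by_cases hQ0 : Q = 0
  · have hP0 : P ≠ 0 := hne.resolve_right (not_not_intro hQ0)
    refine of_reflect (c := 0) hP (by simpa using hQ)
      (h _ (fun y => P (-y) + -0) (hQ.reflect neg_zero.symm)
        (by simpa using hP.reflect (d := 0) neg_zero.symm) fun h0 => hP0 ?_)
    funext x
    simpa using congrFun h0 (-x)
  · exact h P Q hP hQ hQ0

theorem theorem2p1 (p q r A₀ B₀ : ℝ) (hp : 1 < p) (hq : q = 0 ∨ 1 < q) (hr : 1 < r)
    (hA : 0 < A₀) (hB : 0 < B₀) (f g : ℝ → ℝ)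
    (hf : ContDiff ℝ 2 f) (hg : ContDiff ℝ 1 g)
    (hfc : HasCompactSupport f) (hgc : HasCompactSupport g)
    (hne : f ≠ 0 ∨ g ≠ 0) :
    -- nonzero total initial speed
    ((∫ x, g x) ≠ 0 →
      LowerPowerBound (lifespan p q r A₀ B₀ f g) (min (p + q - 1) ((r - 1) / 2)) ∧
      (((∫ x, g x) < 0 → p + q < (r + 1) / 2 →
          ∃ x, 0 < f x + (∫ y in Ioi x, g y) ∨ 0 < f x + (∫ y in Iic x, g y)) →
        SimPower (lifespan p q r A₀ B₀ f g) (min (p + q - 1) ((r - 1) / 2)))) ∧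
    -- zero total initial speed, outside the exceptional range
    ((∫ x, g x) = 0 → ¬ ((r + 1) / 2 < p + q ∧ p + q < r) →
      SimPower (lifespan p q r A₀ B₀ f g) (min (p + q - 1) (r * (r - 1) / (r + 1)))) ∧
    -- zero total initial speed, exceptional range
    ((∫ x, g x) = 0 → (r + 1) / 2 < p + q → p + q < r →
      SimPower (lifespan p q r A₀ B₀ f g) ((p + q) * (r - 1) / (r + 1)) ∧
      (p + q) * (r - 1) / (r + 1) < min (p + q - 1) (r * (r - 1) / (r + 1)) ∧
      ∀ c > 0, ∀ᶠ ε in 𝓝[>] (0 : ℝ), lifespan p q r A₀ B₀ f g ε <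
        ENNReal.ofReal (c * ε ^ (-(min (p + q - 1) (r * (r - 1) / (r + 1)))))) := by
  obtain ⟨P, Q, R, hR, hP, hQ, hfe, hge, hleft, hright⟩ := exists_profiles hf hg hfc hgc
  have hr1 : 0 < r + 1 := by linarith
  have upper : ∀ {θ}, UpperPowerBound p q r A₀ B₀ P Q θ → ∃ C > 0, ∀ᶠ ε in 𝓝[>] (0 : ℝ),
      lifespan p q r A₀ B₀ f g ε ≤ ENNReal.ofReal (C * ε ^ (-θ)) := fun h => by
    have := h.eventually_lifespan_le hp hq hr hP hQ
    rwa [← hfe, ← hge] at this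
  have lower0 : (∫ x, g x) = 0 → LowerPowerBound (lifespan p q r A₀ B₀ f g)
      (min (p + q - 1) (min (p + q) r * (r - 1) / (r + 1))) := fun h0 => by
    obtain ⟨c₁, hc₁, h⟩ := eventually_exists_solution_of_zero hp hq hr hA hB hP hQ hR
      (by rw [h0, zero_div]) rfl
    have := eventually_le_lifespan hc₁ h
    rwa [← hfe, ← hge] at this
  have profiles0 : (∫ x, g x) = 0 → IsProfile P R 0 ∧ IsProfile Q R 0 ∧ (P ≠ 0 ∨ Q ≠ 0) :=
    fun h0 => by
      rw [h0, zero_div] at hP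
      rw [h0, zero_div, neg_zero] at hQ
      refine ⟨hP, hQ, ?_⟩
      by_contra! h
      have hd : deriv (0 : ℝ → ℝ) = 0 := by funext x; simp
      rcases hne with h1 | h1
      · exact h1 (by rw [hfe]; funext x; simp [h.1, h.2])
      · exact h1 (by rw [hge]; funext x; simp [h.1, h.2, hd])
  have upper_mixed : (∫ x, g x) = 0 → UpperPowerBound p q r A₀ B₀ P Q (p + q - 1) := fun h0 => by
    obtain ⟨h1, h2, h3⟩ := profiles0 h0
    exact .of_nonzero_profiles h1 h2 h3 fun P Q hP hQ hne =>
      .of_zero_sum_mixed hp hq hr hA hB hR hP hQ hne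
  have upper_m : (∫ x, g x) = 0 → ∀ m, m = p + q ∨ m = r → (r + 1) / 2 ≤ m →
      UpperPowerBound p q r A₀ B₀ P Q (m * (r - 1) / (r + 1)) := fun h0 m hm hmr => by
    obtain ⟨h1, h2, h3⟩ := profiles0 h0
    exact .of_nonzero_profiles h1 h2 h3 fun P Q hP hQ hne =>
      .of_zero_sum hp hq hr hA hB hR hP hQ hne hm hmr
  refine ⟨fun h0 => ?_, fun h0 hpq => ?_, fun h0 h1 h2 => ?_⟩
  · have lower : LowerPowerBound (lifespan p q r A₀ B₀ f g) (min (p + q - 1) ((r - 1) / 2)) := by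
      obtain ⟨c₁, hc₁, h⟩ := eventually_exists_solution hp hq hr hA hB hP hQ hR one_pos
      have := eventually_le_lifespan hc₁ (h.mono fun ε ⟨u, hu, _⟩ => ⟨u, hu⟩)
      rwa [← hfe, ← hge] at this
    refine ⟨lower, fun hex => lower.simPower (upper ?_)⟩
    rcases le_or_gt ((r - 1) / 2) (p + q - 1) with h1 | h1
    · rw [min_eq_right h1]
      rcases lt_or_gt_of_ne h0 with h2 | h2
      · exact .of_neg_sum hp hq hr hA hB hR hP hQ (by linarith) h1
      · exact .of_pos_sum hp hq hr hA hB hR hP hQ (by linarith)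
    · rw [min_eq_left h1.le]
      rcases lt_or_gt_of_ne h0 with h2 | h2
      · have hc : (∫ x, g x) / 2 < 0 := by linarith
        -- The extra assumption says that the free solution is positive somewhere in one of the two
        -- strips. The point lies in `[-R, R]` because outside it the expression is zero or equals
        -- the negative `∫ g`.
        obtain ⟨x, hx | hx⟩ := hex h2 (by linarith)
        · rw [hright] at hx
          refine .of_pos_level hp hq hr hA hB hR hP hQ (y₀ := x) ?_ ?_ (by linarith)
          · by_contra! h
            rw [hQ.left x h.le] at hx; linarith
          · by_contra! h
            rw [hQ.right x h.le] at hx; linarith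
        · rw [hleft] at hx
          refine .of_pos_level_left hp hq hr hA hB hR hP hQ (y₀ := x) ?_ ?_ (by linarith)
          · by_contra! h
            rw [hP.left x h.le] at hx; linarith
          · by_contra! h
            rw [hP.right x h.le] at hx; linarith
      · refine .of_pos_level hp hq hr hA hB hR hP hQ (y₀ := -R) le_rfl (by linarith) ?_
        rw [hQ.left _ le_rfl]; linarith
  · rcases le_or_gt (p + q) ((r + 1) / 2) with h1 | h1
    · have e : ∀ m, p + q ≤ m → p + q - 1 ≤ m * (r - 1) / (r + 1) := fun m hm => by
        rw [le_div_iff₀ hr1]; nlinarith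
      have hl := lower0 h0
      rw [min_eq_left (by linarith : p + q ≤ r), min_eq_left (e _ le_rfl)] at hl
      rw [min_eq_left (e r (by linarith))]
      exact hl.simPower (upper (upper_mixed h0))
    · have h2 : r ≤ p + q := by
        by_contra! h2
        exact hpq ⟨h1, h2⟩
      have e : r * (r - 1) / (r + 1) ≤ p + q - 1 := by
        rw [div_le_iff₀ hr1]; nlinarith
      have hl := lower0 h0
      rw [min_eq_right h2] at hl
      refine hl.simPower (upper ?_)
      rw [min_eq_right e]
      exact upper_m h0 r (Or.inr rfl) (by linarith)
  -- The two strict inequalities correspond exactly to the two ends `(r + 1) / 2 < p + q` and `p + q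
  -- < r` of the exceptional range.
  · have e1 : (p + q) * (r - 1) / (r + 1) < p + q - 1 := by
      rw [div_lt_iff₀ hr1]; nlinarith
    have e2 : (p + q) * (r - 1) / (r + 1) < r * (r - 1) / (r + 1) :=
      div_lt_div_of_pos_right (mul_lt_mul_of_pos_right h2 (by linarith)) hr1
    have hl := lower0 h0
    rw [min_eq_left h2.le, min_eq_right e1.le] at hl
    have hu := upper (upper_m h0 (p + q) (Or.inl rfl) h1.le)
    exact ⟨hl.simPower hu, lt_min e1 e2, fun c hc => eventually_lt_of_exponent_lt (lt_min e1 e2) hu hc⟩
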